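/- **Definitions.** Let $M$ be a connected smooth manifold (Hausdorff, second countable) of dimension $n$. A *sub-space-time* $(M,D,g,T)$ consists of a smooth bracket generating distribution $D\subset TM$ of constant rank $k$ with $2\le k<n$ (so $D$ is proper), a smoothly varying non-degenerate symmetric bilinear form $g$ of index $1$ on $D$, and a smooth vector field $T$ with $T_p\in D_p$ and $g(T,T)<0$ everywhere. For $p,q\in M$ write $p\ll q$ if there is an absolutely continuous curve $\gamma:[0,1]\to M$ with square integrable velocity, $\gamma(0)=p$, $\gamma(1)=q$, such that for almost every $t$: $\dot\gamma(t)\in D_{\gamma(t)}$, $g(\dot\gamma,\dot\gamma)<0$ and $g(T,\dot\gamma)<0$. Put $I^+(p)=\{q: p\ll q\}$ and $I^-(p)=\{q: q\ll p\}$. The *Alexandrov topology* $\mathscr A$ is the topology on $M$ generated by the subbasis $\{I^+(p),I^-(p): p\in M\}$; $\tau$ denotes the manifold topology. A *sub-Lorentzian isometry* is a diffeomorphism $\Phi$ of $M$ with $\Phi_*D=D$, $\Phi^*g=g$ and $g(\Phi_*T,T)<0$. If a group $G$ acts on $M$ freely and properly discontinuously by sub-Lorentzian isometries that preserve $T$,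 with Hausdorff quotient, then $M/G$ carries the sub-space-time structure for which the projection $\pi:M\to M/G$ is a covering map and a local diffeomorphism with $\pi_*D$, $\pi_*g$, $\pi_*T$ as distribution, metric and time orientation. **Theorem.** For sub-space-times all relations between $\mathscr A$ and $\tau$ occur. More precisely: 1. Let $\mathbb H$ be the Lorentzian Heisenberg group: $\mathbb R^3$ with $D=\mathrm{span}\{T,Y\}$, $T=\partial_x+\tfrac12 y\,\partial_z$, $Y=\partial_y-\tfrac12 x\,\partial_z$, $g(T,T)=-1$, $g(T,Y)=0$, $g(Y,Y)=1$, time orientation $T$. This is a sub-space-time, and $\tau=\mathscr A$. 2. For every $\varphi\in\mathbb R$ the maps $$\Phi_m(x,y,z)=\Bigl(x-m\cosh\varphi,\ y-m\sinh\varphi,\ z+\tfrac m2\,(y\cosh\varphi-x\sinh\varphi)\Bigr),\qquad m\in\mathbb Z,$$ form a group $G_\varphi$ acting freely and properly discontinuously by sub-Lorentzian isometries of $\mathbb H$, and on the quotient sub-space-time $\mathbb H/G_\varphi$ one has $\mathscr A\subsetneq\tau$. 3. Let $N=\mathbb R^3\setminus\{(0,2k,z): k\in\mathbb Z,\ z\in\mathbb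 R\}$ with $D=\mathrm{span}\{T,X\}$, $T=\partial_y+x^2\partial_z$, $X=\partial_x$, $g(T,T)=-1$, $g(T,X)=0$, $g(X,X)=1$, time orientation $T$. This is a sub-space-time on which $\mathbb Z$ acts freely and properly discontinuously by the sub-Lorentzian isometries $(x,y,z)\mapsto(x,y+2m,z)$, and on the quotient sub-space-time one has $\tau\subsetneq\mathscr A$. 4. Let $\mathbb R^3$ carry $D,g,T$ given by the same formulas as in 3. This is a sub-space-time on which $\mathbb Z$ acts freely and properly discontinuously by the sub-Lorentzian isometries $(x,y,z)\mapsto(x,y+m,z)$, and on the quotient sub-space-time one has $\tau\not\subset\mathscr A$ and $\mathscr A\not\subset\tau$. -/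

import Mathlib

open scoped Manifold ContDiff Topology
open MeasureTheory Set

noncomputable section

namespace SubLorentz

section Distributions

variable {n : ℕ} {M : Type*} [TopologicalSpace M] [ChartedSpace (EuclideanSpace ℝ (Fin n)) M]

/-- The vector field `V` is smooth on the set `U`. -/
def SmoothFieldOn [IsManifold (𝓡 n) ∞ M] (V : ∀ q : M, TangentSpace (𝓡 n) q) (U : Set M) : Prop :=
  ContMDiffOn (𝓡 n) (𝓡 n).tangent ∞ (fun q => (⟨q, V q⟩ : TangentBundle (𝓡 n) M)) U

/-- The fields `X 1, …, X k` take values in `D`, are smooth on `U` and span `D q` at each `q ∈ U`.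
(The values of the fields outside `U` play no role.) -/
def IsLocalFrame [IsManifold (𝓡 n) ∞ M] (D : ∀ q : M, Submodule ℝ (TangentSpace (𝓡 n) q))
    (U : Set M) {k : ℕ} (X : Fin k → ∀ q : M, TangentSpace (𝓡 n) q) : Prop :=
  (∀ i, SmoothFieldOn (X i) U) ∧ ∀ q ∈ U, D q = Submodule.span ℝ (range fun i => X i q)

/-- `X_I = [X_{i₁}, [X_{i₂}, … [X_{i_{N-1}}, X_{i_N}]]]` for `I = (i₁, …, i_N)`;
the empty multi-index gives `0`. -/
def iteratedBracket {k : ℕ} (X : Fin k → ∀ q : M, TangentSpace (𝓡 n) q) :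
    List (Fin k) → ∀ q : M, TangentSpace (𝓡 n) q
  | [] => 0
  | [i] => X i
  | i :: j :: l => VectorField.mlieBracket (𝓡 n) (X i) (iteratedBracket X (j :: l))

/-- Smooth distribution: it has smooth local frames near every point. -/
def IsSmoothDistribution [IsManifold (𝓡 n) ∞ M]
    (D : ∀ q : M, Submodule ℝ (TangentSpace (𝓡 n) q)) : Prop :=
  ∀ p : M, ∃ (U : Set M) (k : ℕ) (X : Fin k → ∀ q : M, TangentSpace (𝓡 n) q),
    IsOpen U ∧ p ∈ U ∧ IsLocalFrame D U X

/-- Bracket generating distribution: near every point `p` there is a smooth local frame whose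
iterated brackets, up to some length, span the tangent space at `p`. -/
def IsBracketGenerating [IsManifold (𝓡 n) ∞ M]
    (D : ∀ q : M, Submodule ℝ (TangentSpace (𝓡 n) q)) : Prop :=
  ∀ p : M, ∃ (N : ℕ) (U : Set M) (k : ℕ) (X : Fin k → ∀ q : M, TangentSpace (𝓡 n) q),
    IsOpen U ∧ p ∈ U ∧ IsLocalFrame D U X ∧
      Submodule.span ℝ {v | ∃ I : List (Fin k), I.length ≤ N ∧ iteratedBracket X I p = v} = ⊤

end Distributions

/-- A sub-space-time `(M, D, g, T)` on the smooth manifold `M` of dimension `n` (connected,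
Hausdorff, second countable): `D` is a smooth bracket generating distribution of constant rank `k`
with `2 ≤ k < n`, `g` is a smoothly varying symmetric non-degenerate bilinear form of index one on
`D`, and `T` is a smooth horizontal timelike vector field. -/
structure SubSpaceTime (n : ℕ) (M : Type*) [TopologicalSpace M]
    [ChartedSpace (EuclideanSpace ℝ (Fin n)) M] [IsManifold (𝓡 n) ∞ M] where
  /-- the horizontal distribution -/
  D : ∀ p : M, Submodule ℝ (TangentSpace (𝓡 n) p)
  /-- the sub-Lorentzian metric -/
  g : ∀ p : M, LinearMap.BilinForm ℝ (D p)
  /-- the time orientation -/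
  T : ∀ p : M, D p
  connected : ConnectedSpace M
  hausdorff : T2Space M
  secondCountable : SecondCountableTopology M
  smooth_D : IsSmoothDistribution D
  bracketGenerating : IsBracketGenerating D
  rank_D : ∃ k : ℕ, 2 ≤ k ∧ k < n ∧ ∀ p, Module.finrank ℝ (D p) = k
  symm_g : ∀ p, (g p).IsSymm
  nondegenerate_g : ∀ p, (g p).Nondegenerate
  index_g : ∀ p, sigNeg (g p).toQuadraticMap = 1
  smooth_g : ∀ (U : Set M) (V W : ∀ p : M, D p), IsOpen U →
    SmoothFieldOn (fun p => (V p : TangentSpace (𝓡 n) p)) U →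
    SmoothFieldOn (fun p => (W p : TangentSpace (𝓡 n) p)) U →
    ContMDiffOn (𝓡 n) 𝓘(ℝ, ℝ) ∞ (fun p => g p (V p) (W p)) U
  smooth_T : SmoothFieldOn (fun p => (T p : TangentSpace (𝓡 n) p)) univ
  timelike_T : ∀ p, g p (T p) (T p) < 0

section Curves

variable {n : ℕ} {M : Type*} [TopologicalSpace M] [ChartedSpace (EuclideanSpace ℝ (Fin n)) M]

/-- The curve `γ : [0,1] → M` is absolutely continuous with square integrable velocity.
Near each parameter it is, read in a chart, absolutely continuous with `L²` derivative
(on a compact interval this does not depend on the auxiliary Riemannian metric). -/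
def IsACSquareIntegrable (γ : ℝ → M) : Prop :=
  ContinuousOn γ (Icc 0 1) ∧
  ∀ t ∈ Icc (0 : ℝ) 1, ∃ a b : ℝ, a ≤ b ∧ Icc a b ⊆ Icc 0 1 ∧ Icc a b ∈ 𝓝[Icc 0 1] t ∧
    MapsTo γ (Icc a b) (chartAt (EuclideanSpace ℝ (Fin n)) (γ t)).source ∧
    AbsolutelyContinuousOnInterval
      (fun s => chartAt (EuclideanSpace ℝ (Fin n)) (γ t) (γ s)) a b ∧
    MemLp (deriv fun s => chartAt (EuclideanSpace ℝ (Fin n)) (γ t) (γ s)) 2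
      (volume.restrict (Icc a b))

end Curves

namespace SubSpaceTime

variable {n : ℕ} {M : Type*} [TopologicalSpace M] [ChartedSpace (EuclideanSpace ℝ (Fin n)) M]
  [IsManifold (𝓡 n) ∞ M]
  {M' : Type*} [TopologicalSpace M'] [ChartedSpace (EuclideanSpace ℝ (Fin n)) M']
  [IsManifold (𝓡 n) ∞ M']

/-- `γ : [0,1] → M` is an admissible (horizontal) timelike future directed curve. -/
def IsTimelikeFutureCurve (S : SubSpaceTime n M) (γ : ℝ → M) : Prop :=
  IsACSquareIntegrable (n := n) γ ∧
  ∀ᵐ t ∂(volume.restrict (Icc (0 : ℝ) 1)),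
    MDifferentiableAt 𝓘(ℝ, ℝ) (𝓡 n) γ t ∧
    ∃ v : S.D (γ t), (v : TangentSpace (𝓡 n) (γ t)) = mfderiv 𝓘(ℝ, ℝ) (𝓡 n) γ t 1 ∧
      S.g (γ t) v v < 0 ∧ S.g (γ t) (S.T (γ t)) v < 0

/-- The chronological relation `p ≪ q`. -/
def Chron (S : SubSpaceTime n M) (p q : M) : Prop :=
  ∃ γ : ℝ → M, S.IsTimelikeFutureCurve γ ∧ γ 0 = p ∧ γ 1 = q

/-- The chronological future `I⁺(p)`. -/
def chronFuture (S : SubSpaceTime n M) (p : M) : Set M := {q | S.Chron p q}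

/-- The chronological past `I⁻(p)`. -/
def chronPast (S : SubSpaceTime n M) (p : M) : Set M := {q | S.Chron q p}

/-- The Alexandrov topology, generated by the subbasis of all `I⁺(p)` and `I⁻(p)`. -/
@[reducible] def alexandrov (S : SubSpaceTime n M) : TopologicalSpace M :=
  TopologicalSpace.generateFrom {U | ∃ p, U = S.chronFuture p ∨ U = S.chronPast p}

/-- The set of open sets of the Alexandrov topology. -/
def alexandrovOpens (S : SubSpaceTime n M) : Set (Set M) := {U | IsOpen[S.alexandrov] U}

/-- `f` maps the distribution onto the distribution and the metric to the metric. -/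
def Preserves (S : SubSpaceTime n M) (S' : SubSpaceTime n M') (f : M → M') : Prop :=
  (∀ p, (S.D p).map (mfderiv (𝓡 n) (𝓡 n) f p).toLinearMap = S'.D (f p)) ∧
  ∀ (p : M) (v w : S.D p) (v' w' : S'.D (f p)),
    (v' : TangentSpace (𝓡 n) (f p)) = mfderiv (𝓡 n) (𝓡 n) f p v →
    (w' : TangentSpace (𝓡 n) (f p)) = mfderiv (𝓡 n) (𝓡 n) f p w →
    S'.g (f p) v' w' = S.g p v w

/-- Sub-Lorentzian isometry: a diffeomorphism `Φ` with `Φ_* D = D`, `Φ^* g = g` and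
`g (Φ_* T, T) < 0`. -/
def IsIsometry (S : SubSpaceTime n M) (Φ : M → M) : Prop :=
  (∃ Ψ : M ≃ₘ^∞⟮𝓡 n, 𝓡 n⟯ M, ⇑Ψ = Φ) ∧ S.Preserves S Φ ∧
  ∀ (p : M) (v : S.D (Φ p)),
    (v : TangentSpace (𝓡 n) (Φ p)) = mfderiv (𝓡 n) (𝓡 n) Φ p (S.T p) →
    S.g (Φ p) v (S.T (Φ p)) < 0

/-- The sub-space-time `S'` is the quotient of `S` by the action `act` of the group `G`, with
projection `π`: the group acts by sub-Lorentzian isometries, freely and properly discontinuously,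
`π` is the associated covering map and a local diffeomorphism, and
`D' = π_* D`, `g' = π_* g`, `T' = π_* T`. -/
structure IsQuotientBy {G : Type*} [AddGroup G] (S : SubSpaceTime n M) (act : AddAction G M)
    (S' : SubSpaceTime n M') (π : M → M') : Prop where
  isIsometry : ∀ a : G, S.IsIsometry fun p => a +ᵥ p
  isCovering : IsAddQuotientCoveringMap π G
  isLocalDiffeo : IsLocalDiffeomorph (𝓡 n) (𝓡 n) ∞ π
  preserves : S.Preserves S' π
  map_T : ∀ p, mfderiv (𝓡 n) (𝓡 n) π p (S.T p) = (S'.T (π p) : TangentSpace (𝓡 n) (π p))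

/-- `D = span {T, X}`, the time orientation is `T`, and `g (T, T) = -1`, `g (T, X) = 0`,
`g (X, X) = 1`. -/
def IsFramedBy (S : SubSpaceTime n M) (T X : ∀ p : M, TangentSpace (𝓡 n) p) : Prop :=
  ∀ p, S.D p = Submodule.span ℝ {T p, X p} ∧ (S.T p : TangentSpace (𝓡 n) p) = T p ∧
    ∃ x : S.D p, (x : TangentSpace (𝓡 n) p) = X p ∧
      S.g p (S.T p) (S.T p) = -1 ∧ S.g p (S.T p) x = 0 ∧ S.g p x x = 1

end SubSpaceTime

/-- The set of open sets of the manifold topology. -/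
def manifoldOpens (M : Type*) [TopologicalSpace M] : Set (Set M) := {U | IsOpen U}

/-- The space of orbits of a group action; it carries the quotient topology. -/
abbrev OrbitSpace {G M : Type*} [AddGroup G] (act : AddAction G M) : Type _ :=
  Quotient (@AddAction.orbitRel G M _ act)

/-- The projection onto the space of orbits. -/
def OrbitSpace.proj {G M : Type*} [AddGroup G] (act : AddAction G M) : M → OrbitSpace act :=
  Quotient.mk _

/-- `ℝ³`, with coordinates `x = p 0`, `y = p 1`, `z = p 2`. -/
abbrev R3 : Type := EuclideanSpace ℝ (Fin 3)

/-- The tangent vector of `ℝ³` at `p` with components `v`. -/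
def R3.tangent (p v : R3) : TangentSpace (𝓡 3) p := v

section Heisenberg

/-- `∂_x + (y/2) ∂_z`. -/
def heisenbergT (p : R3) : TangentSpace (𝓡 3) p := R3.tangent p !₂[1, 0, p 1 / 2]

/-- `∂_y - (x/2) ∂_z`. -/
def heisenbergY (p : R3) : TangentSpace (𝓡 3) p := R3.tangent p !₂[0, 1, -(p 0 / 2)]

/-- The action of `ℤ` on the Heisenberg group by
`Φ_m (x, y, z) = (x - m cosh φ, y - m sinh φ, z + (m/2) (y cosh φ - x sinh φ))`. -/
@[reducible] def heisenbergAction (φ : ℝ) : AddAction ℤ R3 where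
  vadd m p := !₂[p 0 - m * Real.cosh φ, p 1 - m * Real.sinh φ,
    p 2 + m / 2 * (p 1 * Real.cosh φ - p 0 * Real.sinh φ)]
  zero_vadd p := by
    change !₂[_, _, _] = _
    ext i
    fin_cases i <;> simp
  add_vadd a b p := by
    change !₂[_, _, _] = !₂[_, _, _]
    ext i
    fin_cases i <;> simp [HVAdd.hVAdd] <;> ring

end Heisenberg

section Martinet

/-- `∂_y + x² ∂_z`. -/
def martinetT (p : R3) : TangentSpace (𝓡 3) p := R3.tangent p !₂[0, 1, p 0 ^ 2]

/-- `∂_x`. -/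
def martinetX (p : R3) : TangentSpace (𝓡 3) p := R3.tangent p !₂[1, 0, 0]

/-- The translation `(x, y, z) ↦ (x, y + s, z)`. -/
def shiftY (s : ℝ) (p : R3) : R3 := !₂[p 0, p 1 + s, p 2]

/-- The action of `ℤ` on `ℝ³` by `(x, y, z) ↦ (x, y + m, z)`. -/
@[reducible] def unitShiftAction : AddAction ℤ R3 where
  vadd m p := shiftY m p
  zero_vadd p := by
    change shiftY _ _ = _
    ext i
    fin_cases i <;> simp [shiftY]
  add_vadd a b p := by
    change shiftY _ _ = shiftY _ (shiftY _ _)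
    ext i
    fin_cases i <;> simp [shiftY]
    ring

/-- `ℝ³` without the lines `{(0, 2k, z) | z ∈ ℝ}`, `k ∈ ℤ`. -/
def slitSpace : TopologicalSpace.Opens R3 where
  carrier := {p | ¬ ∃ k : ℤ, p 0 = 0 ∧ p 1 = 2 * k}
  is_open' := by
    have h : IsClosed {p : R3 | p 0 = 0 ∧ p 1 / 2 ∈ range ((↑) : ℤ → ℝ)} :=
      (isClosed_eq (by fun_prop) continuous_const).inter
        (Int.isClosedEmbedding_coe_real.isClosed_range.preimage (by fun_prop))
    have e : {p : R3 | ¬ ∃ k : ℤ, p 0 = 0 ∧ p 1 = 2 * k} =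
        {p : R3 | p 0 = 0 ∧ p 1 / 2 ∈ range ((↑) : ℤ → ℝ)}ᶜ := by
      ext p
      simp only [mem_ofPred_eq, mem_compl_iff, mem_range, not_iff_not]
      constructor
      · rintro ⟨k, h0, h1⟩
        exact ⟨h0, k, by rw [h1]; ring⟩
      · rintro ⟨h0, k, hk⟩
        exact ⟨k, h0, by rw [hk]; ring⟩
    rw [e]
    exact h.isOpen_compl

/-- The action of `ℤ` on the slit space by `(x, y, z) ↦ (x, y + 2 m, z)`. -/
@[reducible] def slitShiftAction : AddAction ℤ slitSpace where
  vadd m p := ⟨shiftY (2 * m) p.1, by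
    rintro ⟨k, h0, h1⟩
    refine p.2 ⟨k - m, h0, ?_⟩
    have h2 : (p.1 : R3) 1 + 2 * (m : ℝ) = 2 * k := h1
    push_cast
    linarith⟩
  zero_vadd p := by
    apply Subtype.ext
    change shiftY _ _ = _
    ext i
    fin_cases i <;> simp [shiftY]
  add_vadd a b p := by
    apply Subtype.ext
    change shiftY _ _ = shiftY _ (shiftY _ _)
    ext i
    fin_cases i <;> simp [shiftY]
    ring

/-- The restriction of `∂_y + x² ∂_z` to the slit space; the tangent spaces of an open subset of
`ℝ³` are those of `ℝ³`. -/
def slitT (p : slitSpace) : TangentSpace (𝓡 3) p := R3.tangent p.1 !₂[0, 1, p.1 0 ^ 2]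

/-- The restriction of `∂_x` to the slit space. -/
def slitX (p : slitSpace) : TangentSpace (𝓡 3) p := R3.tangent p.1 !₂[1, 0, 0]

end Martinet

end SubLorentz

end

/-!
# Alexandrov and manifold topology of sub-space-times

All the space-times in question have a global orthonormal frame `(T, X)`. A `LorentzFrame`
consists of such a frame and of a dual pair of one-forms `α`, `β`, in terms of which
`g = β ⊗ β - α ⊗ α` and a vector of the distribution is timelike and future directed iff `|β| < α`. A frame
pulls back to an open subset, and it descends to the quotient by a covering action that preserves
it (`LorentzFrame.exists_quotient`). Timelike curves lift along such coverings
(`SubSpaceTime.Chron.exists_lift`), so `π p ≪ π q` in the quotient iff `p` precedes some translate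
of `q`. Everything is thereby reduced to the chronological relation of two models on `ℝ³`. That
relation is bounded from above by functions that are monotone along timelike curves
(`SubSpaceTime.IsTimelikeFutureCurve.lt_of_mfderiv_pos`), and from below by explicit curves.

*The Heisenberg group.* Let `A`, `B` be the differences of the null coordinates `x + y`, `x - y`,
and `Z` the height of `p⁻¹ q`. Along horizontal curves `4 Z' = A B' - A' B`, so `A`, `B`,
`A B - 4 Z` and `A B + 4 Z` increase along timelike curves; conversely the curves `(A t ^ s, B t ^ r)`
reach every point that satisfies the resulting inequalities. Hence `p ≪ q` iff `A, B > 0` and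
`4 |Z| < A B` (`chron_heisenberg_iff`). These sets are open, and the diamonds `I⁺(p₁) ∩ I⁻(p₂)` with
`p₁`, `p₂` on a flow line of `T` shrink to a point (`exists_heisenberg_diamond`), so the two
topologies agree. Under the translations `Φ_m` the product `A B` grows quadratically in `m`, with
leading coefficient `cosh² φ - sinh² φ = 1`, and `Z` only linearly. In the quotient every point
therefore precedes every other one (`exists_chron_heisenbergShift`), and the Alexandrov topology
is indiscrete.

*The Martinet distribution.* Along timelike curves `z' = x² y'` with `y' > |x'|`, so `z` does not
decrease. A point of the plane `x = 0` precedes points of the same height on the line of `T`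
through it, but none of smaller height, so its future is not open; this survives in both
quotients. In the quotient of `ℝ³` these lines in the plane `x = 0` close up, and the points of a
closed timelike curve cannot be separated by Alexandrov open sets; the two topologies are
incomparable. In the slit space a timelike curve that gains no height stays in the plane `x = 0`
and cannot cross a removed line (`chron_slit_not_crossing`), while a curve that starts off the
plane and runs for some time gains a definite height (`chron_martinet_gain`). So a curve between
two points `p₁`, `p₂` close to `p` on its flow line, with `p₂` taken up to translation, is short,
and it stays close to `p` (`exists_slit_diamond`): the Alexandrov topology is finer than the
manifold topology.
-/

noncomputable section

namespace SubLorentz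

/-! ### Absolutely continuous functions -/

section AbsolutelyContinuous

open AbsolutelyContinuousOnInterval Filter

variable {X Y : Type*} [PseudoMetricSpace X] [PseudoMetricSpace Y] {a b : ℝ}

/-- Absolute continuity passes to every function with oscillations dominated by those of an
absolutely continuous one. -/
theorem absolutelyContinuousOnInterval_of_dist_le {f : ℝ → X} {g : ℝ → Y} (K : ℝ)
    (hf : AbsolutelyContinuousOnInterval f a b)
    (h : ∀ x ∈ uIcc a b, ∀ y ∈ uIcc a b, dist (g x) (g y) ≤ K * dist (f x) (f y)) :
    AbsolutelyContinuousOnInterval g a b := by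
  have h0 : Tendsto (fun E : ℕ × (ℕ → ℝ × ℝ) =>
      K * ∑ i ∈ Finset.range E.1, dist (f (E.2 i).1) (f (E.2 i).2))
      (totalLengthFilter ⊓ 𝓟 (disjWithin a b)) (𝓝 0) := by
    simpa using Tendsto.const_mul K hf
  refine squeeze_zero' (.of_forall fun E => Finset.sum_nonneg fun i _ => dist_nonneg) ?_ h0
  rw [eventually_inf_principal]
  refine .of_forall fun E hE => ?_
  rw [Finset.mul_sum]
  exact Finset.sum_le_sum fun i hi => h _ (hE.1 i hi).1 _ (hE.1 i hi).2

theorem absolutelyContinuousOnInterval_congr {f g : ℝ → X}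
    (hf : AbsolutelyContinuousOnInterval f a b) (h : EqOn f g (uIcc a b)) :
    AbsolutelyContinuousOnInterval g a b :=
  absolutelyContinuousOnInterval_of_dist_le 1 hf fun _ hx _ hy => by
    rw [h hx, h hy, one_mul]

theorem absolutelyContinuousOnInterval_comp_lipschitzOnWith {f : ℝ → X} {g : X → Y} {s : Set X}
    {K : NNReal} (hg : LipschitzOnWith K g s) (hf : AbsolutelyContinuousOnInterval f a b)
    (hs : MapsTo f (uIcc a b) s) : AbsolutelyContinuousOnInterval (fun t => g (f t)) a b :=
  absolutelyContinuousOnInterval_of_dist_le K hf fun _ hx _ hy =>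
    hg.dist_le_mul _ (hs hx) _ (hs hy)

theorem absolutelyContinuousOnInterval_comp_affine {f : ℝ → X} {c d k m : ℝ} (hk : 0 < k)
    (hf : AbsolutelyContinuousOnInterval f a b)
    (h : ∀ x ∈ uIcc c d, k * x + m ∈ uIcc a b) :
    AbsolutelyContinuousOnInterval (fun t => f (k * t + m)) c d := by
  rw [absolutelyContinuousOnInterval_iff] at hf ⊢
  intro ε hε
  obtain ⟨δ, hδ, H⟩ := hf ε hε
  refine ⟨δ / k, by positivity, fun E hE hlen => ?_⟩
  refine H (E.1, fun i => (k * (E.2 i).1 + m, k * (E.2 i).2 + m)) ⟨?_, ?_⟩ ?_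
  · exact fun i hi => ⟨h _ (hE.1 i hi).1, h _ (hE.1 i hi).2⟩
  · intro i hi j hj hij
    have hd := hE.2 hi hj hij
    simp only [Function.onFun, Set.disjoint_left] at hd ⊢
    have key : ∀ x y z : ℝ, z ∈ uIoc (k * x + m) (k * y + m) → (z - m) / k ∈ uIoc x y := by
      intro x y z hz
      rw [mem_uIoc] at hz ⊢
      rw [lt_div_iff₀ hk, div_le_iff₀ hk, lt_div_iff₀ hk, div_le_iff₀ hk]
      rcases hz with hz | hz
      · left; constructor <;> linarith [hz.1, hz.2]
      · right; constructor <;> linarith [hz.1, hz.2]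
    exact fun z hz hz' => hd (key _ _ _ hz) (key _ _ _ hz')
  · rw [lt_div_iff₀ hk, Finset.sum_mul] at hlen
    refine lt_of_eq_of_lt (Finset.sum_congr rfl fun i _ => ?_) hlen
    rw [Real.dist_eq, Real.dist_eq,
      show k * (E.2 i).1 + m - (k * (E.2 i).2 + m) = ((E.2 i).1 - (E.2 i).2) * k by ring,
      abs_mul, abs_of_pos hk]

/-- Absolute continuity on two adjacent intervals gives absolute continuity on their union:
every subinterval is cut at the common endpoint `b`. -/
theorem absolutelyContinuousOnInterval_concat {f : ℝ → X} {c : ℝ} (hab : a ≤ b) (hbc : b ≤ c)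
    (h₁ : AbsolutelyContinuousOnInterval f a b) (h₂ : AbsolutelyContinuousOnInterval f b c) :
    AbsolutelyContinuousOnInterval f a c := by
  rw [absolutelyContinuousOnInterval_iff] at h₁ h₂ ⊢
  intro ε hε
  obtain ⟨δ₁, hδ₁, H₁⟩ := h₁ (ε / 2) (by positivity)
  obtain ⟨δ₂, hδ₂, H₂⟩ := h₂ (ε / 2) (by positivity)
  refine ⟨min δ₁ δ₂, by positivity, fun E hE hlen => ?_⟩
  have hmem : ∀ i ∈ Finset.range E.1, (a ≤ (E.2 i).1 ∧ (E.2 i).1 ≤ c) ∧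
      (a ≤ (E.2 i).2 ∧ (E.2 i).2 ≤ c) := by
    intro i hi
    have := hE.1 i hi
    rwa [uIcc_of_le (hab.trans hbc)] at this
  -- the parts of the subintervals on the left and on the right of `b`
  have e₁ := H₁ (E.1, fun i => (min (E.2 i).1 b, min (E.2 i).2 b)) ⟨fun i hi => ?_, ?_⟩
    (lt_of_le_of_lt (Finset.sum_le_sum fun i _ => ?_) (hlen.trans_le (min_le_left _ _)))
  have e₂ := H₂ (E.1, fun i => (max (E.2 i).1 b, max (E.2 i).2 b)) ⟨fun i hi => ?_, ?_⟩
    (lt_of_le_of_lt (Finset.sum_le_sum fun i _ => ?_) (hlen.trans_le (min_le_right _ _)))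
  · have : ∀ x y : ℝ, dist (f x) (f y) ≤
        dist (f (min x b)) (f (min y b)) + dist (f (max x b)) (f (max y b)) := by
      intro x y
      rcases le_total x b with hx | hx <;> rcases le_total y b with hy | hy <;>
        simp only [hx, hy, min_eq_left, min_eq_right, max_eq_left, max_eq_right, dist_self,
          add_zero, zero_add, le_refl]
      · exact dist_triangle _ _ _
      · rw [add_comm]; exact dist_triangle _ _ _
    calc _ ≤ _ := Finset.sum_le_sum fun i _ => this (E.2 i).1 (E.2 i).2
      _ = _ := Finset.sum_add_distrib
      _ < ε / 2 + ε / 2 := add_lt_add e₁ e₂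
      _ = ε := add_halves ε
  · have := hmem i hi
    rw [uIcc_of_le hbc]
    exact ⟨⟨le_max_right _ _, max_le this.1.2 hbc⟩, ⟨le_max_right _ _, max_le this.2.2 hbc⟩⟩
  · intro i hi j hj hij
    refine Disjoint.mono ?_ ?_ (hE.2 hi hj hij) <;>
    · intro z hz
      simp only [mem_uIoc] at hz ⊢
      grind
  · exact abs_max_sub_max_le_abs _ _ _
  · have := hmem i hi
    rw [uIcc_of_le hab]
    exact ⟨⟨le_min this.1.1 hab, min_le_right _ _⟩, ⟨le_min this.2.1 hab, min_le_right _ _⟩⟩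
  · intro i hi j hj hij
    refine Disjoint.mono ?_ ?_ (hE.2 hi hj hij) <;>
    · intro z hz
      simp only [mem_uIoc] at hz ⊢
      grind
  · simpa [Real.dist_eq] using abs_min_sub_min_le_max (E.2 i).1 b (E.2 i).2 b

theorem absolutelyContinuousOnInterval_self (f : ℝ → X) (a : ℝ) :
    AbsolutelyContinuousOnInterval f a a :=
  LipschitzOnWith.absolutelyContinuousOnInterval (K := 0)
    (by simp [lipschitzOnWith_iff_dist_le_mul])

/-- Absolute continuity on a compact interval is a local property. -/
theorem absolutelyContinuousOnInterval_of_forall_nhdsWithin {f : ℝ → X} (hab : a ≤ b)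
    (h : ∀ t ∈ Icc a b, ∃ c d : ℝ, c ≤ d ∧ Icc c d ∈ 𝓝[Icc a b] t ∧
      AbsolutelyContinuousOnInterval f c d) : AbsolutelyContinuousOnInterval f a b := by
  choose! c d hcd hnhds hac using h
  -- cut points, eventually equal to `b`, such that consecutive ones lie in one of the intervals
  obtain ⟨t, h0, hmono, ⟨m, hm⟩, hcov⟩ := exists_monotone_Icc_subset_open_cover_Icc hab
    (c := fun t : Icc a b => interior ((↑) ⁻¹' Icc (c t) (d t)))
    (fun _ => isOpen_interior) fun t _ => mem_iUnion.2 ⟨t, mem_interior_iff_mem_nhds.2 <|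
      preimage_coe_mem_nhds_subtype.2 (hnhds t t.2)⟩
  have key : ∀ n, AbsolutelyContinuousOnInterval f a (t n) := by
    intro n
    induction n with
    | zero => rw [h0]; exact absolutelyContinuousOnInterval_self f a
    | succ n ih =>
      have hle : (t n : ℝ) ≤ t (n + 1) := hmono n.le_succ
      refine absolutelyContinuousOnInterval_concat (t n).2.1 hle ih ?_
      obtain ⟨u, hu⟩ := hcov n
      refine (hac u u.2).mono ?_
      rw [uIcc_of_le hle, uIcc_of_le (hcd u u.2)]
      intro x hx
      have hx' : x ∈ Icc a b := ⟨(t n).2.1.trans hx.1, hx.2.trans (t (n + 1)).2.2⟩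
      have hxt : (⟨x, hx'⟩ : Icc a b) ∈ Icc (t n) (t (n + 1)) := ⟨hx.1, hx.2⟩
      exact (interior_subset (hu hxt) : _ ∈ ((↑) : Icc a b → ℝ) ⁻¹' Icc (c u) (d u))
  simpa [hm m le_rfl] using key m

/-- An absolutely continuous function whose derivative is nonnegative almost everywhere does not
decrease. -/
theorem le_of_absolutelyContinuousOnInterval_of_deriv_nonneg {f : ℝ → ℝ} (hab : a ≤ b)
    (hf : AbsolutelyContinuousOnInterval f a b)
    (h : ∀ᵐ t, t ∈ Ioo a b → 0 ≤ deriv f t) : f a ≤ f b := by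
  rw [← sub_nonneg, ← hf.integral_deriv_eq_sub]
  refine intervalIntegral.integral_nonneg_of_ae_restrict hab ?_
  rw [Filter.EventuallyLE, ← restrict_Ioo_eq_restrict_Icc, ae_restrict_iff' measurableSet_Ioo]
  exact h

/-- An absolutely continuous function whose derivative is positive almost everywhere increases. -/
theorem lt_of_absolutelyContinuousOnInterval_of_deriv_pos {f : ℝ → ℝ} (hab : a < b)
    (hf : AbsolutelyContinuousOnInterval f a b)
    (h : ∀ᵐ t, t ∈ Ioo a b → 0 < deriv f t) : f a < f b := by
  rw [← sub_pos, ← hf.integral_deriv_eq_sub]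
  have h' : ∀ᵐ t ∂(volume.restrict (Ioc a b)), 0 < deriv f t := by
    rw [← restrict_Ioo_eq_restrict_Ioc, ae_restrict_iff' measurableSet_Ioo]
    exact h
  rw [intervalIntegral.integral_pos_iff_support_of_nonneg_ae' ?_ hf.intervalIntegrable_deriv]
  · refine ⟨hab, ?_⟩
    rw [← Measure.restrict_apply' measurableSet_Ioc]
    have : (Function.support (deriv f)) =ᵐ[volume.restrict (Ioc a b)] univ := by
      filter_upwards [h'] with t ht
      exact propext ⟨fun _ => trivial, fun _ => ht.ne'⟩
    rw [measure_congr this]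
    simpa using hab
  · rw [uIoc_of_le hab.le]
    exact h'.mono fun t ht => ht.le

end AbsolutelyContinuous

/-! ### Regularity of curves in manifolds -/

section Curves

variable {n : ℕ} {M : Type*} [TopologicalSpace M] [ChartedSpace (EuclideanSpace ℝ (Fin n)) M]
  {M' : Type*} [TopologicalSpace M'] [ChartedSpace (EuclideanSpace ℝ (Fin n)) M']

/-- The curve `γ`, considered on the interval `J`, is near the parameter `t` absolutely continuous
with square integrable derivative, when read in the preferred chart at `γ t`. -/
def IsRegularAt (n : ℕ) {M : Type*} [TopologicalSpace M]
    [ChartedSpace (EuclideanSpace ℝ (Fin n)) M] (γ : ℝ → M) (J : Set ℝ) (t : ℝ) : Prop :=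
  ∃ a b : ℝ, a ≤ b ∧ Icc a b ⊆ J ∧ Icc a b ∈ 𝓝[J] t ∧
    MapsTo γ (Icc a b) (chartAt (EuclideanSpace ℝ (Fin n)) (γ t)).source ∧
    AbsolutelyContinuousOnInterval
      (fun s => chartAt (EuclideanSpace ℝ (Fin n)) (γ t) (γ s)) a b ∧
    MemLp (deriv fun s => chartAt (EuclideanSpace ℝ (Fin n)) (γ t) (γ s)) 2
      (volume.restrict (Icc a b))

theorem exists_Icc_subset_of_mem_nhdsWithin {c d t : ℝ} (ht : t ∈ Icc c d) {N : Set ℝ}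
    (hN : N ∈ 𝓝[Icc c d] t) :
    ∃ a b : ℝ, a ≤ b ∧ t ∈ Icc a b ∧ Icc a b ⊆ Icc c d ∧ Icc a b ∈ 𝓝[Icc c d] t ∧
      Icc a b ⊆ N := by
  obtain ⟨δ, hδ, hball⟩ := Metric.mem_nhdsWithin_iff.1 hN
  have hsub : Icc (max c (t - δ / 2)) (min d (t + δ / 2)) ⊆ Icc c d :=
    Icc_subset_Icc (le_max_left _ _) (min_le_left _ _)
  have hmem : t ∈ Icc (max c (t - δ / 2)) (min d (t + δ / 2)) :=
    ⟨max_le ht.1 (by linarith), le_min ht.2 (by linarith)⟩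
  refine ⟨_, _, hmem.1.trans hmem.2, hmem, hsub, ?_, fun s hs => hball ⟨?_, hsub hs⟩⟩
  · refine Filter.mem_of_superset (inter_mem_nhdsWithin (Icc c d)
      (Icc_mem_nhds (show t - δ / 2 < t by linarith) (show t < t + δ / 2 by linarith))) ?_
    rintro s ⟨h1, h2⟩
    exact ⟨max_le h1.1 h2.1, le_min h1.2 h2.2⟩
  · rw [Metric.mem_ball, Real.dist_eq, abs_lt]
    have h1 := (le_max_right _ _).trans hs.1
    have h2 := hs.2.trans (min_le_right _ _)
    constructor <;> linarith

variable {γ : ℝ → M} {c d t : ℝ}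

/-- A map `g` that is `C¹` near the image of `γ t` in the preferred chart is Lipschitz there. Hence,
near the parameter `t`, it preserves the absolute continuity of the curve read in this chart, and
its differential is bounded along the curve. -/
theorem IsRegularAt.exists_lipschitz {F : Type*} [NormedAddCommGroup F] [NormedSpace ℝ F]
    {g : EuclideanSpace ℝ (Fin n) → F} (hγ : IsRegularAt n γ (Icc c d) t) (ht : t ∈ Icc c d)
    (hg : ContDiffAt ℝ 1 g (chartAt (EuclideanSpace ℝ (Fin n)) (γ t) (γ t)))
    {N : Set ℝ} (hN : N ∈ 𝓝[Icc c d] t) :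
    ∃ a b : ℝ, a ≤ b ∧ Icc a b ⊆ Icc c d ∧ Icc a b ∈ 𝓝[Icc c d] t ∧ Icc a b ⊆ N ∧
      MapsTo γ (Icc a b) (chartAt (EuclideanSpace ℝ (Fin n)) (γ t)).source ∧
      MemLp (deriv fun s => chartAt (EuclideanSpace ℝ (Fin n)) (γ t) (γ s)) 2
        (volume.restrict (Icc a b)) ∧
      AbsolutelyContinuousOnInterval
        (fun s => g (chartAt (EuclideanSpace ℝ (Fin n)) (γ t) (γ s))) a b ∧
      ∃ K : NNReal, ∀ s ∈ Icc a b,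
        DifferentiableAt ℝ g (chartAt (EuclideanSpace ℝ (Fin n)) (γ t) (γ s)) ∧
        ‖fderiv ℝ g (chartAt (EuclideanSpace ℝ (Fin n)) (γ t) (γ s))‖ ≤ K := by
  obtain ⟨a, b, hab, hJ, hnhds, hmaps, hac, hL2⟩ := hγ
  set φ := chartAt (EuclideanSpace ℝ (Fin n)) (γ t)
  obtain ⟨K, s, hs, hK⟩ := hg.exists_lipschitzOnWith
  have hdiff : ∀ᶠ x in 𝓝 (φ (γ t)), DifferentiableAt ℝ g x :=
    (hg.eventually (by simp)).mono fun x hx => hx.differentiableAt (by simp)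
  obtain ⟨O, hO, hOo, hOt⟩ := mem_nhds_iff.1 (Filter.inter_mem hs hdiff)
  have htab : t ∈ Icc a b := mem_of_mem_nhdsWithin ht hnhds
  have hcont : ContinuousWithinAt (fun s => φ (γ s)) (Icc a b) t := by
    have := hac.continuousOn
    rw [uIcc_of_le hab] at this
    exact this t htab
  have hO' : (fun s => φ (γ s)) ⁻¹' O ∈ 𝓝[Icc c d] t := by
    have h1 : (fun s => φ (γ s)) ⁻¹' O ∈ 𝓝[Icc a b] t := hcont (hOo.mem_nhds hOt)
    have := nhdsWithin_le_of_mem hnhds h1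
    exact this
  obtain ⟨a', b', hab', -, hJ', hnhds', hsub⟩ := exists_Icc_subset_of_mem_nhdsWithin ht
    (Filter.inter_mem (Filter.inter_mem hnhds hO') hN)
  have h1 : Icc a' b' ⊆ Icc a b := fun x hx => (hsub hx).1.1
  have h2 : MapsTo (fun s => φ (γ s)) (Icc a' b') O := fun x hx => (hsub hx).1.2
  refine ⟨a', b', hab', hJ', hnhds', fun x hx => (hsub hx).2, hmaps.mono_left h1,
    hL2.mono_measure (Measure.restrict_mono h1 le_rfl), ?_, K, fun x hx => ⟨(hO (h2 hx)).2, ?_⟩⟩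
  · refine absolutelyContinuousOnInterval_comp_lipschitzOnWith
      (hK.mono fun x hx => (hO hx).1) (hac.mono ?_) (s := O) ?_
    · rwa [uIcc_of_le hab', uIcc_of_le hab]
    · rwa [uIcc_of_le hab']
  · exact norm_fderiv_le_of_lipschitzOn ℝ
      (Filter.mem_of_superset (hOo.mem_nhds (h2 hx)) fun y hy => (hO hy).1) hK

/-- Regularity passes to the image of the curve under a `C¹` map `f`. Almost everywhere
differentiability of the curve is assumed in order to have the chain rule for the derivative of the
image. -/
theorem IsRegularAt.comp [IsManifold (𝓡 n) ∞ M] [IsManifold (𝓡 n) ∞ M'] {f : M → M'} {γ' : ℝ → M'}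
    (hγ : IsRegularAt n γ (Icc c d) t) (ht : t ∈ Icc c d)
    (hcont : ContinuousWithinAt γ (Icc c d) t) (hf : ContMDiffAt (𝓡 n) (𝓡 n) 1 f (γ t))
    (hd : ∀ᵐ s ∂(volume.restrict (Icc c d)), MDifferentiableAt 𝓘(ℝ, ℝ) (𝓡 n) γ s)
    (hγ' : γ' =ᶠ[𝓝[Icc c d] t] fun s => f (γ s)) : IsRegularAt n γ' (Icc c d) t := by
  have ht' : γ' t = f (γ t) := hγ'.self_of_nhdsWithin ht
  set φ := chartAt (EuclideanSpace ℝ (Fin n)) (γ t) with hφ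
  set ψ := chartAt (EuclideanSpace ℝ (Fin n)) (γ' t) with hψ
  set g : EuclideanSpace ℝ (Fin n) → EuclideanSpace ℝ (Fin n) :=
    fun x => ψ (f (φ.symm x)) with hgdef
  have hg : ContDiffAt ℝ 1 g (φ (γ t)) := by
    have := (contMDiffAt_iff.1 hf).2
    rw [← ht'] at this
    simpa [hgdef, hφ, hψ, Function.comp_def, contDiffWithinAt_univ] using this
  have hsrc : ∀ᶠ s in 𝓝[Icc c d] t, γ' s ∈ ψ.source := by
    have h1 : ContinuousWithinAt (fun s => f (γ s)) (Icc c d) t :=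
      hf.continuousAt.comp_continuousWithinAt hcont
    have h2 : ∀ᶠ s in 𝓝[Icc c d] t, f (γ s) ∈ ψ.source :=
      h1 (ψ.open_source.mem_nhds (by
        change f (γ t) ∈ ψ.source
        rw [← ht']
        exact mem_chart_source _ _))
    filter_upwards [h2, hγ'] with s hs hs'
    rwa [hs']
  obtain ⟨a, b, hab, hJ, hnhds, hN, hmaps, hL2, hac, K, hK⟩ :=
    hγ.exists_lipschitz ht hg (Filter.inter_mem hsrc hγ')
  have heq : ∀ s ∈ Icc a b, ψ (γ' s) = g (φ (γ s)) := fun s hs => by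
    have : γ' s = f (γ s) := (hN hs).2
    rw [hgdef, this]
    simp only [φ.left_inv (hmaps hs)]
  refine ⟨a, b, hab, hJ, hnhds, fun s hs => (hN hs).1,
    absolutelyContinuousOnInterval_congr hac ?_, ?_⟩
  · rw [uIcc_of_le hab]
    exact fun s hs => (heq s hs).symm
  · refine MemLp.of_le_mul (c := K) hL2
      (measurable_deriv _).aestronglyMeasurable ?_
    rw [← restrict_Ioo_eq_restrict_Icc, ae_restrict_iff' measurableSet_Ioo]
    rw [ae_restrict_iff' measurableSet_Icc] at hd
    filter_upwards [hd] with s hs hsI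
    have hsI' := Ioo_subset_Icc_self hsI
    have hev : (fun s => ψ (γ' s)) =ᶠ[𝓝 s] g ∘ fun s => φ (γ s) := by
      filter_upwards [Ioo_mem_nhds hsI.1 hsI.2] with u hu using heq u (Ioo_subset_Icc_self hu)
    have hcd : DifferentiableAt ℝ (fun s => φ (γ s)) s := by
      have h1 : MDifferentiableAt (𝓡 n) 𝓘(ℝ, EuclideanSpace ℝ (Fin n)) φ (γ s) :=
        mdifferentiableAt_atlas (chart_mem_atlas _ _) (hmaps hsI')
      exact (h1.comp s (hs (hJ hsI'))).differentiableAt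
    rw [hev.deriv_eq, fderiv_comp_deriv s (hK s hsI').1 hcd]
    exact (ContinuousLinearMap.le_opNorm _ _).trans
      (mul_le_mul_of_nonneg_right (hK s hsI').2 (norm_nonneg _))

/-- A `C¹` real function is absolutely continuous along an admissible curve. -/
theorem IsACSquareIntegrable.absolutelyContinuous_comp [IsManifold (𝓡 n) ∞ M] {h : M → ℝ}
    (hγ : IsACSquareIntegrable (n := n) γ) (hh : ContMDiff (𝓡 n) 𝓘(ℝ, ℝ) 1 h) :
    AbsolutelyContinuousOnInterval (fun s => h (γ s)) 0 1 := by
  refine absolutelyContinuousOnInterval_of_forall_nhdsWithin zero_le_one fun t ht => ?_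
  have hg : ContDiffAt ℝ 1 (fun x => h ((chartAt (EuclideanSpace ℝ (Fin n)) (γ t)).symm x))
      (chartAt (EuclideanSpace ℝ (Fin n)) (γ t) (γ t)) := by
    simpa [Function.comp_def, contDiffWithinAt_univ, chartAt_self_eq] using
      (contMDiffAt_iff.1 (hh (γ t))).2
  obtain ⟨a, b, hab, -, hnhds, -, hmaps, -, hac, -⟩ :=
    IsRegularAt.exists_lipschitz (hγ.2 t ht) ht hg Filter.univ_mem
  refine ⟨a, b, hab, hnhds, absolutelyContinuousOnInterval_congr hac fun s hs => ?_⟩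
  rw [uIcc_of_le hab] at hs
  simp only [(chartAt (EuclideanSpace ℝ (Fin n)) (γ t)).left_inv (hmaps hs)]

end Curves

/-! ### Concatenation of timelike curves -/

section Concatenation

variable {n : ℕ} {M : Type*} [TopologicalSpace M] [ChartedSpace (EuclideanSpace ℝ (Fin n)) M]
  {γ γ' : ℝ → M} {c d e t : ℝ}

/-- Square integrability of the derivative in a form that is stable under affine substitutions and
under concatenation of intervals. -/
theorem memLp_two_deriv_iff_intervalIntegrable {F : Type*} [NormedAddCommGroup F]
    [NormedSpace ℝ F] [FiniteDimensional ℝ F] {f : ℝ → F} {a b : ℝ} (hab : a ≤ b) :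
    MemLp (deriv f) 2 (volume.restrict (Icc a b)) ↔
      IntervalIntegrable (fun s => ‖deriv f s‖ ^ 2) volume a b := by
  have : CompleteSpace F := FiniteDimensional.complete ℝ F
  borelize F
  have : SecondCountableTopology F :=
    (ContinuousLinearEquiv.ofFinrankEq (𝕜 := ℝ) (E := F)
      (F := EuclideanSpace ℝ (Fin (Module.finrank ℝ F)))
      (by simp)).toHomeomorph.secondCountableTopology
  rw [memLp_two_iff_integrable_sq_norm (measurable_deriv f).aestronglyMeasurable,
    intervalIntegrable_iff_integrableOn_Icc_of_le hab, IntegrableOn]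

theorem ae_comp_affine {P : ℝ → Prop} {k m : ℝ} (hk : 0 < k) (h : ∀ᵐ s, P s) :
    ∀ᵐ s, P (k * s + m) := by
  rw [ae_iff] at h ⊢
  have : {s : ℝ | ¬ P (k * s + m)} = (fun s => k * s) ⁻¹' ((fun s => s + m) ⁻¹' {s | ¬ P s}) := rfl
  rw [this, Real.volume_preimage_mul_left hk.ne', measure_preimage_add_right, h, mul_zero]

/-- Regularity is invariant under affine reparametrization. -/
theorem IsRegularAt.comp_affine {k m : ℝ} (hk : 0 < k)
    (hγ : IsRegularAt n γ (Icc (k * c + m) (k * d + m)) (k * t + m)) (ht : t ∈ Icc c d)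
    (hγ' : ∀ s ∈ Icc c d, γ' s = γ (k * s + m)) : IsRegularAt n γ' (Icc c d) t := by
  obtain ⟨a, b, hab, hJ, hnhds, hmaps, hac, hL2⟩ := hγ
  rw [hγ' t ht |>.symm] at hmaps hac hL2
  set φ := chartAt (EuclideanSpace ℝ (Fin n)) (γ' t) with hφ
  have hiff : ∀ s, s ∈ Icc ((a - m) / k) ((b - m) / k) ↔ k * s + m ∈ Icc a b := by
    intro s
    simp only [mem_Icc, div_le_iff₀ hk, le_div_iff₀ hk]
    constructor <;> rintro ⟨h1, h2⟩ <;> constructor <;> linarith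
  have hiff' : ∀ s, s ∈ Icc c d ↔ k * s + m ∈ Icc (k * c + m) (k * d + m) := by
    intro s
    simp only [mem_Icc, add_le_add_iff_right, mul_le_mul_iff_right₀ hk]
  have hJ' : Icc ((a - m) / k) ((b - m) / k) ⊆ Icc c d := fun s hs =>
    (hiff' s).2 (hJ ((hiff s).1 hs))
  have hab' : (a - m) / k ≤ (b - m) / k := by gcongr
  have heq : ∀ s ∈ Icc ((a - m) / k) ((b - m) / k), φ (γ' s) = φ (γ (k * s + m)) :=
    fun s hs => by rw [hγ' s (hJ' hs)]
  refine ⟨(a - m) / k, (b - m) / k, hab', hJ', ?_, ?_, ?_, ?_⟩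
  · have h1 : ContinuousWithinAt (fun s => k * s + m) (Icc c d) t := by fun_prop
    have h2 := h1.tendsto_nhdsWithin (t := Icc (k * c + m) (k * d + m)) fun s hs => (hiff' s).1 hs
    exact Filter.mem_of_superset (h2 hnhds) fun s hs => (hiff s).2 hs
  · intro s hs
    rw [hγ' s (hJ' hs)]
    exact hmaps ((hiff s).1 hs)
  · refine absolutelyContinuousOnInterval_congr
      (absolutelyContinuousOnInterval_comp_affine (m := m) hk hac fun s hs => ?_) fun s hs => ?_
    · rw [uIcc_of_le hab'] at hs
      rw [uIcc_of_le hab]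
      exact (hiff s).1 hs
    · rw [uIcc_of_le hab'] at hs
      exact (heq s hs).symm
  · rw [memLp_two_deriv_iff_intervalIntegrable hab] at hL2
    rw [memLp_two_deriv_iff_intervalIntegrable hab']
    have h1 := ((hL2.comp_add_right m).comp_mul_left (c := k)).const_mul (k ^ 2)
    refine h1.congr_ae ?_
    rw [uIoc_of_le hab', ← restrict_Ioo_eq_restrict_Ioc]
    refine (ae_restrict_iff' measurableSet_Ioo).2 (.of_forall fun s hs => ?_)
    have hev : (fun s => φ (γ' s)) =ᶠ[𝓝 s] fun s => (fun u => φ (γ u)) (k * s + m) := by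
      filter_upwards [Ioo_mem_nhds hs.1 hs.2] with u hu using heq u (Ioo_subset_Icc_self hu)
    have hder : deriv (fun s => (fun u => φ (γ u)) (k * s + m)) s =
        k • deriv (fun u => φ (γ u)) (k * s + m) := by
      rw [deriv_comp_mul_left k (fun u => (fun u => φ (γ u)) (u + m)) s]
      exact congrArg _ (deriv_comp_add_const (fun u => φ (γ u)) m (k * s))
    change k ^ 2 * ‖deriv (fun u => φ (γ u)) (k * s + m)‖ ^ 2 = ‖deriv (fun s => φ (γ' s)) s‖ ^ 2
    rw [hev.deriv_eq, hder, norm_smul, mul_pow, Real.norm_eq_abs, sq_abs]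

theorem IsRegularAt.mono_nhdsWithin {J J' : Set ℝ} (hγ : IsRegularAt n γ J t) (hJ : J ⊆ J')
    (h : J ∈ 𝓝[J'] t) : IsRegularAt n γ J' t := by
  obtain ⟨a, b, hab, hJ', hnhds, hrest⟩ := hγ
  exact ⟨a, b, hab, hJ'.trans hJ, nhdsWithin_le_of_mem h hnhds, hrest⟩

/-- At the common endpoint of two adjacent intervals, regularity from both sides gives
regularity. -/
theorem IsRegularAt.concat_self (hce : c ≤ e) (hed : e ≤ d) (h₁ : IsRegularAt n γ (Icc c e) e)
    (h₂ : IsRegularAt n γ (Icc e d) e) : IsRegularAt n γ (Icc c d) e := by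
  obtain ⟨a, b, hab, hJ, hnhds, hmaps, hac, hL2⟩ := h₁
  obtain ⟨a', b', hab', hJ', hnhds', hmaps', hac', hL2'⟩ := h₂
  have hb : b = e := le_antisymm (hJ ⟨hab, le_rfl⟩).2
    (mem_of_mem_nhdsWithin (right_mem_Icc.2 hce) hnhds).2
  have ha' : a' = e := le_antisymm (mem_of_mem_nhdsWithin (left_mem_Icc.2 hed) hnhds').1
    (hJ' ⟨le_rfl, hab'⟩).1
  subst hb ha'
  refine ⟨a, b', hab.trans hab', ?_, ?_, ?_,
    absolutelyContinuousOnInterval_concat hab hab' hac hac', ?_⟩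
  · exact Icc_subset_Icc (hJ ⟨le_rfl, hab⟩).1 (hJ' ⟨hab', le_rfl⟩).2
  · rw [← Icc_union_Icc_eq_Icc hce hed, nhdsWithin_union, ← Icc_union_Icc_eq_Icc hab hab']
    exact ⟨Filter.mem_of_superset hnhds subset_union_left,
      Filter.mem_of_superset hnhds' subset_union_right⟩
  · rw [← Icc_union_Icc_eq_Icc hab hab']
    exact fun s hs => hs.elim (fun h => hmaps h) (fun h => hmaps' h)
  · rw [memLp_two_deriv_iff_intervalIntegrable hab] at hL2
    rw [memLp_two_deriv_iff_intervalIntegrable hab'] at hL2'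
    rw [memLp_two_deriv_iff_intervalIntegrable (hab.trans hab')]
    exact hL2.trans hL2'

variable [IsManifold (𝓡 n) ∞ M]

/-- The tangent vector `w` at `p` is horizontal, timelike and future directed. -/
def SubSpaceTime.IsFutureTimelike (S : SubSpaceTime n M) (p : M) (w : TangentSpace (𝓡 n) p) :
    Prop :=
  ∃ v : S.D p, (v : TangentSpace (𝓡 n) p) = w ∧ S.g p v v < 0 ∧ S.g p (S.T p) v < 0

theorem SubSpaceTime.IsFutureTimelike.smul {S : SubSpaceTime n M} {p : M}
    {w : TangentSpace (𝓡 n) p} (h : S.IsFutureTimelike p w) {k : ℝ} (hk : 0 < k) :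
    S.IsFutureTimelike p (k • w) := by
  obtain ⟨v, rfl, h1, h2⟩ := h
  refine ⟨k • v, rfl, ?_, ?_⟩
  · simp only [map_smul, LinearMap.smul_apply, smul_eq_mul]
    exact mul_neg_of_pos_of_neg hk (mul_neg_of_pos_of_neg hk h1)
  · simp only [map_smul, smul_eq_mul]
    exact mul_neg_of_pos_of_neg hk h2

/-- Affine reparametrization with positive slope keeps the velocity future directed timelike. -/
theorem ae_futureTimelike_comp_affine {S : SubSpaceTime n M} {k m a b : ℝ} (hk : 0 < k)
    (ha : a = k * c + m) (hb : b = k * d + m)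
    (hγ : ∀ᵐ s, s ∈ Icc a b → MDifferentiableAt 𝓘(ℝ, ℝ) (𝓡 n) γ s ∧
      S.IsFutureTimelike (γ s) (mfderiv 𝓘(ℝ, ℝ) (𝓡 n) γ s 1))
    (hγ' : ∀ s ∈ Ioo c d, γ' s = γ (k * s + m)) :
    ∀ᵐ s, s ∈ Ioo c d → MDifferentiableAt 𝓘(ℝ, ℝ) (𝓡 n) γ' s ∧
      S.IsFutureTimelike (γ' s) (mfderiv 𝓘(ℝ, ℝ) (𝓡 n) γ' s 1) := by
  filter_upwards [ae_comp_affine (m := m) hk hγ] with s hs hsI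
  obtain ⟨h1, h2⟩ := hs ⟨by nlinarith [hsI.1], by nlinarith [hsI.2]⟩
  have hev : γ' =ᶠ[𝓝 s] γ ∘ fun s => k * s + m := by
    filter_upwards [Ioo_mem_nhds hsI.1 hsI.2] with u hu using hγ' u hu
  have haff : HasMFDerivAt 𝓘(ℝ, ℝ) 𝓘(ℝ, ℝ) (fun s : ℝ => k * s + m) s
      (k • ContinuousLinearMap.id ℝ ℝ) := by
    have : HasFDerivAt (fun s : ℝ => k * s + m) (k • ContinuousLinearMap.id ℝ ℝ) s :=
      ((hasFDerivAt_id s).const_mul k).add_const m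
    exact this.hasMFDerivAt
  have hcomp := (h1.hasMFDerivAt.comp s haff).congr_of_eventuallyEq hev
  refine ⟨hcomp.mdifferentiableAt, ?_⟩
  rw [hcomp.mfderiv]
  have hw := h2.smul hk
  rw [← hγ' s hsI] at hw
  convert hw using 1
  exact (mfderiv 𝓘(ℝ, ℝ) (𝓡 n) γ (k * s + m)).map_smul k (1 : ℝ)

/-- The chronological relation is transitive: two timelike curves, run through at double speed, are
concatenated at the parameter `1 / 2`. -/
theorem SubSpaceTime.chron_trans (S : SubSpaceTime n M) {p q r : M} (hpq : S.Chron p q)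
    (hqr : S.Chron q r) : S.Chron p r := by
  obtain ⟨γ₁, ⟨⟨hc₁, hr₁⟩, ht₁⟩, rfl, rfl⟩ := hpq
  obtain ⟨γ₂, ⟨⟨hc₂, hr₂⟩, ht₂⟩, h20, rfl⟩ := hqr
  set γ : ℝ → M := fun t => if t ≤ 1 / 2 then γ₁ (2 * t + 0) else γ₂ (2 * t + -1) with hγ
  have e₁ : ∀ s ∈ Icc (0 : ℝ) (1 / 2), γ s = γ₁ (2 * s + 0) := fun s hs => if_pos hs.2
  have e₂ : ∀ s ∈ Icc (1 / 2 : ℝ) 1, γ s = γ₂ (2 * s + -1) := by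
    intro s hs
    rcases hs.1.eq_or_lt with h | h
    · rw [← h]
      simp [hγ, h20]
    · exact if_neg h.not_ge
  have r₁ : ∀ s ∈ Icc (0 : ℝ) (1 / 2), IsRegularAt n γ (Icc 0 (1 / 2)) s := fun s hs =>
    IsRegularAt.comp_affine (γ := γ₁) (k := 2) (m := 0) two_pos
      (by norm_num; exact hr₁ _ ⟨by linarith [hs.1], by linarith [hs.2]⟩) hs e₁
  have r₂ : ∀ s ∈ Icc (1 / 2 : ℝ) 1, IsRegularAt n γ (Icc (1 / 2) 1) s := fun s hs =>
    IsRegularAt.comp_affine (γ := γ₂) (k := 2) (m := -1) two_pos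
      (by norm_num; exact hr₂ _ ⟨by linarith [hs.1], by linarith [hs.2]⟩) hs e₂
  refine ⟨γ, ⟨⟨?_, fun t ht => ?_⟩, ?_⟩, by simp [hγ], by simp [hγ]; norm_num⟩
  · rw [← Icc_union_Icc_eq_Icc (show (0 : ℝ) ≤ 1 / 2 by norm_num)
      (show (1 / 2 : ℝ) ≤ 1 by norm_num)]
    refine ContinuousOn.union_of_isClosed ?_ ?_ isClosed_Icc isClosed_Icc
    · refine ContinuousOn.congr ?_ e₁
      exact hc₁.comp (by fun_prop) fun s hs => ⟨by linarith [hs.1], by linarith [hs.2]⟩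
    · refine ContinuousOn.congr ?_ e₂
      exact hc₂.comp (by fun_prop) fun s hs => ⟨by linarith [hs.1], by linarith [hs.2]⟩
  · change IsRegularAt n γ (Icc 0 1) t
    rcases lt_trichotomy t (1 / 2) with h | h | h
    · refine (r₁ t ⟨ht.1, h.le⟩).mono_nhdsWithin (Icc_subset_Icc_right (by norm_num)) ?_
      exact Filter.mem_of_superset (inter_mem_nhdsWithin _ (Iic_mem_nhds h))
        fun s hs => ⟨hs.1.1, hs.2⟩
    · subst h
      exact (r₁ _ (by norm_num)).concat_self (by norm_num) (by norm_num) (r₂ _ (by norm_num))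
    · refine (r₂ t ⟨h.le, ht.2⟩).mono_nhdsWithin (Icc_subset_Icc_left (by norm_num)) ?_
      exact Filter.mem_of_superset (inter_mem_nhdsWithin _ (Ici_mem_nhds h))
        fun s hs => ⟨hs.2, hs.1.2⟩
  · rw [ae_restrict_iff' measurableSet_Icc] at ht₁ ht₂
    rw [← restrict_Ioo_eq_restrict_Icc, ae_restrict_iff' measurableSet_Ioo]
    have a₁ := ae_futureTimelike_comp_affine (S := S) (c := 0) (d := 1 / 2) (γ := γ₁) (γ' := γ)
      (k := 2) (m := 0) two_pos (by norm_num) (by norm_num) ht₁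
      fun s hs => e₁ s (Ioo_subset_Icc_self hs)
    have a₂ := ae_futureTimelike_comp_affine (S := S) (c := 1 / 2) (d := 1) (γ := γ₂) (γ' := γ)
      (k := 2) (m := -1) two_pos (by norm_num) (by norm_num) ht₂
      fun s hs => e₂ s (Ioo_subset_Icc_self hs)
    have hne : ∀ᵐ s : ℝ, s ≠ 1 / 2 := by simp [ae_iff]
    filter_upwards [a₁, a₂, hne] with s h1 h2 h3 hs
    rcases lt_or_gt_of_ne h3 with h | h
    · exact h1 ⟨hs.1, h⟩
    · exact h2 ⟨h, hs.2⟩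

end Concatenation

/-! ### Sub-space-times with a global orthonormal frame -/

/-- The fields `T`, `X` of a global frame of a rank two distribution, together with one-forms
`α`, `β` that restrict to the dual coframe. -/
structure LorentzFrame (n : ℕ) (M : Type*) [TopologicalSpace M]
    [ChartedSpace (EuclideanSpace ℝ (Fin n)) M] where
  /-- the timelike field of the frame -/
  T : ∀ p : M, TangentSpace (𝓡 n) p
  /-- the spacelike field of the frame -/
  X : ∀ p : M, TangentSpace (𝓡 n) p
  /-- the form dual to `T` -/
  α : ∀ p : M, TangentSpace (𝓡 n) p →ₗ[ℝ] ℝ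
  /-- the form dual to `X` -/
  β : ∀ p : M, TangentSpace (𝓡 n) p →ₗ[ℝ] ℝ

namespace LorentzFrame

variable {n : ℕ} {M : Type*} [TopologicalSpace M] [ChartedSpace (EuclideanSpace ℝ (Fin n)) M]

/-- The frame as a family of vector fields. -/
def field (F : LorentzFrame n M) (i : Fin 2) : ∀ p : M, TangentSpace (𝓡 n) p :=
  if i = 0 then F.T else F.X

/-- The frame and the coframe are smooth and dual to each other, and the iterated brackets of the
frame of some bounded length span every tangent space. Smoothness of a one-form is expressed by the
smoothness of its values on smooth fields. -/
structure IsRegular [IsManifold (𝓡 n) ∞ M] (F : LorentzFrame n M) : Prop where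
  α_T : ∀ p, F.α p (F.T p) = 1
  α_X : ∀ p, F.α p (F.X p) = 0
  β_T : ∀ p, F.β p (F.T p) = 0
  β_X : ∀ p, F.β p (F.X p) = 1
  smooth : ∀ i, SmoothFieldOn (F.field i) univ
  smooth_α : ∀ (U : Set M) (V : ∀ p : M, TangentSpace (𝓡 n) p), IsOpen U → SmoothFieldOn V U →
    ContMDiffOn (𝓡 n) 𝓘(ℝ, ℝ) ∞ (fun p => F.α p (V p)) U
  smooth_β : ∀ (U : Set M) (V : ∀ p : M, TangentSpace (𝓡 n) p), IsOpen U → SmoothFieldOn V U →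
    ContMDiffOn (𝓡 n) 𝓘(ℝ, ℝ) ∞ (fun p => F.β p (V p)) U
  bracket : ∃ N : ℕ, ∀ p, Submodule.span ℝ
    {v | ∃ I : List (Fin 2), I.length ≤ N ∧ iteratedBracket F.field I p = v} = ⊤

/-- The distribution spanned by the frame. -/
def distribution (F : LorentzFrame n M) (p : M) : Submodule ℝ (TangentSpace (𝓡 n) p) :=
  Submodule.span ℝ {F.T p, F.X p}

theorem T_mem (F : LorentzFrame n M) (p : M) : F.T p ∈ F.distribution p :=
  Submodule.subset_span (by simp)

theorem X_mem (F : LorentzFrame n M) (p : M) : F.X p ∈ F.distribution p :=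
  Submodule.subset_span (by simp)

theorem range_field (F : LorentzFrame n M) (p : M) :
    range (fun i => F.field i p) = {F.T p, F.X p} := by
  ext v
  simp [field, eq_comm]

/-- The metric `-α² + β²` on the distribution. -/
def metric (F : LorentzFrame n M) (p : M) : LinearMap.BilinForm ℝ (F.distribution p) :=
  LinearMap.mk₂ ℝ (fun v w => -(F.α p v * F.α p w) + F.β p v * F.β p w)
    (fun u v w => by simp only [Submodule.coe_add, map_add]; ring)
    (fun c v w => by simp only [Submodule.coe_smul, map_smul, smul_eq_mul]; ring)
    (fun u v w => by simp only [Submodule.coe_add, map_add]; ring)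
    (fun c v w => by simp only [Submodule.coe_smul, map_smul, smul_eq_mul]; ring)

theorem metric_apply (F : LorentzFrame n M) (p : M) (v w : F.distribution p) :
    F.metric p v w = -(F.α p v * F.α p w) + F.β p v * F.β p w := rfl

variable [IsManifold (𝓡 n) ∞ M] {F : LorentzFrame n M}

/-- A vector is horizontal iff it is recovered from its coordinates `α`, `β`. -/
theorem IsRegular.mem_distribution_iff (hF : F.IsRegular) {p : M} {v : TangentSpace (𝓡 n) p} :
    v ∈ F.distribution p ↔ v = F.α p v • F.T p + F.β p v • F.X p := by
  constructor
  · intro hv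
    obtain ⟨a, b, rfl⟩ := Submodule.mem_span_pair.1 hv
    simp [hF.α_T, hF.α_X, hF.β_T, hF.β_X]
  · intro hv
    rw [hv]
    exact Submodule.add_mem _ (Submodule.smul_mem _ _ (F.T_mem p))
      (Submodule.smul_mem _ _ (F.X_mem p))

/-- The coordinates of the vectors of the distribution with respect to the frame. -/
def IsRegular.coordinates (hF : F.IsRegular) (p : M) : F.distribution p ≃ₗ[ℝ] (Fin 2 → ℝ) where
  toFun v := ![F.α p v, F.β p v]
  map_add' v w := by ext i; fin_cases i <;> simp
  map_smul' c v := by ext i; fin_cases i <;> simp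
  invFun c := c 0 • ⟨F.T p, F.T_mem p⟩ + c 1 • ⟨F.X p, F.X_mem p⟩
  left_inv v := by
    refine Subtype.ext (Eq.trans ?_ (hF.mem_distribution_iff.1 v.2).symm)
    simp
  right_inv c := by
    ext i
    fin_cases i <;> simp [hF.α_T, hF.α_X, hF.β_T, hF.β_X]

theorem IsRegular.sigNeg_metric (hF : F.IsRegular) (p : M) :
    sigNeg (F.metric p).toQuadraticMap = 1 := by
  have e : QuadraticMap.Equivalent (F.metric p).toQuadraticMap
      (QuadraticMap.weightedSumSquares ℝ ![(-1 : ℝ), 1]) :=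
    ⟨{ hF.coordinates p with
      map_app' := fun v => by
        change QuadraticMap.weightedSumSquares ℝ ![(-1 : ℝ), 1] ![F.α p v, F.β p v] =
          -(F.α p v * F.α p v) + F.β p v * F.β p v
        simp [QuadraticMap.weightedSumSquares_apply, Fin.sum_univ_two] }⟩
  rw [QuadraticForm.sigNeg_of_equiv_weightedSumSquares e, Set.ncard_eq_one]
  refine ⟨0, ?_⟩
  ext i
  fin_cases i <;> simp

/-- The sub-space-time with the given orthonormal frame. -/
def toSubSpaceTime (F : LorentzFrame n M) (hF : F.IsRegular) (hn : 2 < n) (hc : ConnectedSpace M)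
    (ht : T2Space M) (hs : SecondCountableTopology M) : SubSpaceTime n M where
  D := F.distribution
  g := F.metric
  T p := ⟨F.T p, F.T_mem p⟩
  connected := hc
  hausdorff := ht
  secondCountable := hs
  smooth_D p := ⟨univ, 2, F.field, isOpen_univ, mem_univ p, hF.smooth,
    fun q _ => by rw [range_field]; rfl⟩
  bracketGenerating p := by
    obtain ⟨N, hN⟩ := hF.bracket
    exact ⟨N, univ, 2, F.field, isOpen_univ, mem_univ p,
      ⟨hF.smooth, fun q _ => by rw [range_field]; rfl⟩, hN p⟩
  rank_D := ⟨2, le_rfl, hn, fun p => by rw [(hF.coordinates p).finrank_eq]; simp⟩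
  symm_g p := ⟨fun v w => by rw [metric_apply, metric_apply]; ring⟩
  nondegenerate_g p := by
    have key : ∀ v : F.distribution p, F.α p v = 0 → F.β p v = 0 → v = 0 := fun v h1 h2 => by
      have := hF.mem_distribution_iff.1 v.2
      rw [h1, h2] at this
      exact Subtype.ext (by simpa using this)
    refine ⟨fun v h => key v ?_ ?_, fun v h => key v ?_ ?_⟩
    · simpa [metric_apply, hF.α_T, hF.β_T] using h ⟨F.T p, F.T_mem p⟩
    · simpa [metric_apply, hF.α_X, hF.β_X] using h ⟨F.X p, F.X_mem p⟩
    · simpa [metric_apply, hF.α_T, hF.β_T] using h ⟨F.T p, F.T_mem p⟩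
    · simpa [metric_apply, hF.α_X, hF.β_X] using h ⟨F.X p, F.X_mem p⟩
  index_g := hF.sigNeg_metric
  smooth_g U V W hU hV hW := by
    have h1 := hF.smooth_α U _ hU hV
    have h2 := hF.smooth_α U _ hU hW
    have h3 := hF.smooth_β U _ hU hV
    have h4 := hF.smooth_β U _ hU hW
    exact (h1.mul h2).neg.add (h3.mul h4)
  smooth_T := hF.smooth 0
  timelike_T p := by simp [metric_apply, hF.α_T, hF.β_T]

variable {hF : F.IsRegular} {hn : 2 < n} {hc : ConnectedSpace M} {ht : T2Space M}
  {hs : SecondCountableTopology M}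

theorem isFramedBy_toSubSpaceTime :
    (F.toSubSpaceTime hF hn hc ht hs).IsFramedBy F.T F.X := fun p =>
  ⟨rfl, rfl, ⟨F.X p, F.X_mem p⟩, rfl, by
    change F.metric p ⟨F.T p, F.T_mem p⟩ ⟨F.T p, F.T_mem p⟩ = -1 ∧
      F.metric p ⟨F.T p, F.T_mem p⟩ ⟨F.X p, F.X_mem p⟩ = 0 ∧
      F.metric p ⟨F.X p, F.X_mem p⟩ ⟨F.X p, F.X_mem p⟩ = 1
    simp [metric_apply, hF.α_T, hF.β_T, hF.α_X, hF.β_X]⟩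

/-- The future directed timelike vectors form the cone `|β| < α` in the distribution. -/
theorem isFutureTimelike_toSubSpaceTime_iff {p : M} {w : TangentSpace (𝓡 n) p} :
    (F.toSubSpaceTime hF hn hc ht hs).IsFutureTimelike p w ↔
      w ∈ F.distribution p ∧ |F.β p w| < F.α p w := by
  have hg : ∀ v : F.distribution p, F.metric p v v < 0 ∧ F.metric p ⟨F.T p, F.T_mem p⟩ v < 0 ↔
      |F.β p v| < F.α p v := by
    intro v
    simp only [metric_apply, hF.α_T, hF.β_T, abs_lt]
    constructor
    · rintro ⟨h1, h2⟩
      constructor <;> nlinarith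
    · rintro ⟨h1, h2⟩
      constructor <;> nlinarith
  constructor
  · rintro ⟨v, rfl, h⟩
    exact ⟨v.2, (hg v).1 h⟩
  · rintro ⟨hw, h⟩
    exact ⟨⟨w, hw⟩, rfl, (hg ⟨w, hw⟩).2 h⟩

end LorentzFrame

/-! ### Transfer of frames along local diffeomorphisms -/

section Transfer

variable {n : ℕ} {M : Type*} [TopologicalSpace M] [ChartedSpace (EuclideanSpace ℝ (Fin n)) M]
  {M' : Type*} [TopologicalSpace M'] [ChartedSpace (EuclideanSpace ℝ (Fin n)) M']
  {f : M → M'} {p : M}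

theorem isInvertible_mfderiv (hf : IsLocalDiffeomorphAt (𝓡 n) (𝓡 n) ∞ f p) :
    (mfderiv (𝓡 n) (𝓡 n) f p).IsInvertible :=
  ⟨hf.mfderivToContinuousLinearEquiv (by simp), hf.mfderivToContinuousLinearEquiv_coe (by simp)⟩

theorem mfderiv_injective (hf : IsLocalDiffeomorphAt (𝓡 n) (𝓡 n) ∞ f p) :
    Function.Injective (mfderiv (𝓡 n) (𝓡 n) f p) :=
  (hf.mfderivToContinuousLinearEquiv (by simp)).injective

theorem mfderiv_surjective (hf : IsLocalDiffeomorphAt (𝓡 n) (𝓡 n) ∞ f p) :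
    Function.Surjective (mfderiv (𝓡 n) (𝓡 n) f p) :=
  (hf.mfderivToContinuousLinearEquiv (by simp)).surjective

theorem inverse_mfderiv_apply (hf : IsLocalDiffeomorphAt (𝓡 n) (𝓡 n) ∞ f p)
    (v : TangentSpace (𝓡 n) p) :
    (mfderiv (𝓡 n) (𝓡 n) f p).inverse (mfderiv (𝓡 n) (𝓡 n) f p v) = v :=
  (isInvertible_mfderiv hf).inverse_apply_eq.2 rfl

theorem mfderiv_inverse_apply (hf : IsLocalDiffeomorphAt (𝓡 n) (𝓡 n) ∞ f p)
    (v : TangentSpace (𝓡 n) (f p)) :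
    mfderiv (𝓡 n) (𝓡 n) f p ((mfderiv (𝓡 n) (𝓡 n) f p).inverse v) = v := by
  obtain ⟨u, rfl⟩ := mfderiv_surjective hf v
  rw [inverse_mfderiv_apply hf]

theorem contMDiffAt_function_iff (hf : IsLocalDiffeomorphAt (𝓡 n) (𝓡 n) ∞ f p) {h : M' → ℝ} :
    ContMDiffAt (𝓡 n) 𝓘(ℝ, ℝ) ∞ (fun q => h (f q)) p ↔
      ContMDiffAt (𝓡 n) 𝓘(ℝ, ℝ) ∞ h (f p) := by
  refine ⟨fun H => ?_, fun H => H.comp p hf.contMDiffAt⟩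
  have h0 : hf.localInverse (f p) = p := hf.localInverse_left_inv hf.localInverse_mem_target
  have h1 : ContMDiffAt (𝓡 n) 𝓘(ℝ, ℝ) ∞ ((fun q => h (f q)) ∘ hf.localInverse) (f p) :=
    ContMDiffAt.comp (f p) (by rwa [h0]) hf.localInverse_contMDiffAt
  refine h1.congr_of_eventuallyEq ?_
  filter_upwards [hf.localInverse_eventuallyEq_right] with y hy
  exact congrArg h hy.symm

/-- The frames `F` and `F'` correspond to each other under the differential of `f`. -/
structure LorentzFrame.Related (F : LorentzFrame n M) (F' : LorentzFrame n M') (f : M → M') :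
    Prop where
  T : ∀ p, mfderiv (𝓡 n) (𝓡 n) f p (F.T p) = F'.T (f p)
  X : ∀ p, mfderiv (𝓡 n) (𝓡 n) f p (F.X p) = F'.X (f p)
  α : ∀ p v, F'.α (f p) (mfderiv (𝓡 n) (𝓡 n) f p v) = F.α p v
  β : ∀ p v, F'.β (f p) (mfderiv (𝓡 n) (𝓡 n) f p v) = F.β p v

variable {F : LorentzFrame n M} {F' : LorentzFrame n M'}

theorem LorentzFrame.Related.field (h : F.Related F' f) (i : Fin 2) (p : M) :
    mfderiv (𝓡 n) (𝓡 n) f p (F.field i p) = F'.field i (f p) := by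
  fin_cases i
  · exact h.T p
  · exact h.X p

theorem LorentzFrame.Related.mem_distribution_iff (hf : IsLocalDiffeomorph (𝓡 n) (𝓡 n) ∞ f)
    (h : F.Related F' f) {p : M} {w : TangentSpace (𝓡 n) p} :
    mfderiv (𝓡 n) (𝓡 n) f p w ∈ F'.distribution (f p) ↔ w ∈ F.distribution p := by
  simp only [LorentzFrame.distribution, Submodule.mem_span_pair]
  refine exists₂_congr fun a b => ?_
  rw [← h.T, ← h.X, ← map_smul, ← map_smul, ← map_add, (mfderiv_injective (hf p)).eq_iff]

theorem LorentzFrame.Related.map_distribution (h : F.Related F' f) (p : M) :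
    (F.distribution p).map (mfderiv (𝓡 n) (𝓡 n) f p).toLinearMap = F'.distribution (f p) := by
  rw [LorentzFrame.distribution, LorentzFrame.distribution, Submodule.map_span, image_pair, ← h.T,
    ← h.X]
  rfl

variable [IsManifold (𝓡 n) ∞ M] [IsManifold (𝓡 n) ∞ M']

theorem two_le_infty : (2 : ℕ∞ω) ≤ ∞ := by
  exact WithTop.coe_le_coe.2 (le_top : (2 : ℕ∞) ≤ ⊤)

/-- The regularity under which Mathlib states that the Lie bracket is natural. -/
instance isManifold_minSmoothness_two : IsManifold (𝓡 n) (minSmoothness ℝ 2) M := by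
  rw [minSmoothness_of_isRCLikeNormedField]
  exact IsManifold.of_le two_le_infty

/-- As `∞ + 1 = ∞` holds by definition, this is the given structure; the smoothness of Lie
brackets of smooth fields asks for it in this form. -/
instance isManifold_infty_add_one : IsManifold (𝓡 n) (((⊤ : ℕ∞) : ℕ∞ω) + 1) M := ‹_›

/-- A field is smooth iff a field related to it by a local diffeomorphism is. -/
theorem contMDiffAt_field_iff (hf : IsLocalDiffeomorph (𝓡 n) (𝓡 n) ∞ f)
    {V : ∀ q : M, TangentSpace (𝓡 n) q} {V' : ∀ q : M', TangentSpace (𝓡 n) q}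
    (h : ∀ q, mfderiv (𝓡 n) (𝓡 n) f q (V q) = V' (f q)) :
    ContMDiffAt (𝓡 n) (𝓡 n).tangent ∞ (fun q => (⟨q, V q⟩ : TangentBundle (𝓡 n) M)) p ↔
      ContMDiffAt (𝓡 n) (𝓡 n).tangent ∞
        (fun q => (⟨q, V' q⟩ : TangentBundle (𝓡 n) M')) (f p) := by
  constructor
  · intro H
    have h0 : (hf p).localInverse (f p) = p :=
      (hf p).localInverse_left_inv (hf p).localInverse_mem_target
    have h1 : ContMDiff (𝓡 n).tangent (𝓡 n).tangent ∞ (tangentMap (𝓡 n) (𝓡 n) f) :=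
      hf.contMDiff.contMDiff_tangentMap (by simp)
    have h2 := (h1 _).comp (f p) (ContMDiffAt.comp (f p)
      (g := fun q => (⟨q, V q⟩ : TangentBundle (𝓡 n) M)) (by rwa [h0])
      (hf p).localInverse_contMDiffAt)
    refine h2.congr_of_eventuallyEq ?_
    filter_upwards [(hf p).localInverse_eventuallyEq_right] with y hy
    have h3 : tangentMap (𝓡 n) (𝓡 n) f ⟨(hf p).localInverse y, V ((hf p).localInverse y)⟩ =
        ⟨f ((hf p).localInverse y), V' (f ((hf p).localInverse y))⟩ := by
      rw [← h]
      rfl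
    exact (h3.trans (congrArg (fun q => (⟨q, V' q⟩ : TangentBundle (𝓡 n) M')) hy)).symm
  · intro H
    have h1 := ContMDiffAt.mpullback_vectorField_preimage (n := ∞) H (hf p).contMDiffAt
      (isInvertible_mfderiv (hf p)) (by simp)
    have h2 : VectorField.mpullback (𝓡 n) (𝓡 n) f V' = V := by
      funext q
      rw [VectorField.mpullback_apply, ← h, inverse_mfderiv_apply (hf q)]
    rwa [h2] at h1

/-- Local diffeomorphisms preserve the Lie bracket of related fields. -/
theorem mlieBracket_related (hf : IsLocalDiffeomorph (𝓡 n) (𝓡 n) ∞ f)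
    {V W : ∀ q : M, TangentSpace (𝓡 n) q} {V' W' : ∀ q : M', TangentSpace (𝓡 n) q}
    (hV : ∀ q, mfderiv (𝓡 n) (𝓡 n) f q (V q) = V' (f q))
    (hW : ∀ q, mfderiv (𝓡 n) (𝓡 n) f q (W q) = W' (f q))
    (hVs : SmoothFieldOn V' univ) (hWs : SmoothFieldOn W' univ) (p : M) :
    mfderiv (𝓡 n) (𝓡 n) f p (VectorField.mlieBracket (𝓡 n) V W p) =
      VectorField.mlieBracket (𝓡 n) V' W' (f p) := by
  have key : ∀ {U : ∀ q : M, TangentSpace (𝓡 n) q} {U' : ∀ q : M', TangentSpace (𝓡 n) q},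
      (∀ q, mfderiv (𝓡 n) (𝓡 n) f q (U q) = U' (f q)) →
      VectorField.mpullback (𝓡 n) (𝓡 n) f U' = U := by
    intro U U' h
    funext q
    rw [VectorField.mpullback_apply, ← h, inverse_mfderiv_apply (hf q)]
  have h := VectorField.mpullback_mlieBracket (n := ∞) (f := f) (x₀ := p)
    ((hVs.contMDiffAt Filter.univ_mem).mdifferentiableAt (by simp))
    ((hWs.contMDiffAt Filter.univ_mem).mdifferentiableAt (by simp))
    (hf p).contMDiffAt (by
      rw [minSmoothness_of_isRCLikeNormedField]
      exact two_le_infty)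
  rw [key hV, key hW] at h
  rw [← h, VectorField.mpullback_apply, mfderiv_inverse_apply (hf p)]

theorem smoothFieldOn_iteratedBracket {k : ℕ} {X : Fin k → ∀ q : M, TangentSpace (𝓡 n) q}
    (hX : ∀ i, SmoothFieldOn (X i) univ) (I : List (Fin k)) :
    SmoothFieldOn (iteratedBracket X I) univ := by
  match I with
  | [] =>
    intro q _
    exact (Bundle.contMDiff_zeroSection ℝ (TangentSpace (𝓡 n))).contMDiffAt.contMDiffWithinAt
  | [i] => exact hX i
  | i :: j :: l =>
    intro q _
    exact (ContMDiffAt.mlieBracket_vectorField (n := ⊤) (m := ⊤)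
      ((hX i).contMDiffAt Filter.univ_mem)
      ((smoothFieldOn_iteratedBracket hX (j :: l)).contMDiffAt Filter.univ_mem)
      (by simp)).contMDiffWithinAt

theorem iteratedBracket_related (hf : IsLocalDiffeomorph (𝓡 n) (𝓡 n) ∞ f) {k : ℕ}
    {X : Fin k → ∀ q : M, TangentSpace (𝓡 n) q} {X' : Fin k → ∀ q : M', TangentSpace (𝓡 n) q}
    (h : ∀ i q, mfderiv (𝓡 n) (𝓡 n) f q (X i q) = X' i (f q))
    (hs : ∀ i, SmoothFieldOn (X' i) univ) (I : List (Fin k)) (p : M) :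
    mfderiv (𝓡 n) (𝓡 n) f p (iteratedBracket X I p) = iteratedBracket X' I (f p) := by
  match I with
  | [] => exact map_zero _
  | [i] => exact h i p
  | i :: j :: l =>
    exact mlieBracket_related hf (h i) (iteratedBracket_related hf h hs (j :: l)) (hs i)
      (smoothFieldOn_iteratedBracket hs (j :: l)) p

namespace LorentzFrame

/-- The bracket generating condition can be checked on either side of a local diffeomorphism. -/
theorem Related.span_iteratedBracket (hf : IsLocalDiffeomorph (𝓡 n) (𝓡 n) ∞ f)
    (h : F.Related F' f) (hs : ∀ i, SmoothFieldOn (F'.field i) univ) (N : ℕ) (p : M) :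
    Submodule.span ℝ
      {v | ∃ I : List (Fin 2), I.length ≤ N ∧ iteratedBracket F.field I p = v} = ⊤ ↔
    Submodule.span ℝ
      {v | ∃ I : List (Fin 2), I.length ≤ N ∧ iteratedBracket F'.field I (f p) = v} = ⊤ := by
  set e := (hf p).mfderivToContinuousLinearEquiv (by simp)
  have hset : {v | ∃ I : List (Fin 2), I.length ≤ N ∧ iteratedBracket F'.field I (f p) = v} =
      e.toLinearEquiv.toLinearMap ''
        {v | ∃ I : List (Fin 2), I.length ≤ N ∧ iteratedBracket F.field I p = v} := by
    ext v
    constructor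
    · rintro ⟨I, hI, rfl⟩
      exact ⟨_, ⟨I, hI, rfl⟩, iteratedBracket_related hf h.field hs I p⟩
    · rintro ⟨_, ⟨I, hI, rfl⟩, rfl⟩
      exact ⟨I, hI, (iteratedBracket_related hf h.field hs I p).symm⟩
  rw [hset, Submodule.span_image]
  constructor
  · intro H
    rw [H, Submodule.map_top]
    exact LinearMap.range_eq_top.2 e.toLinearEquiv.surjective
  · intro H
    refine Submodule.map_injective_of_injective e.toLinearEquiv.injective ?_
    rw [H, Submodule.map_top]
    exact (LinearMap.range_eq_top.2 e.toLinearEquiv.surjective).symm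

/-- Regularity of a frame descends along surjective local diffeomorphisms. -/
theorem IsRegular.of_surjective (hF : F.IsRegular) (hf : IsLocalDiffeomorph (𝓡 n) (𝓡 n) ∞ f)
    (hsurj : Function.Surjective f) (h : F.Related F' f) : F'.IsRegular := by
  have hs : ∀ i, SmoothFieldOn (F'.field i) univ := fun i q _ => by
    obtain ⟨p, rfl⟩ := hsurj q
    exact ((contMDiffAt_field_iff hf (h.field i)).1
      ((hF.smooth i).contMDiffAt Filter.univ_mem)).contMDiffWithinAt
  have hform : ∀ (η : ∀ p : M, TangentSpace (𝓡 n) p →ₗ[ℝ] ℝ)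
      (η' : ∀ p : M', TangentSpace (𝓡 n) p →ₗ[ℝ] ℝ)
      (_ : ∀ p v, η' (f p) (mfderiv (𝓡 n) (𝓡 n) f p v) = η p v)
      (_ : ∀ (U : Set M) (V : ∀ p : M, TangentSpace (𝓡 n) p), IsOpen U → SmoothFieldOn V U →
        ContMDiffOn (𝓡 n) 𝓘(ℝ, ℝ) ∞ (fun p => η p (V p)) U)
      (U : Set M') (V : ∀ p : M', TangentSpace (𝓡 n) p), IsOpen U → SmoothFieldOn V U →
        ContMDiffOn (𝓡 n) 𝓘(ℝ, ℝ) ∞ (fun p => η' p (V p)) U := by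
    intro η η' hη hsm U V hU hV q hq
    obtain ⟨p, rfl⟩ := hsurj q
    set W : ∀ p : M, TangentSpace (𝓡 n) p := VectorField.mpullback (𝓡 n) (𝓡 n) f V with hWdef
    have hW : ∀ q, mfderiv (𝓡 n) (𝓡 n) f q (W q) = V (f q) := fun q => by
      rw [hWdef, VectorField.mpullback_apply, mfderiv_inverse_apply (hf q)]
    have hU' : IsOpen (f ⁻¹' U) := hU.preimage hf.contMDiff.continuous
    have hWs : SmoothFieldOn W (f ⁻¹' U) := fun x hx =>
      ((contMDiffAt_field_iff hf hW).2 (hV.contMDiffAt (hU.mem_nhds hx))).contMDiffWithinAt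
    have h1 := (hsm _ W hU' hWs).contMDiffAt (hU'.mem_nhds hq)
    refine ((contMDiffAt_function_iff (h := fun p => η' p (V p)) (hf p)).1
      ?_).contMDiffWithinAt
    refine h1.congr_of_eventuallyEq (.of_forall fun x => ?_)
    change η' (f x) (V (f x)) = η x (W x)
    rw [← hη, hW]
  refine ⟨fun q => ?_, fun q => ?_, fun q => ?_, fun q => ?_, hs, hform F.α F'.α h.α hF.smooth_α,
    hform F.β F'.β h.β hF.smooth_β, ?_⟩
  · obtain ⟨p, rfl⟩ := hsurj q
    rw [← h.T, h.α, hF.α_T]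
  · obtain ⟨p, rfl⟩ := hsurj q
    rw [← h.X, h.α, hF.α_X]
  · obtain ⟨p, rfl⟩ := hsurj q
    rw [← h.T, h.β, hF.β_T]
  · obtain ⟨p, rfl⟩ := hsurj q
    rw [← h.X, h.β, hF.β_X]
  · obtain ⟨N, hN⟩ := hF.bracket
    refine ⟨N, fun q => ?_⟩
    obtain ⟨p, rfl⟩ := hsurj q
    exact (h.span_iteratedBracket hf hs N p).1 (hN p)

/-- Regularity of a frame lifts along local diffeomorphisms. -/
theorem IsRegular.of_related (hF' : F'.IsRegular) (hf : IsLocalDiffeomorph (𝓡 n) (𝓡 n) ∞ f)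
    (h : F.Related F' f) : F.IsRegular := by
  have hs : ∀ i, SmoothFieldOn (F.field i) univ := fun i q _ =>
    ((contMDiffAt_field_iff hf (h.field i)).2
      ((hF'.smooth i).contMDiffAt Filter.univ_mem)).contMDiffWithinAt
  have hform : ∀ (η : ∀ p : M, TangentSpace (𝓡 n) p →ₗ[ℝ] ℝ)
      (η' : ∀ p : M', TangentSpace (𝓡 n) p →ₗ[ℝ] ℝ)
      (_ : ∀ p v, η' (f p) (mfderiv (𝓡 n) (𝓡 n) f p v) = η p v)
      (_ : ∀ (U : Set M') (V : ∀ p : M', TangentSpace (𝓡 n) p), IsOpen U → SmoothFieldOn V U →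
        ContMDiffOn (𝓡 n) 𝓘(ℝ, ℝ) ∞ (fun p => η' p (V p)) U)
      (U : Set M) (V : ∀ p : M, TangentSpace (𝓡 n) p), IsOpen U → SmoothFieldOn V U →
        ContMDiffOn (𝓡 n) 𝓘(ℝ, ℝ) ∞ (fun p => η p (V p)) U := by
    intro η η' hη hsm U V hU hV p hp
    -- push `V` forward along `f` near `p`, that is, pull it back along a local inverse of `f`
    set l := (hf p).localInverse with hl
    set W : ∀ y : M', TangentSpace (𝓡 n) y := VectorField.mpullback (𝓡 n) (𝓡 n) l V with hWdef
    have hld : ∀ y ∈ l.source, IsLocalDiffeomorphAt (𝓡 n) (𝓡 n) ∞ l y := fun y hy =>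
      l.isLocalDiffeomorphAt _ _ _ hy
    have hlr : ∀ y ∈ l.source, f (l y) = y := fun y hy => (hf p).localInverse_right_inv hy
    have hW : ∀ y ∈ l.source, mfderiv (𝓡 n) (𝓡 n) l y (W y) = V (l y) := fun y hy => by
      rw [hWdef, VectorField.mpullback_apply, mfderiv_inverse_apply (hld y hy)]
    have hO : IsOpen (l.source ∩ l ⁻¹' U) :=
      l.contMDiffOn.continuousOn.isOpen_inter_preimage l.open_source hU
    have hWs : SmoothFieldOn W (l.source ∩ l ⁻¹' U) := fun y hy =>
      (ContMDiffAt.mpullback_vectorField_preimage (n := ∞) (hV.contMDiffAt (hU.mem_nhds hy.2))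
        (hld y hy.1).contMDiffAt (isInvertible_mfderiv (hld y hy.1)) (by simp)).contMDiffWithinAt
    have hcongr : ∀ (y y' : M') (_ : y' = y) (u : TangentSpace (𝓡 n) y')
        (v : TangentSpace (𝓡 n) y),
        (u : EuclideanSpace ℝ (Fin n)) = (v : EuclideanSpace ℝ (Fin n)) → η' y' u = η' y v := by
      rintro y _ rfl u v h
      exact congrArg (η' _) h
    have hη' : ∀ y ∈ l.source, η (l y) (V (l y)) = η' y (W y) := fun y hy => by
      rw [← hW y hy, ← hη]
      refine hcongr _ _ (hlr y hy) _ _ ?_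
      have h1 := ((hf (l y)).mdifferentiableAt (by simp)).hasMFDerivAt.comp y
        ((hld y hy).mdifferentiableAt (by simp)).hasMFDerivAt
      have h2 : HasMFDerivAt (𝓡 n) (𝓡 n) (f ∘ l) y
          (ContinuousLinearMap.id ℝ (EuclideanSpace ℝ (Fin n))) :=
        (hasMFDerivAt_id y).congr_of_eventuallyEq
          (Filter.eventuallyEq_of_mem (l.open_source.mem_nhds hy) fun z hz => hlr z hz)
      exact congrArg (fun L : EuclideanSpace ℝ (Fin n) →L[ℝ] EuclideanSpace ℝ (Fin n) => L (W y))
        (hasMFDerivAt_unique h1 h2)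
    have hp' : l (f p) = p := (hf p).localInverse_left_inv (hf p).localInverse_mem_target
    have h1 := (hsm _ W hO hWs).contMDiffAt
      (hO.mem_nhds (show f p ∈ _ from ⟨(hf p).localInverse_mem_source, by
        change l (f p) ∈ U
        rwa [hp']⟩))
    refine (ContMDiffAt.congr_of_eventuallyEq (h1.comp p (hf p).contMDiffAt)
      ?_).contMDiffWithinAt
    filter_upwards [(hf p).localInverse_eventuallyEq_left,
      (hf p).contMDiffAt.continuousAt (l.open_source.mem_nhds (hf p).localInverse_mem_source)]
      with q hq hq'
    exact (congrArg (fun q => η q (V q)) hq).symm.trans (hη' (f q) hq')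
  refine ⟨fun p => ?_, fun p => ?_, fun p => ?_, fun p => ?_, hs, hform F.α F'.α h.α hF'.smooth_α,
    hform F.β F'.β h.β hF'.smooth_β, ?_⟩
  · rw [← h.α, h.T, hF'.α_T]
  · rw [← h.α, h.X, hF'.α_X]
  · rw [← h.β, h.T, hF'.β_T]
  · rw [← h.β, h.X, hF'.β_X]
  · obtain ⟨N, hN⟩ := hF'.bracket
    exact ⟨N, fun p => (h.span_iteratedBracket hf hF'.smooth N p).2 (hN (f p))⟩

end LorentzFrame

end Transfer

/-! ### Timelike curves and local isometries -/

/-- The chain rule for a function along a curve. -/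
theorem deriv_comp_curve {n : ℕ} {M : Type*} [TopologicalSpace M]
    [ChartedSpace (EuclideanSpace ℝ (Fin n)) M] {h : M → ℝ} {γ : ℝ → M} {u : ℝ}
    (hh : MDifferentiableAt (𝓡 n) 𝓘(ℝ, ℝ) h (γ u)) (hγ : MDifferentiableAt 𝓘(ℝ, ℝ) (𝓡 n) γ u) :
    deriv (fun s => h (γ s)) u =
      mfderiv (𝓡 n) 𝓘(ℝ, ℝ) h (γ u) (mfderiv 𝓘(ℝ, ℝ) (𝓡 n) γ u 1) := by
  have h1 : mfderiv 𝓘(ℝ, ℝ) 𝓘(ℝ, ℝ) (fun s => h (γ s)) u = _ := mfderiv_comp u hh hγ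
  rw [← fderiv_apply_one_eq_deriv, ← mfderiv_eq_fderiv, h1]
  rfl

section Lift

variable {n : ℕ} {M : Type*} [TopologicalSpace M] [ChartedSpace (EuclideanSpace ℝ (Fin n)) M]
  [IsManifold (𝓡 n) ∞ M]
  {M' : Type*} [TopologicalSpace M'] [ChartedSpace (EuclideanSpace ℝ (Fin n)) M']
  [IsManifold (𝓡 n) ∞ M'] {f : M → M'} {S : SubSpaceTime n M} {S' : SubSpaceTime n M'}

/-- The differential of `f` preserves and reflects future directed timelike vectors. -/
def PreservesFuture (S : SubSpaceTime n M) (S' : SubSpaceTime n M') (f : M → M') : Prop :=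
  ∀ p w, S'.IsFutureTimelike (f p) (mfderiv (𝓡 n) (𝓡 n) f p w) ↔ S.IsFutureTimelike p w

theorem LorentzFrame.Related.preservesFuture {F : LorentzFrame n M} {F' : LorentzFrame n M'}
    {hF : F.IsRegular} {hn : 2 < n} {hc : ConnectedSpace M} {ht : T2Space M}
    {hs : SecondCountableTopology M} {hF' : F'.IsRegular} {hc' : ConnectedSpace M'}
    {ht' : T2Space M'} {hs' : SecondCountableTopology M'}
    (hf : IsLocalDiffeomorph (𝓡 n) (𝓡 n) ∞ f) (h : F.Related F' f) :
    PreservesFuture (F.toSubSpaceTime hF hn hc ht hs) (F'.toSubSpaceTime hF' hn hc' ht' hs') f := by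
  intro p w
  rw [isFutureTimelike_toSubSpaceTime_iff, isFutureTimelike_toSubSpaceTime_iff,
    h.mem_distribution_iff hf, h.α, h.β]

theorem SubSpaceTime.IsTimelikeFutureCurve.map {γ : ℝ → M} (hγ : S.IsTimelikeFutureCurve γ)
    (hf : IsLocalDiffeomorph (𝓡 n) (𝓡 n) ∞ f) (hS : PreservesFuture S S' f) :
    S'.IsTimelikeFutureCurve (fun s => f (γ s)) := by
  obtain ⟨⟨hc, hr⟩, ht⟩ := hγ
  refine ⟨⟨hf.contMDiff.continuous.comp_continuousOn hc, fun t htI => ?_⟩, ?_⟩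
  · exact IsRegularAt.comp (hr t htI) htI (hc t htI) ((hf _).contMDiffAt.of_le (by simp))
      (ht.mono fun s hs => hs.1) Filter.EventuallyEq.rfl
  · filter_upwards [ht] with t h
    have h1 := (((hf _).mdifferentiableAt (by simp)).hasMFDerivAt.comp t h.1.hasMFDerivAt)
    refine ⟨h1.mdifferentiableAt, ?_⟩
    have h2 : mfderiv 𝓘(ℝ, ℝ) (𝓡 n) (fun s => f (γ s)) t = _ := h1.mfderiv
    rw [h2]
    exact (hS _ _).2 h.2

/-- A continuous lift of a timelike curve along a local isometry is timelike: near each parameter it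
is the image of the curve under a local inverse. -/
theorem SubSpaceTime.IsTimelikeFutureCurve.lift {γ' : ℝ → M'} {γ : ℝ → M}
    (hγ' : S'.IsTimelikeFutureCurve γ') (hf : IsLocalDiffeomorph (𝓡 n) (𝓡 n) ∞ f)
    (hS : PreservesFuture S S' f) (hc : ContinuousOn γ (Icc 0 1))
    (h : ∀ s ∈ Icc (0 : ℝ) 1, f (γ s) = γ' s) : S.IsTimelikeFutureCurve γ := by
  obtain ⟨⟨hc', hr⟩, ht⟩ := hγ'
  have hloc : ∀ t ∈ Icc (0 : ℝ) 1,
      γ =ᶠ[𝓝[Icc 0 1] t] fun s => (hf (γ t)).localInverse (γ' s) := fun t htI => by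
    filter_upwards [hc t htI ((hf (γ t)).localInverse.open_target.mem_nhds
      (hf (γ t)).localInverse_mem_target), self_mem_nhdsWithin] with s hs hsI
    rw [← h s hsI]
    exact ((hf (γ t)).localInverse_left_inv hs).symm
  have hsm : ∀ t ∈ Icc (0 : ℝ) 1,
      ContMDiffAt (𝓡 n) (𝓡 n) ∞ (hf (γ t)).localInverse (γ' t) := fun t htI => by
    rw [← h t htI]
    exact (hf (γ t)).localInverse_contMDiffAt
  refine ⟨⟨hc, fun t htI => ?_⟩, ?_⟩
  · exact IsRegularAt.comp (hr t htI) htI (hc' t htI) ((hsm t htI).of_le (by simp))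
      (ht.mono fun s hs => hs.1) (hloc t htI)
  · rw [← restrict_Ioo_eq_restrict_Icc, ae_restrict_iff' measurableSet_Ioo] at ht ⊢
    filter_upwards [ht] with t h1 htI
    have htI' := Ioo_subset_Icc_self htI
    have hnhds : Icc (0 : ℝ) 1 ∈ 𝓝 t := Icc_mem_nhds htI.1 htI.2
    have hev := hloc t htI'
    rw [nhdsWithin_eq_nhds.2 hnhds] at hev
    have hd : MDifferentiableAt 𝓘(ℝ, ℝ) (𝓡 n) γ t :=
      (((hsm t htI').mdifferentiableAt (by simp)).comp t (h1 htI).1).congr_of_eventuallyEq hev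
    refine ⟨hd, ?_⟩
    have hev' : γ' =ᶠ[𝓝 t] f ∘ γ := by
      filter_upwards [hnhds] with s hs using (h s hs).symm
    have h2 := (((hf (γ t)).mdifferentiableAt (by simp)).hasMFDerivAt.comp t
      hd.hasMFDerivAt).congr_of_eventuallyEq hev'
    have h3 : S'.IsFutureTimelike (γ' t) (mfderiv 𝓘(ℝ, ℝ) (𝓡 n) γ' t 1) := (h1 htI).2
    have h4 : mfderiv 𝓘(ℝ, ℝ) (𝓡 n) γ' t = _ := h2.mfderiv
    rw [h4, ← h t htI'] at h3
    exact (hS _ _).1 h3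

theorem SubSpaceTime.Chron.map {p q : M} (h : S.Chron p q)
    (hf : IsLocalDiffeomorph (𝓡 n) (𝓡 n) ∞ f) (hS : PreservesFuture S S' f) :
    S'.Chron (f p) (f q) := by
  obtain ⟨γ, hγ, rfl, rfl⟩ := h
  exact ⟨_, hγ.map hf hS, rfl, rfl⟩

/-- Timelike curves lift along coverings that are local isometries. -/
theorem SubSpaceTime.Chron.exists_lift {p : M} {q' : M'} (h : S'.Chron (f p) q')
    (hf : IsLocalDiffeomorph (𝓡 n) (𝓡 n) ∞ f) (hcov : IsCoveringMap f)
    (hS : PreservesFuture S S' f) : ∃ q, f q = q' ∧ S.Chron p q := by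
  obtain ⟨γ', hγ', h0, rfl⟩ := h
  set c : C(unitInterval, M') := ⟨fun t => γ' t, hγ'.1.1.domRestrict⟩ with hc
  have hc0 : c 0 = f p := h0
  set Γ := hcov.liftPath c p hc0
  have hΓ : ∀ t : unitInterval, f (Γ t) = γ' t := fun t =>
    congrFun (hcov.liftPath_lifts c p hc0) t
  have hΓ0 : Γ 0 = p := hcov.liftPath_zero c p hc0
  refine ⟨Γ 1, hΓ 1, fun t => Γ (projIcc 0 1 zero_le_one t), ?_, ?_, ?_⟩
  · refine hγ'.lift hf hS (Γ.continuous.comp continuous_projIcc).continuousOn fun s hs => ?_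
    rw [projIcc_of_mem _ hs, hΓ]
  · change Γ (projIcc 0 1 zero_le_one 0) = p
    rw [projIcc_left]
    exact hΓ0
  · change Γ (projIcc 0 1 zero_le_one 1) = _
    rw [projIcc_right]
    rfl

/-- A `C¹` function whose derivative is nonnegative on the future directed timelike vectors along a
timelike curve does not decrease along this curve. -/
theorem SubSpaceTime.IsTimelikeFutureCurve.le_of_mfderiv_nonneg {γ : ℝ → M}
    (hγ : S.IsTimelikeFutureCurve γ) {h : M → ℝ} (hh : ContMDiff (𝓡 n) 𝓘(ℝ, ℝ) 1 h) {s t : ℝ}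
    (hs : 0 ≤ s) (hst : s ≤ t) (ht : t ≤ 1)
    (hd : ∀ u ∈ Ioo s t, ∀ w, S.IsFutureTimelike (γ u) w →
      (0 : ℝ) ≤ mfderiv (𝓡 n) 𝓘(ℝ, ℝ) h (γ u) w) : h (γ s) ≤ h (γ t) := by
  refine le_of_absolutelyContinuousOnInterval_of_deriv_nonneg hst
    ((hγ.1.absolutelyContinuous_comp hh).mono ?_) ?_
  · rw [uIcc_of_le hst, uIcc_of_le zero_le_one]
    exact Icc_subset_Icc hs ht
  · have h1 := hγ.2
    rw [ae_restrict_iff' measurableSet_Icc] at h1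
    filter_upwards [h1] with u hu huI
    obtain ⟨h2, h3⟩ := hu ⟨hs.trans huI.1.le, huI.2.le.trans ht⟩
    rw [deriv_comp_curve (hh.mdifferentiableAt (by simp)) h2]
    exact hd u huI _ h3

/-- A `C¹` function whose derivative is positive on the future directed timelike vectors along a
timelike curve increases along this curve. -/
theorem SubSpaceTime.IsTimelikeFutureCurve.lt_of_mfderiv_pos {γ : ℝ → M}
    (hγ : S.IsTimelikeFutureCurve γ) {h : M → ℝ} (hh : ContMDiff (𝓡 n) 𝓘(ℝ, ℝ) 1 h) {s t : ℝ}
    (hs : 0 ≤ s) (hst : s < t) (ht : t ≤ 1)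
    (hd : ∀ u ∈ Ioo s t, ∀ w, S.IsFutureTimelike (γ u) w →
      (0 : ℝ) < mfderiv (𝓡 n) 𝓘(ℝ, ℝ) h (γ u) w) : h (γ s) < h (γ t) := by
  refine lt_of_absolutelyContinuousOnInterval_of_deriv_pos hst
    ((hγ.1.absolutelyContinuous_comp hh).mono ?_) ?_
  · rw [uIcc_of_le hst.le, uIcc_of_le zero_le_one]
    exact Icc_subset_Icc hs ht
  · have h1 := hγ.2
    rw [ae_restrict_iff' measurableSet_Icc] at h1
    filter_upwards [h1] with u hu huI
    obtain ⟨h2, h3⟩ := hu ⟨hs.trans huI.1.le, huI.2.le.trans ht⟩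
    rw [deriv_comp_curve (hh.mdifferentiableAt (by simp)) h2]
    exact hd u huI _ h3

end Lift

/-- A `C¹` curve in `ℝⁿ` with future directed timelike velocity is admissible. -/
theorem SubSpaceTime.isTimelikeFutureCurve_of_contDiff {n : ℕ}
    (S : SubSpaceTime n (EuclideanSpace ℝ (Fin n)))
    {γ : ℝ → EuclideanSpace ℝ (Fin n)} (hγ : ContDiff ℝ 1 γ)
    (h : ∀ t ∈ Ioo (0 : ℝ) 1, S.IsFutureTimelike (γ t) (deriv γ t : EuclideanSpace ℝ (Fin n))) :
    S.IsTimelikeFutureCurve γ := by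
  refine ⟨⟨hγ.continuous.continuousOn, fun t ht => ⟨0, 1, zero_le_one, Subset.rfl,
    self_mem_nhdsWithin, fun s _ => mem_univ _, ?_, ?_⟩⟩, ?_⟩
  · exact hγ.contDiffOn.absolutelyContinuousOnInterval
  · change MemLp (deriv γ) 2 _
    have hc : Continuous (deriv γ) := hγ.continuous_deriv le_rfl
    obtain ⟨C, hC⟩ := isCompact_Icc.exists_bound_of_continuousOn (hc.continuousOn (s := Icc 0 1))
    refine MemLp.of_bound (measurable_deriv γ).aestronglyMeasurable C ?_
    exact (ae_restrict_iff' measurableSet_Icc).2 (.of_forall hC)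
  · rw [← restrict_Ioo_eq_restrict_Icc, ae_restrict_iff' measurableSet_Ioo]
    refine .of_forall fun t ht => ?_
    have hd : DifferentiableAt ℝ γ t := hγ.differentiable (by simp) t
    refine ⟨hd.mdifferentiableAt, ?_⟩
    have := h t ht
    rw [← fderiv_apply_one_eq_deriv, ← mfderiv_eq_fderiv] at this
    exact this

/-! ### Quotient manifolds -/

section QuotientManifold

variable {n : ℕ} {M : Type*} [TopologicalSpace M] [ChartedSpace (EuclideanSpace ℝ (Fin n)) M]
  {M' : Type*} [TopologicalSpace M'] {f : M → M'}

/-- If the changes of sheets of the surjective local homeomorphism `f` are smooth, then the charts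
pushed forward along `f` make its codomain a smooth manifold. -/
theorem isManifold_chartedSpace [IsManifold (𝓡 n) ∞ M] (hf : IsLocalHomeomorph f)
    (hsurj : Function.Surjective f)
    (hsm : ∀ p₀ p, f p ∈ (hf.localInverseAt p₀).source →
      ContMDiffAt (𝓡 n) (𝓡 n) ∞ (fun q => hf.localInverseAt p₀ (f q)) p) :
    @IsManifold ℝ _ _ _ _ _ _ (𝓡 n) ∞ M' _
      (hf.chartedSpace (H := EuclideanSpace ℝ (Fin n)) hsurj) := by
  let _ := hf.chartedSpace (H := EuclideanSpace ℝ (Fin n)) hsurj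
  refine isManifold_of_contDiffOn _ _ _ ?_
  rintro _ _ ⟨q₁, rfl⟩ ⟨q₂, rfl⟩
  set s := hsurj.hasRightInverse.choose
  set χ₁ := chartAt (EuclideanSpace ℝ (Fin n)) (s q₁)
  set χ₂ := chartAt (EuclideanSpace ℝ (Fin n)) (s q₂)
  rintro u ⟨hu, -⟩
  simp only [modelWithCornersSelf_coe_symm, preimage_id_eq, id_eq,
    OpenPartialHomeomorph.trans_source,
    OpenPartialHomeomorph.symm_source, OpenPartialHomeomorph.trans_target,
    OpenPartialHomeomorph.coe_trans_symm, mem_inter_iff, mem_preimage, Function.comp_apply,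
    IsLocalHomeomorph.localInverseAt_symm] at hu
  obtain ⟨⟨hu1, hu2⟩, hu3, hu4⟩ := hu
  have h1 : ContMDiffAt (𝓡 n) (𝓡 n) ∞ χ₁.symm u :=
    (contMDiffOn_chart_symm (x := s q₁)).contMDiffAt (χ₁.open_target.mem_nhds hu1)
  have h3 : ContMDiffAt (𝓡 n) (𝓡 n) ∞ χ₂ (hf.localInverseAt (s q₂) (f (χ₁.symm u))) :=
    (contMDiffOn_chart (x := s q₂)).contMDiffAt (χ₂.open_source.mem_nhds hu4)
  have h4 := (h3.comp (χ₁.symm u) (hsm _ _ hu3)).comp u h1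
  refine (contMDiffAt_iff_contDiffAt.1 h4).contDiffWithinAt.congr (fun v _ => ?_) ?_ <;>
  simp [χ₁, χ₂, s]

/-- With the charts pushed forward along `f`, the map `f` is a local diffeomorphism. -/
theorem isLocalDiffeomorph_chartedSpace [IsManifold (𝓡 n) ∞ M] (hf : IsLocalHomeomorph f)
    (hsurj : Function.Surjective f)
    (hsm : ∀ p₀ p, f p ∈ (hf.localInverseAt p₀).source →
      ContMDiffAt (𝓡 n) (𝓡 n) ∞ (fun q => hf.localInverseAt p₀ (f q)) p) :
    @IsLocalDiffeomorph ℝ _ _ _ _ _ _ _ _ _ _ _ (𝓡 n) (𝓡 n) M _ _ M' _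
      (hf.chartedSpace (H := EuclideanSpace ℝ (Fin n)) hsurj) ∞ f := by
  let _ := hf.chartedSpace (H := EuclideanSpace ℝ (Fin n)) hsurj
  have := isManifold_chartedSpace hf hsurj hsm
  set s := hsurj.hasRightInverse.choose with hs
  have hfs : ∀ q, f (s q) = q := hsurj.hasRightInverse.choose_spec
  have hmem : ∀ q, q ∈ (hf.localInverseAt (s q)).source := fun q => by
    have := hf.apply_self_mem_localInverseAt_source (x := s q)
    rwa [hfs] at this
  have hval : ∀ q, hf.localInverseAt (s q) q = s q := fun q => by
    have := hf.localInverseAt_apply_self (x := s q)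
    rwa [hfs] at this
  have hsmooth : ContMDiff (𝓡 n) (𝓡 n) ∞ f := fun p => by
    rw [contMDiffAt_iff_target]
    refine ⟨hf.continuous.continuousAt, ?_⟩
    have h1 : ContMDiffAt (𝓡 n) (𝓡 n) ∞ (chartAt (EuclideanSpace ℝ (Fin n)) (s (f p)))
        (hf.localInverseAt (s (f p)) (f p)) :=
      (contMDiffOn_chart (x := s (f p))).contMDiffAt
        ((chartAt (EuclideanSpace ℝ (Fin n)) (s (f p))).open_source.mem_nhds (by
          rw [hval]; exact mem_chart_source _ _))
    exact ContMDiffAt.comp (f := fun q => hf.localInverseAt (s (f p)) (f q)) p h1 (hsm _ _ (hmem _))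
  have hinv : ∀ p₀, ContMDiffOn (𝓡 n) (𝓡 n) ∞ (hf.localInverseAt p₀)
      (hf.localInverseAt p₀).source := fun p₀ q hq => by
    refine ContMDiffAt.contMDiffWithinAt ?_
    rw [contMDiffAt_iff_source]
    have h0 : extChartAt (𝓡 n) q q = chartAt (EuclideanSpace ℝ (Fin n)) (s q) (s q) := by
      change chartAt (EuclideanSpace ℝ (Fin n)) (s q) (hf.localInverseAt (s q) q) = _
      rw [hval]
    have h1 : ContMDiffAt (𝓡 n) (𝓡 n) ∞ (chartAt (EuclideanSpace ℝ (Fin n)) (s q)).symm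
        (extChartAt (𝓡 n) q q) := by
      rw [h0]
      exact (contMDiffOn_chart_symm (x := s q)).contMDiffAt
        ((chartAt _ (s q)).open_target.mem_nhds (mem_chart_target _ _))
    have h2 : (chartAt (EuclideanSpace ℝ (Fin n)) (s q)).symm (extChartAt (𝓡 n) q q) = s q := by
      rw [h0]
      exact (chartAt _ (s q)).left_inv (mem_chart_source _ _)
    have h3 : ContMDiffAt (𝓡 n) (𝓡 n) ∞ ((fun p => hf.localInverseAt p₀ (f p)) ∘
        (chartAt (EuclideanSpace ℝ (Fin n)) (s q)).symm) (extChartAt (𝓡 n) q q) := by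
      refine ContMDiffAt.comp _ (hsm _ _ ?_) h1
      rw [h2, hfs]
      exact hq
    have h4 : ∀ v, hf.localInverseAt p₀ ((extChartAt (𝓡 n) q).symm v) =
        hf.localInverseAt p₀ (f ((chartAt (EuclideanSpace ℝ (Fin n)) (s q)).symm v)) := fun v =>
      congrArg _ (congrFun (hf.localInverseAt_symm (s q)) _)
    exact h3.contMDiffWithinAt.congr (fun v _ => h4 v) (h4 _)
  intro p
  refine ⟨⟨(hf.localInverseAt p).symm.toPartialEquiv, (hf.localInverseAt p).open_target,
    (hf.localInverseAt p).open_source, ?_, hinv p⟩, hf.self_mem_localInverseAt_target, ?_⟩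
  · change ContMDiffOn _ _ _ (hf.localInverseAt p).symm _
    rw [hf.localInverseAt_symm]
    exact hsmooth.contMDiffOn
  · intro x _
    exact (congrFun (hf.localInverseAt_symm p) x).symm

/-- The changes of sheets of a covering by a group of diffeomorphisms are given locally by elements
of the group. -/
theorem contMDiffAt_localInverseAt_comp {G : Type*} [AddGroup G] [AddAction G M]
    (hcov : IsAddQuotientCoveringMap f G) (hf : IsLocalHomeomorph f)
    (hG : ∀ a : G, ContMDiff (𝓡 n) (𝓡 n) ∞ fun p : M => a +ᵥ p) (p₀ p : M)
    (hp : f p ∈ (hf.localInverseAt p₀).source) :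
    ContMDiffAt (𝓡 n) (𝓡 n) ∞ (fun q => hf.localInverseAt p₀ (f q)) p := by
  obtain ⟨a, ha⟩ : hf.localInverseAt p₀ (f p) ∈ AddAction.orbit G p :=
    hcov.apply_eq_iff_mem_orbit.1 (hf.apply_localInverseAt_of_mem hp)
  have ha' : a +ᵥ p = hf.localInverseAt p₀ (f p) := ha
  refine (hG a p).congr_of_eventuallyEq ?_
  have h1 : ∀ᶠ q in 𝓝 p, f q ∈ (hf.localInverseAt p₀).source :=
    hf.continuous.continuousAt ((hf.localInverseAt p₀).open_source.mem_nhds hp)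
  have h2 : ∀ᶠ q in 𝓝 p, a +ᵥ q ∈ (hf.localInverseAt p₀).target :=
    (hG a).continuous.continuousAt ((hf.localInverseAt p₀).open_target.mem_nhds (by
      rw [ha']
      exact (hf.localInverseAt p₀).map_source hp))
  filter_upwards [h1, h2] with q hq1 hq2
  refine hf.injOn_localInverseAt_target ((hf.localInverseAt p₀).map_source hq1) hq2 ?_
  rw [hf.apply_localInverseAt_of_mem hq1]
  exact (hcov.apply_eq_iff_mem_orbit.2 ⟨a, rfl⟩).symm

end QuotientManifold

/-- An action of `ℤ` on a locally compact Hausdorff space is a covering action if some continuous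
function increases by `a • c` under translation by `a`, with `c ≠ 0`. -/
theorem isAddQuotientCoveringMap_of_height {M : Type*} [TopologicalSpace M] [AddAction ℤ M]
    [ContinuousConstVAdd ℤ M] [LocallyCompactSpace M] [T2Space M] {h : M → ℝ} (hh : Continuous h)
    {c : ℝ} (hc : c ≠ 0) (hadd : ∀ (a : ℤ) p, h (a +ᵥ p) = h p + a * c) :
    ProperlyDiscontinuousVAdd ℤ M ∧
      IsAddQuotientCoveringMap (Quotient.mk (AddAction.orbitRel ℤ M)) ℤ := by
  have h1 : ProperlyDiscontinuousVAdd ℤ M := ⟨fun {K L} hK hL => by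
    obtain ⟨C, hC⟩ := hK.exists_bound_of_continuousOn hh.continuousOn
    obtain ⟨C', hC'⟩ := hL.exists_bound_of_continuousOn hh.continuousOn
    refine (Set.finite_Icc (-⌈(C + C') / |c|⌉) ⌈(C + C') / |c|⌉).subset ?_
    rintro a ⟨_, ⟨p, hp, rfl⟩, hq⟩
    have e1 := hC p hp
    have e2 := hC' _ hq
    have e3 := hadd a p
    have e4 : |(a : ℝ) * c| ≤ C + C' := by
      have : (a : ℝ) * c = h (a +ᵥ p) - h p := by rw [e3]; ring
      rw [this]
      refine (abs_sub _ _).trans ?_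
      simp only [Real.norm_eq_abs] at e1 e2
      linarith
    have e5 : |(a : ℝ)| ≤ ⌈(C + C') / |c|⌉ := by
      refine le_trans ?_ (Int.le_ceil _)
      rw [le_div_iff₀ (abs_pos.2 hc), ← abs_mul]
      exact e4
    exact abs_le.1 (by exact_mod_cast e5)⟩
  refine ⟨h1, ?_⟩
  have h2 : IsCancelVAdd ℤ M := ⟨fun a b p hab => by
    have := congrArg h hab
    rw [hadd, hadd] at this
    exact_mod_cast mul_right_cancel₀ hc (add_left_cancel this)⟩
  exact isAddQuotientCoveringMap_quotientMk_of_properlyDiscontinuousVAdd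

/-! ### Quotients of framed sub-space-times -/

section QuotientFrame

variable {n : ℕ} {M : Type*} [TopologicalSpace M] [ChartedSpace (EuclideanSpace ℝ (Fin n)) M]
  {M' : Type*} [TopologicalSpace M'] [ChartedSpace (EuclideanSpace ℝ (Fin n)) M'] {f : M → M'}

/-- The push forward of a frame along `f`, computed at the points of a section `s` of `f`. -/
def LorentzFrame.pushforward (F : LorentzFrame n M) (f : M → M') (s : M' → M) :
    LorentzFrame n M' where
  T q := (mfderiv (𝓡 n) (𝓡 n) f (s q) (F.T (s q)) : EuclideanSpace ℝ (Fin n))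
  X q := (mfderiv (𝓡 n) (𝓡 n) f (s q) (F.X (s q)) : EuclideanSpace ℝ (Fin n))
  α q := (F.α (s q) ∘ₗ (mfderiv (𝓡 n) (𝓡 n) f (s q)).inverse.toLinearMap :
    EuclideanSpace ℝ (Fin n) →ₗ[ℝ] ℝ)
  β q := (F.β (s q) ∘ₗ (mfderiv (𝓡 n) (𝓡 n) f (s q)).inverse.toLinearMap :
    EuclideanSpace ℝ (Fin n) →ₗ[ℝ] ℝ)

/-- A frame that is invariant under the deck transformations is related to its push forward. -/
theorem LorentzFrame.related_pushforward {F : LorentzFrame n M}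
    (hf : IsLocalDiffeomorph (𝓡 n) (𝓡 n) ∞ f) {s : M' → M}
    (h : ∀ p, ∃ σ : M → M, ContMDiff (𝓡 n) (𝓡 n) ∞ σ ∧ F.Related F σ ∧ f ∘ σ = f ∧
      s (f p) = σ p) : F.Related (F.pushforward f s) f := by
  have key : ∀ p, ∃ σ : M → M, F.Related F σ ∧ s (f p) = σ p ∧
      ∀ v, mfderiv (𝓡 n) (𝓡 n) f p v =
        mfderiv (𝓡 n) (𝓡 n) f (σ p) (mfderiv (𝓡 n) (𝓡 n) σ p v) := by
    intro p
    obtain ⟨σ, h1, h2, h3, h4⟩ := h p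
    refine ⟨σ, h2, h4, fun v => ?_⟩
    have h5 := ((hf (σ p)).mdifferentiableAt (by simp)).hasMFDerivAt.comp p
      ((h1 p).mdifferentiableAt (by simp)).hasMFDerivAt
    rw [h3] at h5
    rw [h5.mfderiv]
    rfl
  constructor
  · intro p
    obtain ⟨σ, h1, h2, h3⟩ := key p
    rw [h3, h1.T]
    change _ = (mfderiv (𝓡 n) (𝓡 n) f (s (f p)) (F.T (s (f p))) : EuclideanSpace ℝ (Fin n))
    rw [h2]
  · intro p
    obtain ⟨σ, h1, h2, h3⟩ := key p
    rw [h3, h1.X]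
    change _ = (mfderiv (𝓡 n) (𝓡 n) f (s (f p)) (F.X (s (f p))) : EuclideanSpace ℝ (Fin n))
    rw [h2]
  · intro p v
    obtain ⟨σ, h1, h2, h3⟩ := key p
    rw [h3, ← h1.α]
    change F.α (s (f p)) ((mfderiv (𝓡 n) (𝓡 n) f (s (f p))).inverse _) = _
    rw [h2]
    exact congrArg _ (inverse_mfderiv_apply (hf (σ p)) _)
  · intro p v
    obtain ⟨σ, h1, h2, h3⟩ := key p
    rw [h3, ← h1.β]
    change F.β (s (f p)) ((mfderiv (𝓡 n) (𝓡 n) f (s (f p))).inverse _) = _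
    rw [h2]
    exact congrArg _ (inverse_mfderiv_apply (hf (σ p)) _)

theorem LorentzFrame.Related.preserves [IsManifold (𝓡 n) ∞ M] [IsManifold (𝓡 n) ∞ M']
    {F : LorentzFrame n M} {F' : LorentzFrame n M'}
    {hF : F.IsRegular} {hn : 2 < n} {hc : ConnectedSpace M} {ht : T2Space M}
    {hs : SecondCountableTopology M} {hF' : F'.IsRegular} {hc' : ConnectedSpace M'}
    {ht' : T2Space M'} {hs' : SecondCountableTopology M'} (h : F.Related F' f) :
    (F.toSubSpaceTime hF hn hc ht hs).Preserves (F'.toSubSpaceTime hF' hn hc' ht' hs') f := by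
  have key : ∀ (p : M) (v w : F.distribution p) (v' w' : F'.distribution (f p)),
      (v' : TangentSpace (𝓡 n) (f p)) = mfderiv (𝓡 n) (𝓡 n) f p v →
      (w' : TangentSpace (𝓡 n) (f p)) = mfderiv (𝓡 n) (𝓡 n) f p w →
      F'.metric (f p) v' w' = F.metric p v w := fun p v w v' w' hv hw => by
    rw [LorentzFrame.metric_apply, LorentzFrame.metric_apply, hv, hw, h.α, h.α, h.β, h.β]
  exact ⟨h.map_distribution, key⟩

theorem LorentzFrame.Related.isIsometry [IsManifold (𝓡 n) ∞ M] {F : LorentzFrame n M}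
    {hF : F.IsRegular} {hn : 2 < n} {hc : ConnectedSpace M} {ht : T2Space M}
    {hs : SecondCountableTopology M} {Ψ : M ≃ₘ^∞⟮𝓡 n, 𝓡 n⟯ M} (h : F.Related F Ψ) :
    (F.toSubSpaceTime hF hn hc ht hs).IsIsometry Ψ := by
  have key : ∀ (p : M) (v : F.distribution (Ψ p)),
      (v : TangentSpace (𝓡 n) (Ψ p)) = mfderiv (𝓡 n) (𝓡 n) Ψ p (F.T p) →
      F.metric (Ψ p) v ⟨F.T (Ψ p), F.T_mem _⟩ < 0 := fun p v hv => by
    rw [LorentzFrame.metric_apply, hv, h.T, hF.α_T, hF.β_T]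
    norm_num
  exact ⟨⟨Ψ, rfl⟩, h.preserves, key⟩

/-- A framed sub-space-time has a quotient by an action of `ℤ` that preserves the frame and that
translates the values of some continuous function; the timelike curves of the quotient are the
projections of timelike curves. -/
theorem LorentzFrame.exists_quotient [IsManifold (𝓡 n) ∞ M] {F : LorentzFrame n M}
    (hF : F.IsRegular) (hn : 2 < n) (hc : ConnectedSpace M) (ht : T2Space M)
    (hs : SecondCountableTopology M) (act : AddAction ℤ M)
    (hG : ∀ a : ℤ, ContMDiff (𝓡 n) (𝓡 n) ∞ fun p : M => a +ᵥ p)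
    (hrel : ∀ a : ℤ, F.Related F fun p : M => a +ᵥ p) {h : M → ℝ} (hh : Continuous h)
    {c : ℝ} (hc0 : c ≠ 0) (hadd : ∀ (a : ℤ) (p : M), h (a +ᵥ p) = h p + a * c) :
    ∃ (_ : ChartedSpace (EuclideanSpace ℝ (Fin n)) (OrbitSpace act))
      (_ : IsManifold (𝓡 n) ∞ (OrbitSpace act)) (S' : SubSpaceTime n (OrbitSpace act)),
      (F.toSubSpaceTime hF hn hc ht hs).IsQuotientBy act S' (OrbitSpace.proj act) ∧
      ∀ p q, S'.Chron (OrbitSpace.proj act p) (OrbitSpace.proj act q) ↔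
        ∃ m : ℤ, (F.toSubSpaceTime hF hn hc ht hs).Chron p (m +ᵥ q) := by
  have hcs : ContinuousConstVAdd ℤ M := ⟨fun a => (hG a).continuous⟩
  have hlc : LocallyCompactSpace M :=
    ChartedSpace.locallyCompactSpace (EuclideanSpace ℝ (Fin n)) M
  obtain ⟨hpd, hcov⟩ := isAddQuotientCoveringMap_of_height hh hc0 hadd
  set π : M → OrbitSpace act := OrbitSpace.proj act
  have hcov' : IsAddQuotientCoveringMap π ℤ := hcov
  have hloc : IsLocalHomeomorph π := hcov'.isCoveringMap.isLocalHomeomorph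
  have hsurj : Function.Surjective π := hcov'.surjective
  have hsm := contMDiffAt_localInverseAt_comp hcov' hloc hG
  refine ⟨hloc.chartedSpace hsurj, isManifold_chartedSpace hloc hsurj hsm, ?_⟩
  let _ : ChartedSpace (EuclideanSpace ℝ (Fin n)) (OrbitSpace act) := hloc.chartedSpace hsurj
  have _ : IsManifold (𝓡 n) ∞ (OrbitSpace act) := isManifold_chartedSpace hloc hsurj hsm
  have hdiff : IsLocalDiffeomorph (𝓡 n) (𝓡 n) ∞ π :=
    isLocalDiffeomorph_chartedSpace hloc hsurj hsm
  have hinv : ∀ (a : ℤ) (p : M), π (a +ᵥ p) = π p := fun a p =>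
    hcov'.apply_eq_iff_mem_orbit.2 ⟨a, rfl⟩
  obtain ⟨s, hs'⟩ := hsurj.hasRightInverse
  have hpush : F.Related (F.pushforward π s) π := by
    refine LorentzFrame.related_pushforward hdiff fun p => ?_
    obtain ⟨a, ha⟩ := hcov'.apply_eq_iff_mem_orbit.1 (hs' (π p))
    exact ⟨_, hG a, hrel a, funext (hinv a), ha.symm⟩
  have hF' := hF.of_surjective hdiff hsurj hpush
  have hc' : ConnectedSpace (OrbitSpace act) := hsurj.connectedSpace hdiff.contMDiff.continuous
  have ht' : T2Space (OrbitSpace act) := t2Space_of_properlyDiscontinuousVAdd_of_t2Space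
  have hs'' : SecondCountableTopology (OrbitSpace act) :=
    ContinuousConstVAdd.secondCountableTopology
  have hdeck : ∀ a : ℤ, ∃ Ψ : M ≃ₘ^∞⟮𝓡 n, 𝓡 n⟯ M, ⇑Ψ = fun p => a +ᵥ p := fun a =>
    ⟨⟨AddAction.toPerm a, hG a, hG (-a)⟩, rfl⟩
  refine ⟨(F.pushforward π s).toSubSpaceTime hF' hn hc' ht' hs'',
    ⟨fun a => ?_, hcov', hdiff, hpush.preserves, hpush.T⟩, fun p q => ⟨fun hpq => ?_, ?_⟩⟩
  · obtain ⟨Ψ, hΨ⟩ := hdeck a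
    have := hrel a
    rw [← hΨ] at this ⊢
    exact this.isIsometry
  · obtain ⟨q', hq', hpq'⟩ := hpq.exists_lift hdiff hcov'.isCoveringMap
      (hpush.preservesFuture hdiff)
    obtain ⟨m, hm⟩ := hcov'.apply_eq_iff_mem_orbit.1 hq'
    refine ⟨m, ?_⟩
    rwa [show m +ᵥ q = q' from hm]
  · rintro ⟨m, hm⟩
    rw [← hinv m q]
    exact hm.map hdiff (hpush.preservesFuture hdiff)

end QuotientFrame

/-! ### Frames on `ℝ³` -/

section FramesR3

/-- The frame of `ℝ³` with fields `T` and `X` and with the coordinate forms `i` and `j` as dual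
forms. -/
def frameR3 (T X : R3 → R3) (i j : Fin 3) : LorentzFrame 3 R3 where
  T p := T p
  X p := X p
  α _ := ((EuclideanSpace.proj i : R3 →L[ℝ] ℝ).toLinearMap : R3 →ₗ[ℝ] ℝ)
  β _ := ((EuclideanSpace.proj j : R3 →L[ℝ] ℝ).toLinearMap : R3 →ₗ[ℝ] ℝ)

variable {T X : R3 → R3} {i j : Fin 3}

theorem smoothFieldOn_iff {V : R3 → R3} {U : Set R3} :
    SmoothFieldOn (fun p => (V p : TangentSpace (𝓡 3) p)) U ↔ ContDiffOn ℝ ∞ V U :=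
  contMDiffOn_vectorSpace_iff_contDiffOn

/-- A frame of `ℝ³` dual to two coordinate forms is regular if some iterated bracket is a nonzero
multiple of `∂_z`. -/
theorem isRegular_frameR3 (hT : ContDiff ℝ ∞ T) (hX : ContDiff ℝ ∞ X)
    (hTi : ∀ p, T p i = 1) (hTj : ∀ p, T p j = 0) (hXi : ∀ p, X p i = 0) (hXj : ∀ p, X p j = 1)
    (hij : ∀ k, k = i ∨ k = j ∨ k = 2) (hi : i ≠ 2) (hj : j ≠ 2) {c : ℝ} (hc : c ≠ 0)
    {I : List (Fin 2)} (hI1 : I ≠ [])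
    (hI : ∀ p, iteratedBracket (frameR3 T X i j).field I p = (!₂[0, 0, c] : R3)) :
    (frameR3 T X i j).IsRegular where
  α_T := hTi
  α_X := hXi
  β_T := hTj
  β_X := hXj
  smooth k := by
    fin_cases k
    · exact smoothFieldOn_iff.2 hT.contDiffOn
    · exact smoothFieldOn_iff.2 hX.contDiffOn
  smooth_α U V _ hV := by
    have h := smoothFieldOn_iff.1 hV
    exact ((EuclideanSpace.proj i : R3 →L[ℝ] ℝ).contDiff.comp_contDiffOn h).contMDiffOn
  smooth_β U V _ hV := by
    have h := smoothFieldOn_iff.1 hV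
    exact ((EuclideanSpace.proj j : R3 →L[ℝ] ℝ).contDiff.comp_contDiffOn h).contMDiffOn
  bracket := by
    refine ⟨I.length, fun p => ?_⟩
    have hlen : 1 ≤ I.length := List.length_pos_iff.2 hI1
    set W : Submodule ℝ R3 := Submodule.span ℝ {v | ∃ J : List (Fin 2), J.length ≤ I.length ∧
      iteratedBracket (frameR3 T X i j).field J p = v} with hW
    have h1 : T p ∈ W := Submodule.subset_span ⟨[0], hlen, rfl⟩
    have h2 : X p ∈ W := Submodule.subset_span ⟨[1], hlen, rfl⟩
    have h3 : (!₂[0, 0, c] : R3) ∈ W := Submodule.subset_span ⟨I, le_rfl, hI p⟩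
    change W = ⊤
    refine Submodule.eq_top_iff'.2 fun v => ?_
    have hv : v = v i • T p + v j • X p +
        ((v 2 - v i * T p 2 - v j * X p 2) / c) • (!₂[0, 0, c] : R3) := by
      have hz : ∀ k : Fin 3, k ≠ 2 → (![0, 0, c] : Fin 3 → ℝ) k = 0 := by
        intro k hk
        fin_cases k <;> simp at hk ⊢
      ext k
      rcases hij k with rfl | rfl | rfl
      · simp only [PiLp.add_apply, PiLp.smul_apply, smul_eq_mul, hTi, hXi, hz _ hi]
        ring
      · simp only [PiLp.add_apply, PiLp.smul_apply, smul_eq_mul, hTj, hXj, hz _ hj]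
        ring
      · have : (![0, 0, c] : Fin 3 → ℝ) 2 = c := rfl
        simp only [PiLp.add_apply, PiLp.smul_apply, smul_eq_mul, this]
        field_simp
        ring
    rw [hv]
    exact W.add_mem (W.add_mem (W.smul_mem _ h1) (W.smul_mem _ h2)) (W.smul_mem _ h3)

theorem fderiv_R3_apply {a b c : R3 → ℝ} {p : R3} {a' b' c' : R3 →L[ℝ] ℝ} (ha : HasFDerivAt a a' p)
    (hb : HasFDerivAt b b' p) (hc : HasFDerivAt c c' p) (w : R3) :
    fderiv ℝ (fun q => (!₂[a q, b q, c q] : R3)) p w = !₂[a' w, b' w, c' w] := by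
  have h1 : HasFDerivAt (fun q => ![a q, b q, c q])
      (ContinuousLinearMap.pi ![a', b', c']) p := by
    refine hasFDerivAt_pi'' fun k => ?_
    fin_cases k
    exacts [ha, hb, hc]
  have h2 := ((EuclideanSpace.equiv (Fin 3) ℝ).symm.toContinuousLinearMap.hasFDerivAt
    (x := ![a p, b p, c p])).comp p h1
  have h3 : fderiv ℝ (fun q => (!₂[a q, b q, c q] : R3)) p = _ := h2.fderiv
  rw [h3]
  ext k
  fin_cases k <;> rfl

theorem hasFDerivAt_coord (k : Fin 3) (p : R3) :
    HasFDerivAt (fun q : R3 => q k) (EuclideanSpace.proj k : R3 →L[ℝ] ℝ) p :=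
  (EuclideanSpace.proj k : R3 →L[ℝ] ℝ).hasFDerivAt

/-- The frame of the Heisenberg group. -/
def heisenbergFrame : LorentzFrame 3 R3 := frameR3 heisenbergT heisenbergY 0 1

/-- The frame of the Martinet distribution. -/
def martinetFrame : LorentzFrame 3 R3 := frameR3 martinetT martinetX 1 0

theorem fderiv_heisenbergT (p w : R3) :
    fderiv ℝ (fun q => (heisenbergT q : R3)) p w = !₂[0, 0, w 1 / 2] := by
  have h := fderiv_R3_apply (hasFDerivAt_const (1 : ℝ) p) (hasFDerivAt_const (0 : ℝ) p)
    ((hasFDerivAt_coord 1 p).mul_const (1 / 2 : ℝ)) w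
  have e : (fun q => (heisenbergT q : R3)) = fun q => (!₂[1, 0, q 1 * (1 / 2)] : R3) := by
    funext q
    change (!₂[1, 0, q 1 / 2] : R3) = _
    rw [div_eq_mul_one_div]
  rw [e, h]
  ext k
  fin_cases k <;> simp
  ring

theorem fderiv_heisenbergY (p w : R3) :
    fderiv ℝ (fun q => (heisenbergY q : R3)) p w = !₂[0, 0, -(w 0 / 2)] := by
  have h := fderiv_R3_apply (hasFDerivAt_const (0 : ℝ) p) (hasFDerivAt_const (1 : ℝ) p)
    ((hasFDerivAt_coord 0 p).mul_const (-(1 / 2) : ℝ)) w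
  have e : (fun q => (heisenbergY q : R3)) = fun q => (!₂[0, 1, q 0 * (-(1 / 2))] : R3) := by
    funext q
    change (!₂[0, 1, -(q 0 / 2)] : R3) = _
    congr 3
    ring_nf
  rw [e, h]
  ext k
  fin_cases k <;> simp
  ring

theorem fderiv_martinetT (p w : R3) :
    fderiv ℝ (fun q => (martinetT q : R3)) p w = !₂[0, 0, 2 * p 0 * w 0] := by
  have h := fderiv_R3_apply (hasFDerivAt_const (0 : ℝ) p) (hasFDerivAt_const (1 : ℝ) p)
    ((hasFDerivAt_coord 0 p).pow 2) w
  refine h.trans ?_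
  ext k
  fin_cases k <;> simp

theorem contDiff_R3 {a b c : R3 → ℝ} (ha : ContDiff ℝ ∞ a) (hb : ContDiff ℝ ∞ b)
    (hc : ContDiff ℝ ∞ c) : ContDiff ℝ ∞ fun q => (!₂[a q, b q, c q] : R3) := by
  rw [contDiff_euclidean]
  intro k
  fin_cases k
  exacts [ha, hb, hc]

theorem mlieBracket_R3 (V W : ∀ p : R3, TangentSpace (𝓡 3) p) (p : R3) :
    VectorField.mlieBracket (𝓡 3) V W p =
      fderiv ℝ (fun q => (W q : R3)) p (V p) - fderiv ℝ (fun q => (V q : R3)) p (W p) := by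
  rw [← VectorField.mlieBracketWithin_univ, VectorField.mlieBracketWithin_eq_lieBracketWithin]
  exact congrFun (VectorField.lieBracketWithin_univ (𝕜 := ℝ) (V := fun q => (V q : R3))
    (W := fun q => (W q : R3))) p

theorem isRegular_heisenbergFrame : heisenbergFrame.IsRegular := by
  refine isRegular_frameR3 (c := -1) (I := [0, 1])
    (contDiff_R3 contDiff_const contDiff_const (by fun_prop))
    (contDiff_R3 contDiff_const contDiff_const (by fun_prop)) (fun _ => rfl) (fun _ => rfl)
    (fun _ => rfl) (fun _ => rfl) (by decide) (by decide) (by decide) (by norm_num) (by simp)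
    fun p => ?_
  refine (mlieBracket_R3 heisenbergT heisenbergY p).trans ?_
  refine (congrArg₂ (fun a b : R3 => a - b) (fderiv_heisenbergY p _)
    (fderiv_heisenbergT p _)).trans ?_
  ext k
  fin_cases k <;> simp [heisenbergT, heisenbergY, R3.tangent]
  norm_num

theorem isRegular_martinetFrame : martinetFrame.IsRegular := by
  refine isRegular_frameR3 (c := 2) (I := [1, 1, 0])
    (contDiff_R3 contDiff_const contDiff_const (by fun_prop))
    (contDiff_R3 contDiff_const contDiff_const contDiff_const) (fun _ => rfl) (fun _ => rfl)
    (fun _ => rfl) (fun _ => rfl) (by decide) (by decide) (by decide) (by norm_num) (by simp)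
    fun p => ?_
  have hX : ∀ p w : R3, fderiv ℝ (fun q => (martinetX q : R3)) p w = 0 := fun p w => by
    have : (fun q => (martinetX q : R3)) = fun _ => (!₂[1, 0, 0] : R3) := rfl
    rw [this, fderiv_fun_const]
    rfl
  have h1 : VectorField.mlieBracket 𝓘(ℝ, R3) martinetX martinetT =
      fun q => (!₂[0, 0, q 0 * 2] : R3) := by
    funext q
    refine (mlieBracket_R3 martinetX martinetT q).trans ?_
    refine (congrArg₂ (fun a b : R3 => a - b) (fderiv_martinetT q _) (hX q _)).trans ?_
    ext k
    fin_cases k <;> simp [martinetX, R3.tangent]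
    ring
  change VectorField.mlieBracket 𝓘(ℝ, R3) martinetX
    (VectorField.mlieBracket 𝓘(ℝ, R3) martinetX martinetT) p = _
  rw [h1]
  refine (mlieBracket_R3 martinetX _ p).trans ?_
  refine (congrArg₂ (fun a b : R3 => a - b) (fderiv_R3_apply (hasFDerivAt_const (0 : ℝ) p)
    (hasFDerivAt_const (0 : ℝ) p) ((hasFDerivAt_coord 0 p).mul_const (2 : ℝ)) _)
    (hX p _)).trans ?_
  ext k
  fin_cases k <;> simp [martinetX, R3.tangent]

/-- A map preserves a frame of `ℝ³` and its coordinate coframe if its derivative carries the fields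
of the frame to themselves and does not change the coordinates `i` and `j` of vectors. -/
theorem related_frameR3 {f : R3 → R3} (hi : ∀ p w, fderiv ℝ f p w i = w i)
    (hj : ∀ p w, fderiv ℝ f p w j = w j) (hT : ∀ p, fderiv ℝ f p (T p) = T (f p))
    (hX : ∀ p, fderiv ℝ f p (X p) = X (f p)) :
    (frameR3 T X i j).Related (frameR3 T X i j) f := by
  have h : ∀ p, mfderiv (𝓡 3) (𝓡 3) f p = fderiv ℝ f p := fun p => mfderiv_eq_fderiv
  constructor
  · intro p
    rw [h]
    exact hT p
  · intro p
    rw [h]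
    exact hX p
  · intro p v
    rw [h]
    exact hi p v
  · intro p v
    rw [h]
    exact hj p v

/-- The isometry `Φ_m` of the Heisenberg group. -/
def heisenbergShift (φ : ℝ) (m : ℤ) (p : R3) : R3 :=
  !₂[p 0 - m * Real.cosh φ, p 1 - m * Real.sinh φ,
    p 2 + m / 2 * (p 1 * Real.cosh φ - p 0 * Real.sinh φ)]

theorem contDiff_heisenbergShift (φ : ℝ) (m : ℤ) : ContDiff ℝ ∞ (heisenbergShift φ m) :=
  contDiff_R3 (by fun_prop) (by fun_prop) (by fun_prop)

theorem related_heisenbergShift (φ : ℝ) (m : ℤ) :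
    heisenbergFrame.Related heisenbergFrame (heisenbergShift φ m) := by
  have h : ∀ p w : R3, fderiv ℝ (heisenbergShift φ m) p w =
      !₂[w 0, w 1, w 2 + m / 2 * (w 1 * Real.cosh φ - w 0 * Real.sinh φ)] := fun p w =>
    fderiv_R3_apply ((hasFDerivAt_coord 0 p).sub_const _) ((hasFDerivAt_coord 1 p).sub_const _)
      ((hasFDerivAt_coord 2 p).add ((((hasFDerivAt_coord 1 p).mul_const (Real.cosh φ)).sub
        ((hasFDerivAt_coord 0 p).mul_const (Real.sinh φ))).const_mul ((m : ℝ) / 2))) w |>.trans (by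
      ext k
      fin_cases k <;> simp [mul_comm])
  refine related_frameR3 (fun p w => ?_) (fun p w => ?_) (fun p => ?_) (fun p => ?_)
  · rw [h]
    rfl
  · rw [h]
    rfl
  · refine (h p _).trans ?_
    ext k
    fin_cases k <;> simp [heisenbergT, R3.tangent, heisenbergShift]
    ring
  · refine (h p _).trans ?_
    ext k
    fin_cases k <;> simp [heisenbergY, R3.tangent, heisenbergShift]
    ring

theorem contDiff_shiftY (s : ℝ) : ContDiff ℝ ∞ (shiftY s) :=
  contDiff_R3 (by fun_prop) (by fun_prop) (by fun_prop)

theorem fderiv_shiftY (s : ℝ) (p w : R3) : fderiv ℝ (shiftY s) p w = w :=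
  (fderiv_R3_apply (hasFDerivAt_coord 0 p) ((hasFDerivAt_coord 1 p).add_const s)
    (hasFDerivAt_coord 2 p) w).trans (by
      ext k
      fin_cases k <;> simp)

theorem related_shiftY (s : ℝ) : martinetFrame.Related martinetFrame (shiftY s) := by
  refine related_frameR3 (fun p w => ?_) (fun p w => ?_) (fun p => ?_) (fun p => ?_)
  · rw [fderiv_shiftY]
  · rw [fderiv_shiftY]
  · exact fderiv_shiftY s p _
  · exact fderiv_shiftY s p _

end FramesR3

/-! ### Open submanifolds -/

section Opens

variable {n : ℕ} {M : Type*} [TopologicalSpace M] [ChartedSpace (EuclideanSpace ℝ (Fin n)) M]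
  {U : TopologicalSpace.Opens M}

/-- The tangent spaces of an open subset are those of the ambient manifold, in the same coordinates:
the preferred chart of the subset is the restriction of the ambient one. -/
theorem mfderiv_subtypeVal (p : U) (w : TangentSpace (𝓡 n) p) :
    (mfderiv (𝓡 n) (𝓡 n) (Subtype.val : U → M) p w : EuclideanSpace ℝ (Fin n)) = w := by
  have h : HasMFDerivAt (𝓡 n) (𝓡 n) (Subtype.val : U → M) p
      (ContinuousLinearMap.id ℝ (EuclideanSpace ℝ (Fin n))) := by
    refine ⟨continuous_subtype_val.continuousAt, ?_⟩
    refine (hasFDerivWithinAt_id _ _).congr_of_eventuallyEq ?_ ?_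
    · have h1 := TopologicalSpace.Opens.chartAt_subtype_val_symm_eventuallyEq
        (H := EuclideanSpace ℝ (Fin n)) U (x := p)
      have h2 : ∀ᶠ u in 𝓝 (chartAt (EuclideanSpace ℝ (Fin n)) p.1 p.1),
          u ∈ (chartAt (EuclideanSpace ℝ (Fin n)) p.1).target :=
        (chartAt _ p.1).open_target.mem_nhds (mem_chart_target _ _)
      refine Filter.Eventually.filter_mono nhdsWithin_le_nhds ?_
      change ∀ᶠ u in 𝓝 (chartAt (EuclideanSpace ℝ (Fin n)) p.1 p.1), _
      filter_upwards [h1, h2] with u hu1 hu2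
      change chartAt (EuclideanSpace ℝ (Fin n)) p.1
        ((chartAt (EuclideanSpace ℝ (Fin n)) p).symm u).1 = u
      rw [show ((chartAt (EuclideanSpace ℝ (Fin n)) p).symm u).1 =
        (chartAt (EuclideanSpace ℝ (Fin n)) p.1).symm u from hu1.symm]
      exact (chartAt _ p.1).right_inv hu2
    · change chartAt (EuclideanSpace ℝ (Fin n)) p.1
        ((chartAt (EuclideanSpace ℝ (Fin n)) p).symm (chartAt (EuclideanSpace ℝ (Fin n)) p p)).1 =
          chartAt (EuclideanSpace ℝ (Fin n)) p.1 p.1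
      rw [(chartAt _ p).left_inv (mem_chart_source _ _)]
  rw [h.mfderiv]
  rfl

theorem isLocalDiffeomorph_subtypeVal :
    IsLocalDiffeomorph (𝓡 n) (𝓡 n) ∞ (Subtype.val : U → M) := by
  intro p
  set e := U.openPartialHomeomorphSubtypeCoe ⟨p⟩
  refine ⟨⟨e.toPartialEquiv, e.open_source, e.open_target, contMDiff_subtype_val.contMDiffOn, ?_⟩,
    mem_univ _, fun _ _ => rfl⟩
  intro q hq
  refine ContMDiffAt.contMDiffWithinAt ?_
  refine (ContMDiffAt.subtypeVal_comp_iff U _ q).1 ?_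
  refine contMDiffAt_id.congr_of_eventuallyEq ?_
  filter_upwards [e.open_target.mem_nhds hq] with u hu using e.right_inv hu

end Opens

/-! ### The model space-times and their quotients -/

/-- The frame of the Martinet distribution on the slit space. -/
def slitFrame : LorentzFrame 3 slitSpace where
  T := slitT
  X := slitX
  α _ := ((EuclideanSpace.proj 1 : R3 →L[ℝ] ℝ).toLinearMap : R3 →ₗ[ℝ] ℝ)
  β _ := ((EuclideanSpace.proj 0 : R3 →L[ℝ] ℝ).toLinearMap : R3 →ₗ[ℝ] ℝ)

theorem related_subtypeVal : slitFrame.Related martinetFrame Subtype.val where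
  T p := mfderiv_subtypeVal p _
  X p := mfderiv_subtypeVal p _
  α p v := congrArg (fun w : R3 => w 1) (mfderiv_subtypeVal p v)
  β p v := congrArg (fun w : R3 => w 0) (mfderiv_subtypeVal p v)

theorem isRegular_slitFrame : slitFrame.IsRegular :=
  isRegular_martinetFrame.of_related isLocalDiffeomorph_subtypeVal related_subtypeVal

theorem contMDiff_slitShift (m : ℤ) : ContMDiff (𝓡 3) (𝓡 3) ∞
    fun p : slitSpace => slitShiftAction.toVAdd.vadd m p := by
  refine (ContMDiff.subtypeVal_comp_iff slitSpace _).1 ?_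
  exact (contDiff_shiftY (2 * m)).contMDiff.comp contMDiff_subtype_val

theorem related_slitShift (m : ℤ) : slitFrame.Related slitFrame
    fun p : slitSpace => slitShiftAction.toVAdd.vadd m p := by
  -- the derivative is the identity, as for the translation of `ℝ³` that covers it
  have h : ∀ (p : slitSpace) (w : TangentSpace (𝓡 3) p), (mfderiv (𝓡 3) (𝓡 3)
      (fun p : slitSpace => slitShiftAction.toVAdd.vadd m p) p w : R3) = w := by
    intro p w
    have h1 := (contMDiff_subtype_val (I := 𝓡 3) (n := ∞) (U := slitSpace)).mdifferentiableAt
      (by simp) (x := slitShiftAction.toVAdd.vadd m p) |>.hasMFDerivAt.comp p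
      ((contMDiff_slitShift m).mdifferentiableAt (by simp) (x := p)).hasMFDerivAt
    have h2 := ((contDiff_shiftY (2 * m)).contMDiff.mdifferentiableAt (by simp)
      (x := p.1)).hasMFDerivAt.comp p ((contMDiff_subtype_val (I := 𝓡 3) (n := ∞)
        (U := slitSpace)).mdifferentiableAt (by simp) (x := p)).hasMFDerivAt
    have h3 := congrArg (fun L => (L w : R3)) (hasMFDerivAt_unique h1 h2)
    have h4 : mfderiv (𝓡 3) (𝓡 3) (shiftY (2 * m)) p.1 = fderiv ℝ (shiftY (2 * m)) p.1 :=
      mfderiv_eq_fderiv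
    have h5 := (mfderiv_subtypeVal (slitShiftAction.toVAdd.vadd m p) _).symm.trans h3
    refine h5.trans ?_
    change mfderiv (𝓡 3) (𝓡 3) (shiftY (2 * m)) p.1 _ = w
    rw [h4]
    exact (fderiv_shiftY _ _ _).trans (mfderiv_subtypeVal p w)
  exact ⟨fun p => h p _, fun p => h p _, fun p v => congrArg (fun w : R3 => w 1) (h p v),
    fun p v => congrArg (fun w : R3 => w 0) (h p v)⟩

/-- The slit space is the product of a line with the complement of a countable set in the plane. -/
instance connectedSpace_slitSpace : ConnectedSpace slitSpace := by
  refine isConnected_iff_connectedSpace (s := (slitSpace : Set R3)).1 ?_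
  have hc : (range fun k : ℤ => ((0 : ℝ), 2 * (k : ℝ))).Countable := countable_range _
  have h1 := (hc.isPathConnected_compl_of_one_lt_rank
    (by simp [one_add_one_eq_two])).isConnected
  have h2 := (h1.prod (isConnected_univ (α := ℝ))).image
    (fun q : (ℝ × ℝ) × ℝ => (!₂[q.1.1, q.1.2, q.2] : R3)) (by fun_prop)
  convert h2
  ext p
  constructor
  · intro hp
    refine ⟨((p 0, p 1), p 2), ⟨?_, mem_univ _⟩, ?_⟩
    · rintro ⟨k, hk⟩
      exact hp ⟨k, (congrArg Prod.fst hk).symm, (congrArg Prod.snd hk).symm⟩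
    · ext k
      fin_cases k <;> rfl
  · rintro ⟨q, ⟨hq, -⟩, rfl⟩ ⟨k, h0, h1⟩
    exact hq ⟨k, Prod.ext h0.symm h1.symm⟩

/-- The Lorentzian Heisenberg group. -/
def heisenbergSpaceTime : SubSpaceTime 3 R3 :=
  heisenbergFrame.toSubSpaceTime isRegular_heisenbergFrame (by norm_num) inferInstance
    inferInstance inferInstance

/-- `ℝ³` with the Martinet distribution. -/
def martinetSpaceTime : SubSpaceTime 3 R3 :=
  martinetFrame.toSubSpaceTime isRegular_martinetFrame (by norm_num) inferInstance
    inferInstance inferInstance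

/-- The slit space with the Martinet distribution. -/
def slitSpaceTime : SubSpaceTime 3 slitSpace :=
  slitFrame.toSubSpaceTime isRegular_slitFrame (by norm_num) inferInstance
    inferInstance inferInstance

theorem isFramedBy_heisenberg : heisenbergSpaceTime.IsFramedBy heisenbergT heisenbergY :=
  LorentzFrame.isFramedBy_toSubSpaceTime

theorem isFramedBy_martinet : martinetSpaceTime.IsFramedBy martinetT martinetX :=
  LorentzFrame.isFramedBy_toSubSpaceTime

theorem isFramedBy_slit : slitSpaceTime.IsFramedBy slitT slitX :=
  LorentzFrame.isFramedBy_toSubSpaceTime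

theorem isFutureTimelike_heisenberg_iff {p w : R3} :
    heisenbergSpaceTime.IsFutureTimelike p w ↔
      w 2 = w 0 * (p 1 / 2) - w 1 * (p 0 / 2) ∧ |w 1| < w 0 := by
  refine LorentzFrame.isFutureTimelike_toSubSpaceTime_iff.trans (and_congr_left' ?_)
  refine isRegular_heisenbergFrame.mem_distribution_iff.trans ?_
  change w = w 0 • (!₂[1, 0, p 1 / 2] : R3) + w 1 • (!₂[0, 1, -(p 0 / 2)] : R3) ↔ _
  constructor
  · intro h
    have := congrArg (fun v : R3 => v 2) h
    simp at this
    linarith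
  · intro h
    ext k
    fin_cases k <;> simp [h]
    ring

theorem isFutureTimelike_martinet_iff {p w : R3} :
    martinetSpaceTime.IsFutureTimelike p w ↔ w 2 = w 1 * p 0 ^ 2 ∧ |w 0| < w 1 := by
  refine LorentzFrame.isFutureTimelike_toSubSpaceTime_iff.trans (and_congr_left' ?_)
  refine isRegular_martinetFrame.mem_distribution_iff.trans ?_
  change w = w 1 • (!₂[0, 1, p 0 ^ 2] : R3) + w 0 • (!₂[1, 0, 0] : R3) ↔ _
  constructor
  · intro h
    simpa using congrArg (fun v : R3 => v 2) h
  · intro h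
    ext k
    fin_cases k <;> simp [h]

theorem preservesFuture_subtypeVal :
    PreservesFuture slitSpaceTime martinetSpaceTime Subtype.val :=
  related_subtypeVal.preservesFuture isLocalDiffeomorph_subtypeVal

/-- `-m cosh φ` is the change of `x` under the action, and `cosh φ` does not vanish, so `x` is the
function that makes the action a covering action. -/
theorem exists_heisenberg_quotient (φ : ℝ) :
    ∃ (_ : ChartedSpace (EuclideanSpace ℝ (Fin 3)) (OrbitSpace (heisenbergAction φ)))
      (_ : IsManifold (𝓡 3) ∞ (OrbitSpace (heisenbergAction φ)))
      (S' : SubSpaceTime 3 (OrbitSpace (heisenbergAction φ))),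
      heisenbergSpaceTime.IsQuotientBy (heisenbergAction φ) S'
        (OrbitSpace.proj (heisenbergAction φ)) ∧
      ∀ p q, S'.Chron (OrbitSpace.proj (heisenbergAction φ) p)
        (OrbitSpace.proj (heisenbergAction φ) q) ↔
        ∃ m : ℤ, heisenbergSpaceTime.Chron p (heisenbergShift φ m q) := by
  refine LorentzFrame.exists_quotient _ _ _ _ _ (heisenbergAction φ)
    (fun m => (contDiff_heisenbergShift φ m).contMDiff) (related_heisenbergShift φ)
    (h := fun p => p 0) (by fun_prop) (c := -Real.cosh φ) (neg_ne_zero.2 (Real.cosh_pos φ).ne')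
    fun m p => ?_
  change p 0 - m * Real.cosh φ = _
  ring

theorem exists_martinet_quotient :
    ∃ (_ : ChartedSpace (EuclideanSpace ℝ (Fin 3)) (OrbitSpace unitShiftAction))
      (_ : IsManifold (𝓡 3) ∞ (OrbitSpace unitShiftAction))
      (S' : SubSpaceTime 3 (OrbitSpace unitShiftAction)),
      martinetSpaceTime.IsQuotientBy unitShiftAction S' (OrbitSpace.proj unitShiftAction) ∧
      ∀ p q, S'.Chron (OrbitSpace.proj unitShiftAction p) (OrbitSpace.proj unitShiftAction q) ↔
        ∃ m : ℤ, martinetSpaceTime.Chron p (shiftY m q) := by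
  refine LorentzFrame.exists_quotient _ _ _ _ _ unitShiftAction
    (fun m => (contDiff_shiftY m).contMDiff) (fun m => related_shiftY m)
    (h := fun p => p 1) (by fun_prop) (c := 1) one_ne_zero fun m p => ?_
  change p 1 + m = _
  ring

theorem exists_slit_quotient :
    ∃ (_ : ChartedSpace (EuclideanSpace ℝ (Fin 3)) (OrbitSpace slitShiftAction))
      (_ : IsManifold (𝓡 3) ∞ (OrbitSpace slitShiftAction))
      (S' : SubSpaceTime 3 (OrbitSpace slitShiftAction)),
      slitSpaceTime.IsQuotientBy slitShiftAction S' (OrbitSpace.proj slitShiftAction) ∧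
      ∀ p q, S'.Chron (OrbitSpace.proj slitShiftAction p) (OrbitSpace.proj slitShiftAction q) ↔
        ∃ m : ℤ, slitSpaceTime.Chron p (slitShiftAction.toVAdd.vadd m q) := by
  refine LorentzFrame.exists_quotient _ _ _ _ _ slitShiftAction
    contMDiff_slitShift related_slitShift
    (h := fun p => p.1 1) (by fun_prop) (c := 2) two_ne_zero fun m p => ?_
  change p.1 1 + 2 * m = _
  ring

/-! ### Curves and boxes in `ℝ³` -/

section CurvesR3

variable {S : SubSpaceTime 3 R3} {γ : ℝ → R3} {s t : ℝ}

theorem SubSpaceTime.IsTimelikeFutureCurve.le_of_hasFDerivAt (hγ : S.IsTimelikeFutureCurve γ)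
    {h : R3 → ℝ} {h' : R3 → R3 →L[ℝ] ℝ} (hh : ContDiff ℝ 1 h) (hd : ∀ q, HasFDerivAt h (h' q) q)
    (hs : 0 ≤ s) (hst : s ≤ t) (ht : t ≤ 1)
    (hpos : ∀ u ∈ Ioo s t, ∀ w : R3, S.IsFutureTimelike (γ u) w → 0 ≤ h' (γ u) w) :
    h (γ s) ≤ h (γ t) := by
  refine hγ.le_of_mfderiv_nonneg hh.contMDiff hs hst ht fun u hu w hw => ?_
  have h1 : mfderiv (𝓡 3) 𝓘(ℝ, ℝ) h (γ u) = h' (γ u) := mfderiv_eq_fderiv.trans (hd _).fderiv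
  rw [h1]
  exact hpos u hu w hw

theorem SubSpaceTime.IsTimelikeFutureCurve.lt_of_hasFDerivAt (hγ : S.IsTimelikeFutureCurve γ)
    {h : R3 → ℝ} {h' : R3 → R3 →L[ℝ] ℝ} (hh : ContDiff ℝ 1 h) (hd : ∀ q, HasFDerivAt h (h' q) q)
    (hs : 0 ≤ s) (hst : s < t) (ht : t ≤ 1)
    (hpos : ∀ u ∈ Ioo s t, ∀ w : R3, S.IsFutureTimelike (γ u) w → 0 < h' (γ u) w) :
    h (γ s) < h (γ t) := by
  refine hγ.lt_of_mfderiv_pos hh.contMDiff hs hst ht fun u hu w hw => ?_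
  have h1 : mfderiv (𝓡 3) 𝓘(ℝ, ℝ) h (γ u) = h' (γ u) := mfderiv_eq_fderiv.trans (hd _).fderiv
  rw [h1]
  exact hpos u hu w hw

theorem exists_box_subset {U : Set R3} (hU : IsOpen U) {p : R3} (hp : p ∈ U) :
    ∃ η > 0, ∀ q : R3, |q 0 - p 0| < η → |q 1 - p 1| < η → |q 2 - p 2| < η → q ∈ U := by
  obtain ⟨ε, hε, h⟩ := Metric.isOpen_iff.1 hU p hp
  refine ⟨ε / 2, by positivity, fun q h0 h1 h2 => h ?_⟩
  rw [Metric.mem_ball, EuclideanSpace.dist_eq, Real.sqrt_lt' hε, Fin.sum_univ_three]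
  simp only [Real.dist_eq]
  have h0' := abs_nonneg (q 0 - p 0)
  have h1' := abs_nonneg (q 1 - p 1)
  have h2' := abs_nonneg (q 2 - p 2)
  nlinarith

end CurvesR3

/-! ### The Heisenberg group -/

/-- The difference of the values of the null coordinate `x + y`. -/
def nullA (p q : R3) : ℝ := q 0 + q 1 - (p 0 + p 1)

/-- The difference of the values of the null coordinate `x - y`. -/
def nullB (p q : R3) : ℝ := q 0 - q 1 - (p 0 - p 1)

/-- The third coordinate of `p⁻¹ q` in the Heisenberg group. -/
def heightZ (p q : R3) : ℝ :=
  q 2 - p 2 - ((p 0 + p 1) * nullB p q - (p 0 - p 1) * nullA p q) / 4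

theorem hasFDerivAt_nullA (p q : R3) : HasFDerivAt (nullA p)
    ((EuclideanSpace.proj 0 : R3 →L[ℝ] ℝ) + (EuclideanSpace.proj 1 : R3 →L[ℝ] ℝ)) q :=
  ((hasFDerivAt_coord 0 q).add (hasFDerivAt_coord 1 q)).sub_const _

theorem hasFDerivAt_nullB (p q : R3) : HasFDerivAt (nullB p)
    ((EuclideanSpace.proj 0 : R3 →L[ℝ] ℝ) - (EuclideanSpace.proj 1 : R3 →L[ℝ] ℝ)) q :=
  ((hasFDerivAt_coord 0 q).sub (hasFDerivAt_coord 1 q)).sub_const _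

theorem contDiff_nullA (p : R3) : ContDiff ℝ 1 (nullA p) := by unfold nullA; fun_prop

theorem contDiff_nullB (p : R3) : ContDiff ℝ 1 (nullB p) := by unfold nullB; fun_prop

theorem contDiff_heightZ (p : R3) : ContDiff ℝ 1 (heightZ p) := by
  unfold heightZ nullA nullB; fun_prop

theorem fderiv_heightZ (p q w : R3) : fderiv ℝ (heightZ p) q w =
    w 2 - ((p 0 + p 1) * (w 0 - w 1) - (p 0 - p 1) * (w 0 + w 1)) / 4 := by
  have h := ((hasFDerivAt_coord 2 q).sub_const (p 2)).sub
    ((((hasFDerivAt_nullB p q).const_mul (p 0 + p 1)).sub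
      ((hasFDerivAt_nullA p q).const_mul (p 0 - p 1))).mul_const (1 / 4))
  have e : heightZ p = fun q => q 2 - p 2 -
      ((p 0 + p 1) * nullB p q - (p 0 - p 1) * nullA p q) * (1 / 4) := by
    funext q
    rw [heightZ, div_eq_mul_one_div]
  rw [e]
  refine (congrArg (fun L : R3 →L[ℝ] ℝ => L w) h.fderiv).trans ?_
  simp
  ring

/-- With `A`, `B` and `Z` for `nullA`, `nullB` and `heightZ`, one has `4 Z' = A B' - A' B` along
horizontal curves, so that `A B - 4 Z` and `A B + 4 Z` have the derivatives `2 A' B` and `2 A B'`.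
As `A'` and `B'` are positive along timelike curves, all of `A`, `B` and `A B ± 4 Z` increase from
`0`. -/
theorem chron_heisenberg_necessary {p q : R3} (h : heisenbergSpaceTime.Chron p q) :
    0 < nullA p q ∧ 0 < nullB p q ∧ 4 * |heightZ p q| < nullA p q * nullB p q := by
  obtain ⟨γ, hγ, rfl, rfl⟩ := h
  have hA : ∀ u, 0 < u → u ≤ 1 → 0 < nullA (γ 0) (γ u) := fun u hu hu1 => by
    have := hγ.lt_of_hasFDerivAt (contDiff_nullA (γ 0)) (hasFDerivAt_nullA (γ 0)) le_rfl hu hu1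
      fun v _ w hw => by
        have := (abs_lt.1 (isFutureTimelike_heisenberg_iff.1 hw).2).1
        change 0 < w 0 + w 1
        linarith
    simpa [nullA] using this
  have hB : ∀ u, 0 < u → u ≤ 1 → 0 < nullB (γ 0) (γ u) := fun u hu hu1 => by
    have := hγ.lt_of_hasFDerivAt (contDiff_nullB (γ 0)) (hasFDerivAt_nullB (γ 0)) le_rfl hu hu1
      fun v _ w hw => by
        have := (abs_lt.1 (isFutureTimelike_heisenberg_iff.1 hw).2).2
        change 0 < w 0 - w 1
        linarith
    simpa [nullB] using this
  have hZ : ∀ q, HasFDerivAt (heightZ (γ 0)) (fderiv ℝ (heightZ (γ 0)) q) q := fun q =>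
    ((contDiff_heightZ (γ 0)).differentiable (by simp) q).hasFDerivAt
  have h00 : nullA (γ 0) (γ 0) = 0 ∧ nullB (γ 0) (γ 0) = 0 ∧ heightZ (γ 0) (γ 0) = 0 := by
    simp [nullA, nullB, heightZ]
  refine ⟨hA 1 one_pos le_rfl, hB 1 one_pos le_rfl, ?_⟩
  have h1 : 0 < nullA (γ 0) (γ 1) * nullB (γ 0) (γ 1) - 4 * heightZ (γ 0) (γ 1) := by
    have := hγ.lt_of_hasFDerivAt (s := 0) (t := 1)
      (h := fun q => nullA (γ 0) q * nullB (γ 0) q - 4 * heightZ (γ 0) q)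
      (((contDiff_nullA _).mul (contDiff_nullB _)).sub (contDiff_const.mul (contDiff_heightZ _)))
      (fun q => ((hasFDerivAt_nullA _ q).mul (hasFDerivAt_nullB _ q)).sub ((hZ q).const_mul 4))
      le_rfl one_pos le_rfl fun u hu w hw => by
        obtain ⟨h1, h2⟩ := isFutureTimelike_heisenberg_iff.1 hw
        have h3 : 0 < 2 * (w 0 + w 1) * nullB (γ 0) (γ u) :=
          mul_pos (by linarith [(abs_lt.1 h2).1]) (hB u hu.1 hu.2.le)
        refine h3.trans_eq ?_
        simp [fderiv_heightZ, nullA, nullB, h1]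
        ring
    simpa [h00] using this
  have h2 : 0 < nullA (γ 0) (γ 1) * nullB (γ 0) (γ 1) + 4 * heightZ (γ 0) (γ 1) := by
    have := hγ.lt_of_hasFDerivAt (s := 0) (t := 1)
      (h := fun q => nullA (γ 0) q * nullB (γ 0) q + 4 * heightZ (γ 0) q)
      (((contDiff_nullA _).mul (contDiff_nullB _)).add (contDiff_const.mul (contDiff_heightZ _)))
      (fun q => ((hasFDerivAt_nullA _ q).mul (hasFDerivAt_nullB _ q)).add ((hZ q).const_mul 4))
      le_rfl one_pos le_rfl fun u hu w hw => by
        obtain ⟨h1, h2⟩ := isFutureTimelike_heisenberg_iff.1 hw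
        have h3 : 0 < 2 * nullA (γ 0) (γ u) * (w 0 - w 1) :=
          mul_pos (by linarith [hA u hu.1 hu.2.le]) (by linarith [(abs_lt.1 h2).2])
        refine h3.trans_eq ?_
        simp [fderiv_heightZ, nullA, nullB, h1]
        ring
    simpa [h00] using this
  have h3 : |4 * heightZ (γ 0) (γ 1)| < nullA (γ 0) (γ 1) * nullB (γ 0) (γ 1) :=
    abs_lt.2 ⟨by linarith, by linarith⟩
  rwa [abs_mul, abs_of_pos (by norm_num : (0 : ℝ) < 4)] at h3

/-- The horizontal curve with null coordinates `A t ^ s` and `B t ^ r` relative to its starting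
point is timelike, and its final height is `A B / 4` times `(r - s) / (r + s)`. -/
theorem chron_heisenberg_sufficient {p q : R3} (hA : 0 < nullA p q) (hB : 0 < nullB p q)
    (hZ : 4 * |heightZ p q| < nullA p q * nullB p q) : heisenbergSpaceTime.Chron p q := by
  set A := nullA p q with hAdef
  set B := nullB p q with hBdef
  set δ : ℝ := 4 * heightZ p q / (A * B) with hδ
  have hAB : 0 < A * B := mul_pos hA hB
  have hZδ : heightZ p q = A * B / 4 * δ := by
    rw [hδ]
    field_simp
  have hδ1 : |δ| < 1 := by
    rw [hδ, abs_div, abs_of_pos hAB, div_lt_one hAB, abs_mul, abs_of_pos (by norm_num : (0:ℝ) < 4)]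
    exact hZ
  -- the exponents, scaled so that both are at least one
  set s : ℝ := (1 - δ) / (1 - |δ|) with hs
  set r : ℝ := (1 + δ) / (1 - |δ|) with hr
  have hK : 0 < 1 - |δ| := by linarith
  have hs1 : 1 ≤ s := (one_le_div hK).2 (by linarith [le_abs_self δ])
  have hr1 : 1 ≤ r := (one_le_div hK).2 (by linarith [neg_abs_le δ])
  have hsr : δ * (r + s) = r - s := by
    rw [hs, hr]
    field_simp
    ring
  have hpow : ∀ k : ℝ, 1 ≤ k → ContDiff ℝ 1 fun t : ℝ => t ^ k := fun k hk => by
    exact_mod_cast Real.contDiff_rpow_const_of_le (n := 1) (by exact_mod_cast hk)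
  have hpow' : ∀ k : ℝ, 1 ≤ k → ∀ t : ℝ, HasDerivAt (fun t : ℝ => t ^ k) (k * t ^ (k - 1)) t :=
    fun k hk t => Real.hasDerivAt_rpow_const (Or.inr hk)
  set γ : ℝ → R3 := fun t => !₂[p 0 + (A * t ^ s + B * t ^ r) / 2,
    p 1 + (A * t ^ s - B * t ^ r) / 2,
    p 2 + ((p 0 + p 1) * (B * t ^ r) - (p 0 - p 1) * (A * t ^ s)) / 4 +
      A * B / 4 * δ * t ^ (r + s)] with hγ
  have hγs : ContDiff ℝ 1 γ := by
    have h1 := hpow s hs1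
    have h2 := hpow r hr1
    have h3 := hpow (r + s) (by linarith)
    rw [contDiff_euclidean]
    intro k
    fin_cases k
    · change ContDiff ℝ 1 fun t => p 0 + (A * t ^ s + B * t ^ r) / 2
      fun_prop
    · change ContDiff ℝ 1 fun t => p 1 + (A * t ^ s - B * t ^ r) / 2
      fun_prop
    · change ContDiff ℝ 1 fun t => p 2 +
        ((p 0 + p 1) * (B * t ^ r) - (p 0 - p 1) * (A * t ^ s)) / 4 + A * B / 4 * δ * t ^ (r + s)
      fun_prop
  have hderiv : ∀ t k, (deriv γ t) k = deriv (fun t => γ t k) t := fun t k =>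
    (((EuclideanSpace.proj k : R3 →L[ℝ] ℝ).hasFDerivAt (x := γ t)).comp_hasDerivAt t
      (hγs.differentiable (by simp) t).hasDerivAt).deriv.symm
  have h01 : γ 0 = p ∧ γ 1 = q := by
    have e1 : (0 : ℝ) ^ s = 0 := Real.zero_rpow (by linarith)
    have e2 : (0 : ℝ) ^ r = 0 := Real.zero_rpow (by linarith)
    have e3 : (0 : ℝ) ^ (r + s) = 0 := Real.zero_rpow (by linarith)
    constructor
    · ext k
      fin_cases k <;> simp [hγ, e1, e2, e3]
    · have e4 : q 2 = p 2 + ((p 0 + p 1) * B - (p 0 - p 1) * A) / 4 + A * B / 4 * δ := by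
        rw [← hZδ, heightZ]
        ring
      ext k
      fin_cases k
      · simp [hγ, hAdef, hBdef, nullA, nullB]
        ring
      · simp [hγ, hAdef, hBdef, nullA, nullB]
        ring
      · simp [hγ, e4]
  rw [← h01.1, ← h01.2]
  refine ⟨γ, SubSpaceTime.isTimelikeFutureCurve_of_contDiff _ hγs fun t ht => ?_, rfl, rfl⟩
  have d0 : (deriv γ t) 0 = (A * (s * t ^ (s - 1)) + B * (r * t ^ (r - 1))) / 2 := by
    rw [hderiv]
    exact (((((hpow' s hs1 t).const_mul A).add ((hpow' r hr1 t).const_mul B)).div_const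
      2).const_add (p 0)).deriv
  have d1 : (deriv γ t) 1 = (A * (s * t ^ (s - 1)) - B * (r * t ^ (r - 1))) / 2 := by
    rw [hderiv]
    exact (((((hpow' s hs1 t).const_mul A).sub ((hpow' r hr1 t).const_mul B)).div_const
      2).const_add (p 1)).deriv
  have d2 : (deriv γ t) 2 = ((p 0 + p 1) * (B * (r * t ^ (r - 1))) -
      (p 0 - p 1) * (A * (s * t ^ (s - 1)))) / 4 +
        A * B / 4 * δ * ((r + s) * t ^ (r + s - 1)) := by
    rw [hderiv]
    exact ((((((hpow' r hr1 t).const_mul B).const_mul (p 0 + p 1)).sub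
      (((hpow' s hs1 t).const_mul A).const_mul (p 0 - p 1))).div_const 4).const_add (p 2)).add
        ((hpow' (r + s) (by linarith) t).const_mul (A * B / 4 * δ)) |>.deriv
  have hu : 0 < t ^ (s - 1) := Real.rpow_pos_of_pos ht.1 _
  have hv : 0 < t ^ (r - 1) := Real.rpow_pos_of_pos ht.1 _
  have e1 : t ^ s = t ^ (s - 1) * t := by
    rw [Real.rpow_sub_one ht.1.ne']
    field_simp [ht.1.ne']
  have e2 : t ^ r = t ^ (r - 1) * t := by
    rw [Real.rpow_sub_one ht.1.ne']
    field_simp [ht.1.ne']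
  have e3 : t ^ (r + s - 1) = t ^ (s - 1) * t ^ (r - 1) * t := by
    rw [show r + s - 1 = r + (s - 1) by ring, Real.rpow_add ht.1, e2]
    ring
  refine isFutureTimelike_heisenberg_iff.2 ⟨?_, ?_⟩
  · rw [d0, d1, d2, e3]
    change _ = _ * ((p 1 + (A * t ^ s - B * t ^ r) / 2) / 2) -
      _ * ((p 0 + (A * t ^ s + B * t ^ r) / 2) / 2)
    rw [e1, e2]
    linear_combination A * B / 4 * t ^ (s - 1) * t ^ (r - 1) * t * hsr
  · have f1 : 0 < A * (s * t ^ (s - 1)) := by positivity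
    have f2 : 0 < B * (r * t ^ (r - 1)) := by positivity
    rw [d0, d1, abs_lt]
    constructor <;> linarith

/-- The chronological relation of the Heisenberg group. -/
theorem chron_heisenberg_iff {p q : R3} : heisenbergSpaceTime.Chron p q ↔
    0 < nullA p q ∧ 0 < nullB p q ∧ 4 * |heightZ p q| < nullA p q * nullB p q :=
  ⟨chron_heisenberg_necessary, fun h => chron_heisenberg_sufficient h.1 h.2.1 h.2.2⟩

theorem isOpen_heisenberg_chronFuture (p : R3) : IsOpen (heisenbergSpaceTime.chronFuture p) := by
  have h : heisenbergSpaceTime.chronFuture p = {q | 0 < nullA p q} ∩ ({q | 0 < nullB p q} ∩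
      {q | 4 * |heightZ p q| < nullA p q * nullB p q}) := by
    ext q
    exact chron_heisenberg_iff
  rw [h]
  unfold heightZ nullA nullB
  exact (isOpen_lt (by fun_prop) (by fun_prop)).inter
    ((isOpen_lt (by fun_prop) (by fun_prop)).inter (isOpen_lt (by fun_prop) (by fun_prop)))

theorem isOpen_heisenberg_chronPast (p : R3) : IsOpen (heisenbergSpaceTime.chronPast p) := by
  have h : heisenbergSpaceTime.chronPast p = {q | 0 < nullA q p} ∩ ({q | 0 < nullB q p} ∩
      {q | 4 * |heightZ q p| < nullA q p * nullB q p}) := by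
    ext q
    exact chron_heisenberg_iff
  rw [h]
  unfold heightZ nullA nullB
  exact (isOpen_lt (by fun_prop) (by fun_prop)).inter
    ((isOpen_lt (by fun_prop) (by fun_prop)).inter (isOpen_lt (by fun_prop) (by fun_prop)))

theorem chron_heisenberg_flow (p : R3) {ε : ℝ} (hε : 0 < ε) :
    heisenbergSpaceTime.Chron p !₂[p 0 + ε, p 1, p 2 + p 1 * ε / 2] := by
  refine chron_heisenberg_sufficient ?_ ?_ ?_
  · simpa [nullA] using hε
  · simpa [nullB] using hε
  · have h : heightZ p !₂[p 0 + ε, p 1, p 2 + p 1 * ε / 2] = 0 := by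
      simp [heightZ, nullA, nullB]
      ring
    rw [h, abs_zero, mul_zero]
    exact mul_pos (by simpa [nullA] using hε) (by simpa [nullB] using hε)

/-- The chronological diamonds around the flow lines of `T` form a neighbourhood basis. -/
theorem exists_heisenberg_diamond {U : Set R3} (hU : IsOpen U) {p : R3} (hp : p ∈ U) :
    ∃ p₁ p₂, p ∈ heisenbergSpaceTime.chronFuture p₁ ∩ heisenbergSpaceTime.chronPast p₂ ∧
      heisenbergSpaceTime.chronFuture p₁ ∩ heisenbergSpaceTime.chronPast p₂ ⊆ U := by
  obtain ⟨η, hη, hbox⟩ := exists_box_subset hU hp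
  set C : ℝ := |p 0| + 2 * |p 1| + 4 with hC
  have hC0 : 4 ≤ C := by have := abs_nonneg (p 0); have := abs_nonneg (p 1); linarith
  set ε : ℝ := min 1 (η / C) with hε
  have hε0 : 0 < ε := lt_min one_pos (by positivity)
  have hε1 : ε ≤ 1 := min_le_left _ _
  have hεη : ε * C ≤ η := by
    have := min_le_right 1 (η / C)
    rwa [← hε, le_div_iff₀ (by linarith)] at this
  refine ⟨!₂[p 0 - ε, p 1, p 2 - p 1 * ε / 2], !₂[p 0 + ε, p 1, p 2 + p 1 * ε / 2],
    ⟨?_, chron_heisenberg_flow p hε0⟩, ?_⟩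
  · have := chron_heisenberg_flow !₂[p 0 - ε, p 1, p 2 - p 1 * ε / 2] hε0
    have e : (!₂[p 0 - ε + ε, p 1, p 2 - p 1 * ε / 2 + p 1 * ε / 2] : R3) = p := by
      ext k
      fin_cases k <;> simp
    change heisenbergSpaceTime.Chron _ p
    have h2 : heisenbergSpaceTime.Chron !₂[p 0 - ε, p 1, p 2 - p 1 * ε / 2]
      !₂[p 0 - ε + ε, p 1, p 2 - p 1 * ε / 2 + p 1 * ε / 2] := this
    rwa [e] at h2
  · rintro q ⟨hq1, hq2⟩
    obtain ⟨a1, b1, z1⟩ := chron_heisenberg_necessary hq1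
    obtain ⟨a2, b2, -⟩ := chron_heisenberg_necessary hq2
    simp only [nullA, nullB, heightZ, Matrix.cons_val_zero, Matrix.cons_val_one,
      Matrix.cons_val] at a1 b1 z1 a2 b2
    set a : ℝ := q 0 + q 1 - (p 0 - ε + p 1) with ha
    set b : ℝ := q 0 - q 1 - (p 0 - ε - p 1) with hb
    have a3 : a < 2 * ε := by linarith
    have b3 : b < 2 * ε := by linarith
    have hab : a * b ≤ 4 * ε := by nlinarith
    obtain ⟨z2, z3⟩ := abs_lt.1 ((lt_div_iff₀' (by norm_num : (0:ℝ) < 4)).2 z1)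
    have hx := abs_le.1 (le_refl |p 0|)
    have hy := abs_le.1 (le_refl |p 1|)
    have hq1' : |q 1 - p 1| < 2 * ε := abs_lt.2 ⟨by linarith, by linarith⟩
    have hεC : ε * 4 ≤ ε * C := mul_le_mul_of_nonneg_left hC0 hε0.le
    refine hbox q (abs_lt.2 ⟨by linarith, by linarith⟩) (abs_lt.2 ⟨by linarith, by linarith⟩) ?_
    -- `q 2 - p 2` is the height of `q` over `p₁`, which `z1` bounds by `ε`, plus terms that are
    -- linear in `q 0 - p 0` and `q 1 - p 1`
    have e1 : |p 1 * (q 0 - p 0)| ≤ |p 1| * (2 * ε) := by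
      rw [abs_mul]
      refine mul_le_mul_of_nonneg_left (abs_le.2 ⟨by linarith, by linarith⟩) (abs_nonneg _)
    have e2 : |p 0 * (q 1 - p 1)| ≤ |p 0| * (2 * ε) := by
      rw [abs_mul]
      exact mul_le_mul_of_nonneg_left hq1'.le (abs_nonneg _)
    have e3 : |ε * (q 1 - p 1)| ≤ 2 * ε := by
      rw [abs_mul, abs_of_pos hε0]
      nlinarith [abs_nonneg (q 1 - p 1)]
    have e1' := abs_le.1 e1
    have e2' := abs_le.1 e2
    have e3' := abs_le.1 e3
    have key : q 2 - p 2 = (q 2 - (p 2 - p 1 * ε / 2) - ((p 0 - ε + p 1) * b -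
        (p 0 - ε - p 1) * a) / 4) +
        (p 1 * (q 0 - p 0) - p 0 * (q 1 - p 1) + ε * (q 1 - p 1)) / 2 := by
      rw [ha, hb]
      ring
    have hfin : 3 * ε + |p 1| * ε + |p 0| * ε < η := by
      have : ε * C = |p 0| * ε + 2 * (|p 1| * ε) + 4 * ε := by rw [hC]; ring
      have := mul_nonneg (abs_nonneg (p 1)) hε0.le
      linarith
    rw [abs_lt]
    constructor <;> linarith

theorem alexandrovOpens_heisenberg : heisenbergSpaceTime.alexandrovOpens = manifoldOpens R3 := by
  apply Subset.antisymm
  · refine le_generateFrom (t := (inferInstance : TopologicalSpace R3)) ?_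
    rintro _ ⟨p, rfl | rfl⟩
    exacts [isOpen_heisenberg_chronFuture p, isOpen_heisenberg_chronPast p]
  · intro U hU
    change IsOpen[heisenbergSpaceTime.alexandrov] U
    refine (@isOpen_iff_forall_mem_open _ heisenbergSpaceTime.alexandrov U).2 fun p hp => ?_
    obtain ⟨p₁, p₂, hm, hs⟩ := exists_heisenberg_diamond hU hp
    have h1 : IsOpen[heisenbergSpaceTime.alexandrov] (heisenbergSpaceTime.chronFuture p₁) :=
      .basic _ ⟨p₁, Or.inl rfl⟩
    have h2 : IsOpen[heisenbergSpaceTime.alexandrov] (heisenbergSpaceTime.chronPast p₂) :=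
      .basic _ ⟨p₂, Or.inr rfl⟩
    exact ⟨_, hs, TopologicalSpace.GenerateOpen.inter _ _ h1 h2, hm⟩

/-- Every point precedes some translate of every other point: the product of the differences of the
null coordinates grows quadratically in the number of translations, and the height linearly. -/
theorem exists_chron_heisenbergShift (φ : ℝ) (p q : R3) :
    ∃ m : ℤ, heisenbergSpaceTime.Chron p (heisenbergShift φ m q) := by
  set c := Real.cosh φ
  set s := Real.sinh φ
  have hcs : c ^ 2 - s ^ 2 = 1 := Real.cosh_sq_sub_sinh_sq φ
  have hE : 0 < c + s := by rw [Real.cosh_add_sinh]; exact Real.exp_pos φ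
  have hE' : 0 < c - s := by rw [Real.cosh_sub_sinh]; exact Real.exp_pos (-φ)
  -- the rates of change of the height and of the product of the null coordinates, apart from `k²`
  set L : ℝ := -(q 1 * c - q 0 * s) / 2 - ((p 0 + p 1) * (c - s) - (p 0 - p 1) * (c + s)) / 4
  set b₀ : ℝ := nullA p q * (c - s) + nullB p q * (c + s)
  have hquad : ∀ b d : ℝ, ∀ᶠ k : ℕ in Filter.atTop, 0 < (k : ℝ) ^ 2 + k * b + d := by
    intro b d
    obtain ⟨K, hK⟩ := exists_nat_gt (|b| + |d| + 1)
    filter_upwards [Filter.eventually_ge_atTop K] with k hk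
    have hk' : |b| + |d| + 1 < k := hK.trans_le (by exact_mod_cast hk)
    have h1 := neg_abs_le b
    have h2 := neg_abs_le d
    have h3 := abs_nonneg b
    have h4 := abs_nonneg d
    nlinarith
  have hlin : ∀ a b : ℝ, 0 < a → ∀ᶠ k : ℕ in Filter.atTop, 0 < b + k * a := by
    intro a b ha
    obtain ⟨K, hK⟩ := exists_nat_gt (-b / a)
    filter_upwards [Filter.eventually_ge_atTop K] with k hk
    have hk' : -b / a < k := hK.trans_le (by exact_mod_cast hk)
    rw [div_lt_iff₀ ha] at hk'
    linarith
  obtain ⟨k, h1, h2, h3, h4⟩ := ((hlin _ (nullA p q) hE).and ((hlin _ (nullB p q) hE').and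
    ((hquad (b₀ - 4 * L) (nullA p q * nullB p q - 4 * heightZ p q)).and
      (hquad (b₀ + 4 * L) (nullA p q * nullB p q + 4 * heightZ p q))))).exists
  refine ⟨-k, chron_heisenberg_iff.2 ?_⟩
  have eA : nullA p (heisenbergShift φ (-k) q) = nullA p q + k * (c + s) := by
    simp [nullA, heisenbergShift, c, s, -Real.cosh_add_sinh]
    ring
  have eB : nullB p (heisenbergShift φ (-k) q) = nullB p q + k * (c - s) := by
    simp [nullB, heisenbergShift, c, s, -Real.cosh_sub_sinh]
    ring
  have eZ : heightZ p (heisenbergShift φ (-k) q) = heightZ p q + k * L := by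
    rw [heightZ, eA, eB]
    simp [heightZ, heisenbergShift, L, c, s]
    ring
  rw [eA, eB, eZ]
  refine ⟨h1, h2, ?_⟩
  have e1 : (nullA p q + k * (c + s)) * (nullB p q + k * (c - s)) =
      (k : ℝ) ^ 2 + k * b₀ + nullA p q * nullB p q := by
    simp only [b₀]
    linear_combination (k : ℝ) ^ 2 * hcs
  rw [← lt_div_iff₀' (by norm_num : (0 : ℝ) < 4), abs_lt, e1]
  constructor <;> linarith

/-- In the quotient every point precedes every other one, so the Alexandrov topology is
indiscrete. -/
theorem alexandrovOpens_ssubset_of_heisenberg_quotient {φ : ℝ}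
    [ChartedSpace (EuclideanSpace ℝ (Fin 3)) (OrbitSpace (heisenbergAction φ))]
    [IsManifold (𝓡 3) ∞ (OrbitSpace (heisenbergAction φ))]
    {S' : SubSpaceTime 3 (OrbitSpace (heisenbergAction φ))}
    (hq : heisenbergSpaceTime.IsQuotientBy (heisenbergAction φ) S'
      (OrbitSpace.proj (heisenbergAction φ)))
    (h : ∀ p q, S'.Chron (OrbitSpace.proj (heisenbergAction φ) p)
        (OrbitSpace.proj (heisenbergAction φ) q) ↔
        ∃ m : ℤ, heisenbergSpaceTime.Chron p (heisenbergShift φ m q)) :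
    S'.alexandrovOpens ⊂ manifoldOpens (OrbitSpace (heisenbergAction φ)) := by
  have hsurj : Function.Surjective (OrbitSpace.proj (heisenbergAction φ)) :=
    hq.isCovering.surjective
  have hall : ∀ x y, S'.Chron x y := fun x y => by
    obtain ⟨p, rfl⟩ := hsurj x
    obtain ⟨q, rfl⟩ := hsurj y
    exact (h p q).2 (exists_chron_heisenbergShift φ p q)
  have htriv : ∀ U, IsOpen[S'.alexandrov] U → U = ∅ ∨ U = univ := by
    have h1 : (⊤ : TopologicalSpace (OrbitSpace (heisenbergAction φ))) ≤ S'.alexandrov := by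
      refine le_generateFrom ?_
      rintro _ ⟨p, rfl | rfl⟩
      · exact (TopologicalSpace.isOpen_top_iff _).2 (Or.inr (eq_univ_of_forall fun y => hall p y))
      · exact (TopologicalSpace.isOpen_top_iff _).2 (Or.inr (eq_univ_of_forall fun y => hall y p))
    exact fun U hU => (TopologicalSpace.isOpen_top_iff _).1 (h1 U hU)
  refine ⟨fun U hU => ?_, fun hsub => ?_⟩
  · rcases htriv U hU with rfl | rfl
    exacts [(isOpen_empty : IsOpen (∅ : Set (OrbitSpace (heisenbergAction φ)))),
      (isOpen_univ : IsOpen (univ : Set (OrbitSpace (heisenbergAction φ))))]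
  · have := S'.hausdorff
    let _ : AddAction ℤ R3 := heisenbergAction φ
    set π : R3 → OrbitSpace (heisenbergAction φ) := OrbitSpace.proj (heisenbergAction φ)
    have hne : π !₂[0, 0, 1] ≠ π 0 := fun he => by
      obtain ⟨m, hm⟩ := hq.isCovering.apply_eq_iff_mem_orbit.1 he
      have hm' : heisenbergShift φ m 0 = !₂[0, 0, 1] := hm
      have := congrArg (fun v : R3 => v 2) hm'
      simp [heisenbergShift] at this
    have hopen : IsOpen ({π 0}ᶜ : Set (OrbitSpace (heisenbergAction φ))) := isOpen_compl_singleton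
    have hmem : π !₂[0, 0, 1] ∈ ({π 0}ᶜ : Set (OrbitSpace (heisenbergAction φ))) := hne
    rcases htriv _ (hsub hopen) with h0 | h0
    · rw [h0] at hmem
      exact hmem
    · exact (h0 ▸ mem_univ (π 0) : π 0 ∈ ({π 0}ᶜ : Set (OrbitSpace (heisenbergAction φ)))) rfl

/-! ### The Martinet distribution -/

section Martinet

variable {γ : ℝ → R3} {s t : ℝ}

theorem martinet_abs_lt (hγ : martinetSpaceTime.IsTimelikeFutureCurve γ) (hs : 0 ≤ s)
    (hst : s < t) (ht : t ≤ 1) : |γ t 0 - γ s 0| < γ t 1 - γ s 1 := by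
  have h1 := hγ.lt_of_hasFDerivAt (h := fun q => q 1 - q 0) (by fun_prop)
    (fun q => (hasFDerivAt_coord 1 q).sub (hasFDerivAt_coord 0 q)) hs hst ht fun u _ w hw => by
      have := (abs_lt.1 (isFutureTimelike_martinet_iff.1 hw).2).2
      change 0 < w 1 - w 0
      linarith
  have h2 := hγ.lt_of_hasFDerivAt (h := fun q => q 1 + q 0) (by fun_prop)
    (fun q => (hasFDerivAt_coord 1 q).add (hasFDerivAt_coord 0 q)) hs hst ht fun u _ w hw => by
      have := (abs_lt.1 (isFutureTimelike_martinet_iff.1 hw).2).1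
      change 0 < w 1 + w 0
      linarith
  simp only at h1 h2
  exact abs_lt.2 ⟨by linarith, by linarith⟩

/-- Where `c ≤ x²`, the form `dz - c dy` is nonnegative on future directed timelike vectors. -/
theorem martinet_sub_le (hγ : martinetSpaceTime.IsTimelikeFutureCurve γ) (hs : 0 ≤ s)
    (hst : s ≤ t) (ht : t ≤ 1) {c : ℝ} (hc : ∀ u ∈ Ioo s t, c ≤ γ u 0 ^ 2) :
    c * (γ t 1 - γ s 1) ≤ γ t 2 - γ s 2 := by
  have h1 := hγ.le_of_hasFDerivAt (h := fun q => q 2 - c * q 1) (by fun_prop)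
    (fun q => (hasFDerivAt_coord 2 q).sub ((hasFDerivAt_coord 1 q).const_mul c)) hs hst ht
    fun u hu w hw => by
      obtain ⟨h2, h3⟩ := isFutureTimelike_martinet_iff.1 hw
      change 0 ≤ w 2 - c * w 1
      rw [h2]
      nlinarith [hc u hu, abs_nonneg (w 0)]
  simp only at h1
  linarith

/-- As `z' = x² y'` with `y' > 0`, the coordinate `z` does not decrease along timelike curves. -/
theorem martinet_height_le (hγ : martinetSpaceTime.IsTimelikeFutureCurve γ) (hs : 0 ≤ s)
    (hst : s ≤ t) (ht : t ≤ 1) : γ s 2 ≤ γ t 2 := by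
  have := martinet_sub_le hγ hs hst ht (c := 0) fun u _ => sq_nonneg _
  linarith

theorem continuousOn_coord (hγ : martinetSpaceTime.IsTimelikeFutureCurve γ) (k : Fin 3) :
    ContinuousOn (fun u => γ u k) (Icc 0 1) :=
  (EuclideanSpace.proj k : R3 →L[ℝ] ℝ).continuous.comp_continuousOn hγ.1.1

theorem chron_martinet_height_le {p q : R3} (h : martinetSpaceTime.Chron p q) : p 2 ≤ q 2 := by
  obtain ⟨γ, hγ, rfl, rfl⟩ := h
  exact martinet_height_le hγ le_rfl zero_le_one le_rfl

theorem chron_martinet_abs_lt {p q : R3} (h : martinetSpaceTime.Chron p q) :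
    |q 0 - p 0| < q 1 - p 1 := by
  obtain ⟨γ, hγ, rfl, rfl⟩ := h
  exact martinet_abs_lt hγ le_rfl one_pos le_rfl

/-- A timelike curve that starts off the plane `x = 0` and advances by `δ` in the direction of `y`
gains height, as it needs time to reach this plane. -/
theorem chron_martinet_gain {p q : R3} (h : martinetSpaceTime.Chron p q) {δ : ℝ} (hδ0 : 0 ≤ δ)
    (hδ : δ ≤ |p 0| / 2) (hpq : δ ≤ q 1 - p 1) : (p 0 / 2) ^ 2 * δ ≤ q 2 - p 2 := by
  obtain ⟨γ, hγ, rfl, rfl⟩ := h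
  obtain ⟨t, ht, hty⟩ : γ 0 1 + δ ∈ (fun u => γ u 1) '' Icc 0 1 :=
    intermediate_value_Icc zero_le_one (continuousOn_coord hγ 1) ⟨by linarith, by linarith⟩
  have hty' : γ t 1 = γ 0 1 + δ := hty
  have h1 := martinet_sub_le hγ le_rfl ht.1 ht.2 (c := (γ 0 0 / 2) ^ 2) fun u hu => by
    have hu1 := martinet_abs_lt hγ le_rfl hu.1 (hu.2.le.trans ht.2)
    have hu2 := (abs_nonneg _).trans (martinet_abs_lt hγ hu.1.le hu.2 ht.2).le
    refine sq_le_sq.2 ?_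
    rw [abs_div, abs_of_pos (two_pos : (0 : ℝ) < 2)]
    have := abs_sub_abs_le_abs_sub (γ 0 0) (γ u 0)
    rw [abs_sub_comm] at this
    linarith
  have h2 := martinet_height_le hγ ht.1 ht.2 le_rfl
  rw [hty', add_sub_cancel_left] at h1
  linarith

/-- A timelike curve that does not gain height stays in the plane `x = 0`. -/
theorem martinet_eq_zero_of_height_le (hγ : martinetSpaceTime.IsTimelikeFutureCurve γ)
    (h : γ 1 2 ≤ γ 0 2) {u : ℝ} (hu : u ∈ Icc (0 : ℝ) 1) : γ u 0 = 0 := by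
  have key : ∀ u ∈ Ico (0 : ℝ) 1, γ u 0 = 0 := by
    intro u hu
    by_contra hne
    -- after `u` the curve stays off the plane for a while and gains height
    have hd : ∃ t ∈ Ioc u 1, γ t 1 - γ u 1 ≤ |γ u 0| / 2 := by
      have hpos : 0 < |γ u 0| / 2 := by positivity
      have hcont := (continuousOn_coord hγ 1 u ⟨hu.1, hu.2.le⟩).mono_left
        (nhdsWithin_mono u (Ioc_subset_Icc_self.trans (Icc_subset_Icc_left hu.1) :
          Ioc u 1 ⊆ Icc 0 1))
      have hev : ∀ᶠ t in 𝓝[Ioc u 1] u, γ t 1 < γ u 1 + |γ u 0| / 2 :=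
        hcont.eventually_lt_const (by linarith)
      have : (𝓝[Ioc u 1] u).NeBot := by
        rw [nhdsWithin_Ioc_eq_nhdsGT hu.2]
        infer_instance
      obtain ⟨t, ht1, ht2⟩ := (hev.and self_mem_nhdsWithin).exists
      exact ⟨t, ht2, by linarith⟩
    obtain ⟨t, ht, hty⟩ := hd
    have h1 := martinet_sub_le hγ hu.1 ht.1.le ht.2 (c := (γ u 0 / 2) ^ 2) fun v hv => by
      have hv1 := martinet_abs_lt hγ hu.1 hv.1 (hv.2.le.trans ht.2)
      have hv2 := (abs_nonneg _).trans (martinet_abs_lt hγ (hu.1.trans hv.1.le) hv.2 ht.2).le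
      refine sq_le_sq.2 ?_
      rw [abs_div, abs_of_pos (two_pos : (0 : ℝ) < 2)]
      have := abs_sub_abs_le_abs_sub (γ u 0) (γ v 0)
      rw [abs_sub_comm] at this
      linarith
    have h2 := (abs_nonneg _).trans_lt (martinet_abs_lt hγ hu.1 ht.1 ht.2)
    have h3 : 0 < (γ u 0 / 2) ^ 2 := by positivity
    have h4 := martinet_height_le hγ le_rfl hu.1 hu.2.le
    have h5 := martinet_height_le hγ (hu.1.trans ht.1.le) ht.2 le_rfl
    have h6 := mul_pos h3 h2
    linarith
  rcases hu.2.lt_or_eq with hu1 | rfl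
  · exact key u ⟨hu.1, hu1⟩
  · have h2 : Filter.Tendsto (fun u => γ u 0) (𝓝[Ico 0 1] 1) (𝓝 (γ 1 0)) :=
      (continuousOn_coord hγ 0 1 hu).mono_left (nhdsWithin_mono _ Ico_subset_Icc_self)
    have : (𝓝[Ico (0 : ℝ) 1] 1).NeBot := by
      rw [nhdsWithin_Ico_eq_nhdsLT one_pos]
      infer_instance
    refine tendsto_nhds_unique (h2.congr' ?_) tendsto_const_nhds
    filter_upwards [self_mem_nhdsWithin] with v hv using key v hv

/-- The flow of `T` of the Martinet distribution. -/
def martinetFlow (p : R3) (s : ℝ) : R3 := !₂[p 0, p 1 + s, p 2 + p 0 ^ 2 * s]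

theorem martinetFlow_zero (p : R3) : martinetFlow p 0 = p := by
  ext k
  fin_cases k <;> simp [martinetFlow]

theorem isTimelikeFutureCurve_martinetFlow (p : R3) {a b : ℝ} (hab : a < b) :
    martinetSpaceTime.IsTimelikeFutureCurve fun t => martinetFlow p (a + t * (b - a)) := by
  have hc : ContDiff ℝ 1 fun t : ℝ => martinetFlow p (a + t * (b - a)) := by
    rw [contDiff_euclidean]
    intro k
    fin_cases k
    · change ContDiff ℝ 1 fun _ : ℝ => p 0
      fun_prop
    · change ContDiff ℝ 1 fun t : ℝ => p 1 + (a + t * (b - a))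
      fun_prop
    · change ContDiff ℝ 1 fun t : ℝ => p 2 + p 0 ^ 2 * (a + t * (b - a))
      fun_prop
  refine SubSpaceTime.isTimelikeFutureCurve_of_contDiff _ hc fun t _ => ?_
  have hderiv : ∀ k, (deriv (fun t => martinetFlow p (a + t * (b - a))) t) k =
      deriv (fun t => martinetFlow p (a + t * (b - a)) k) t := fun k =>
    (((EuclideanSpace.proj k : R3 →L[ℝ] ℝ).hasFDerivAt).comp_hasDerivAt t
      (hc.differentiable (by simp) t).hasDerivAt).deriv.symm
  have hid : HasDerivAt (fun t => a + t * (b - a)) (b - a) t := by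
    simpa using ((hasDerivAt_id t).mul_const (b - a)).const_add a
  have d0 : (deriv (fun t => martinetFlow p (a + t * (b - a))) t) 0 = 0 :=
    (hderiv 0).trans (hasDerivAt_const t (p 0)).deriv
  have d1 : (deriv (fun t => martinetFlow p (a + t * (b - a))) t) 1 = b - a :=
    (hderiv 1).trans (hid.const_add (p 1)).deriv
  have d2 : (deriv (fun t => martinetFlow p (a + t * (b - a))) t) 2 = p 0 ^ 2 * (b - a) :=
    (hderiv 2).trans ((hid.const_mul (p 0 ^ 2)).const_add (p 2)).deriv
  refine isFutureTimelike_martinet_iff.2 ⟨?_, ?_⟩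
  · rw [d1, d2]
    change _ = _ * p 0 ^ 2
    ring
  · rw [d0, d1, abs_zero]
    linarith

theorem chron_martinetFlow (p : R3) {a b : ℝ} (hab : a < b) :
    martinetSpaceTime.Chron (martinetFlow p a) (martinetFlow p b) :=
  ⟨_, isTimelikeFutureCurve_martinetFlow p hab, by simp, by simp⟩

theorem chron_slitFlow (p : R3) {a b : ℝ} (hab : a < b)
    (h : ∀ s ∈ Icc a b, martinetFlow p s ∈ slitSpace) :
    slitSpaceTime.Chron ⟨martinetFlow p a, h a (left_mem_Icc.2 hab.le)⟩
      ⟨martinetFlow p b, h b (right_mem_Icc.2 hab.le)⟩ := by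
  have hmem : ∀ t : Icc (0 : ℝ) 1, martinetFlow p (a + t * (b - a)) ∈ slitSpace := fun t =>
    h _ ⟨by nlinarith [t.2.1], by nlinarith [t.2.2]⟩
  refine ⟨fun t => ⟨_, hmem (projIcc 0 1 zero_le_one t)⟩, ?_, ?_, ?_⟩
  · refine (isTimelikeFutureCurve_martinetFlow p hab).lift isLocalDiffeomorph_subtypeVal
      preservesFuture_subtypeVal ?_ fun s hs => ?_
    · refine Continuous.continuousOn (Continuous.subtype_mk ?_ _)
      unfold martinetFlow
      have := continuous_subtype_val.comp (continuous_projIcc (h := zero_le_one (α := ℝ)))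
      fun_prop
    · rw [projIcc_of_mem _ hs]
  · refine Subtype.ext ?_
    change martinetFlow p (a + (projIcc (0 : ℝ) 1 zero_le_one 0 : ℝ) * (b - a)) = _
    rw [projIcc_left]
    simp
  · refine Subtype.ext ?_
    change martinetFlow p (a + (projIcc (0 : ℝ) 1 zero_le_one 1 : ℝ) * (b - a)) = _
    rw [projIcc_right]
    simp

theorem chron_martinet_of_slit {p q : slitSpace} (h : slitSpaceTime.Chron p q) :
    martinetSpaceTime.Chron p.1 q.1 :=
  h.map isLocalDiffeomorph_subtypeVal preservesFuture_subtypeVal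

/-- A timelike curve of the slit space that does not gain height stays in the plane `x = 0`, hence
it cannot cross the removed lines. -/
theorem chron_slit_not_crossing {p q : slitSpace} (h : slitSpaceTime.Chron p q)
    (hz : q.1 2 ≤ p.1 2) (k : ℤ) (h1 : p.1 1 ≤ 2 * k) (h2 : 2 * k ≤ q.1 1) : False := by
  obtain ⟨γ, hγ, rfl, rfl⟩ := h
  have hγ' := hγ.map isLocalDiffeomorph_subtypeVal preservesFuture_subtypeVal
  obtain ⟨u, hu, huk⟩ : (2 * k : ℝ) ∈ (fun u => (γ u).1 1) '' Icc 0 1 :=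
    intermediate_value_Icc zero_le_one (continuousOn_coord hγ' 1) ⟨h1, h2⟩
  exact (γ u).2 ⟨k, martinet_eq_zero_of_height_le hγ' hz hu, huk⟩

theorem mem_slitSpace_of_ne_zero {p : R3} (h : p 0 ≠ 0) : p ∈ slitSpace := fun ⟨_, h0, _⟩ => h h0

theorem mem_slitSpace_of_lt {p : R3} (k : ℤ) (h1 : 2 * k < p 1) (h2 : p 1 < 2 * k + 2) :
    p ∈ slitSpace := by
  rintro ⟨j, -, hj⟩
  rw [hj] at h1 h2
  have h3 : k < j := by exact_mod_cast (by linarith : (k : ℝ) < j)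
  have h4 : j < k + 1 := by exact_mod_cast (by linarith : (j : ℝ) < k + 1)
  omega

/-- Every neighbourhood of `p` in the slit space contains all points that lie between `p₁` and some
translate of `p₂`, for suitable points `p₁ ≪ p ≪ p₂` of the flow line of `T` through `p`. Off the
plane `x = 0` a timelike curve from `p₁` gains too much height unless it is short; a timelike curve
between points of the plane `x = 0` with the same height is confined by the removed lines. -/
theorem exists_slit_diamond {V : Set slitSpace} (hV : IsOpen V) {p : slitSpace} (hp : p ∈ V) :
    ∃ p₁ p₂ : slitSpace, slitSpaceTime.Chron p₁ p ∧ slitSpaceTime.Chron p p₂ ∧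
      ∀ (q : slitSpace) (m : ℤ), slitSpaceTime.Chron p₁ q →
        slitSpaceTime.Chron q (slitShiftAction.toVAdd.vadd m p₂) → q ∈ V := by
  obtain ⟨η, hη, hbox⟩ := exists_box_subset (slitSpace.isOpen.isOpenMap_subtype_val V hV)
    (mem_image_of_mem _ hp)
  have hbox' : ∀ q : slitSpace, |q.1 0 - p.1 0| < η → |q.1 1 - p.1 1| < η →
      |q.1 2 - p.1 2| < η → q ∈ V := fun q h0 h1 h2 => by
    obtain ⟨q', hq', he⟩ := hbox q h0 h1 h2
    rwa [← Subtype.ext he]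
  have hflow : ∀ (ε : ℝ), 0 < ε → (∀ s ∈ Icc (-ε) ε, martinetFlow p s ∈ slitSpace) →
      ∃ p₁ p₂ : slitSpace, p₁.1 = martinetFlow p (-ε) ∧ p₂.1 = martinetFlow p ε ∧
        slitSpaceTime.Chron p₁ p ∧ slitSpaceTime.Chron p p₂ := by
    intro ε hε h
    have h1 := chron_slitFlow p.1 (neg_lt_zero.2 hε)
      fun s hs => h s ⟨hs.1, hs.2.trans hε.le⟩
    have h2 := chron_slitFlow p.1 hε fun s hs => h s ⟨by linarith [hs.1], hs.2⟩
    refine ⟨⟨_, h _ ⟨le_rfl, by linarith⟩⟩, ⟨_, h _ ⟨by linarith, le_rfl⟩⟩, rfl, rfl, ?_, ?_⟩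
    · convert h1
      exact (martinetFlow_zero _).symm
    · convert h2
      exact (martinetFlow_zero _).symm
  have hz : ∀ (ε : ℝ) (p₁ p₂ q : slitSpace) (m : ℤ), p₁.1 = martinetFlow p (-ε) →
      p₂.1 = martinetFlow p ε → slitSpaceTime.Chron p₁ q →
      slitSpaceTime.Chron q (slitShiftAction.toVAdd.vadd m p₂) →
      p.1 2 - p.1 0 ^ 2 * ε ≤ q.1 2 ∧ q.1 2 ≤ p.1 2 + p.1 0 ^ 2 * ε ∧
        |q.1 0 - p.1 0| < q.1 1 - (p.1 1 - ε) := by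
    intro ε p₁ p₂ q m e1 e2 h1 h2
    have h3 := chron_martinet_height_le (chron_martinet_of_slit h1)
    have h4 := chron_martinet_height_le (chron_martinet_of_slit h2)
    have h5 := chron_martinet_abs_lt (chron_martinet_of_slit h1)
    change q.1 2 ≤ p₂.1 2 at h4
    rw [e1] at h3 h5
    rw [e2] at h4
    change p.1 2 + p.1 0 ^ 2 * (-ε) ≤ q.1 2 at h3
    change |q.1 0 - p.1 0| < q.1 1 - (p.1 1 + -ε) at h5
    exact ⟨by linarith, h4, by linarith⟩
  by_cases hx : p.1 0 = 0
  · -- `p` lies between the planes `y = 2 k` and `y = 2 k + 2`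
    set k : ℤ := ⌊p.1 1 / 2⌋
    have hk1 : (2 * k : ℝ) < p.1 1 := by
      have h1 : (k : ℝ) ≤ p.1 1 / 2 := Int.floor_le _
      rcases (by linarith : (2 * k : ℝ) ≤ p.1 1).lt_or_eq with h | h
      · exact h
      · exact (p.2 ⟨k, hx, h.symm⟩).elim
    have hk2 : p.1 1 < 2 * k + 2 := by
      have : p.1 1 / 2 < k + 1 := Int.lt_floor_add_one _
      linarith
    set ε : ℝ := min (η / 2) (min ((p.1 1 - 2 * k) / 2) ((2 * k + 2 - p.1 1) / 2))
    have hε : 0 < ε := lt_min (by linarith) (lt_min (by linarith) (by linarith))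
    have hε1 : ε ≤ η / 2 := min_le_left _ _
    have hε2 : ε ≤ (p.1 1 - 2 * k) / 2 := (min_le_right _ _).trans (min_le_left _ _)
    have hε3 : ε ≤ (2 * k + 2 - p.1 1) / 2 := (min_le_right _ _).trans (min_le_right _ _)
    obtain ⟨p₁, p₂, e1, e2, h1, h2⟩ := hflow ε hε fun s hs => by
      refine mem_slitSpace_of_lt k ?_ ?_
      · change _ < p.1 1 + s
        linarith [hs.1]
      · change p.1 1 + s < _
        linarith [hs.2]
    refine ⟨p₁, p₂, h1, h2, fun q m hq1 hq2 => ?_⟩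
    obtain ⟨z1, z2, z3⟩ := hz ε p₁ p₂ q m e1 e2 hq1 hq2
    rw [hx] at z1 z2
    have hm : m ≤ 0 := by
      by_contra hm
      have hm' : (1 : ℝ) ≤ m := by exact_mod_cast (by omega : 1 ≤ m)
      refine chron_slit_not_crossing (slitSpaceTime.chron_trans hq1 hq2) ?_ (k + 1) ?_ ?_
      · change p₂.1 2 ≤ p₁.1 2
        rw [e1, e2]
        change p.1 2 + p.1 0 ^ 2 * ε ≤ p.1 2 + p.1 0 ^ 2 * (-ε)
        rw [hx]
        linarith
      · rw [e1]
        change p.1 1 + -ε ≤ _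
        push_cast
        linarith
      · change _ ≤ p₂.1 1 + 2 * m
        rw [e2]
        change _ ≤ p.1 1 + ε + 2 * m
        push_cast
        linarith
    have hm' : (m : ℝ) ≤ 0 := by exact_mod_cast hm
    have h5 := (abs_nonneg _).trans_lt (chron_martinet_abs_lt (chron_martinet_of_slit hq2))
    change 0 < p₂.1 1 + 2 * m - q.1 1 at h5
    rw [e2] at h5
    change 0 < p.1 1 + ε + 2 * m - q.1 1 at h5
    have h6 := (abs_nonneg _).trans_lt z3
    exact hbox' q (by linarith) (abs_lt.2 ⟨by linarith, by linarith⟩)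
      (abs_lt.2 ⟨by linarith, by linarith⟩)
  · set δ : ℝ := min (|p.1 0| / 2) (η / 2)
    have hx2 : 0 < p.1 0 ^ 2 := by positivity
    have hδ : 0 < δ := lt_min (by positivity) (by positivity)
    have hδ1 : δ ≤ |p.1 0| / 2 := min_le_left _ _
    have hδ2 : δ ≤ η / 2 := min_le_right _ _
    -- a curve from `p₁` that is longer than `δ` gains at least `(p 0)² δ / 4`, which exceeds the
    -- height `2 (p 0)² ε` of `p₂` over `p₁`
    set ε : ℝ := min (δ / 16) (η / (2 * p.1 0 ^ 2))
    have hε : 0 < ε := lt_min (by positivity) (by positivity)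
    have hε1 : ε ≤ δ / 16 := min_le_left _ _
    have hε2 : p.1 0 ^ 2 * ε ≤ η / 2 := by
      have : ε ≤ η / (2 * p.1 0 ^ 2) := min_le_right _ _
      rw [le_div_iff₀ (by positivity)] at this
      linarith
    obtain ⟨p₁, p₂, e1, e2, h1, h2⟩ := hflow ε hε fun s _ => mem_slitSpace_of_ne_zero hx
    refine ⟨p₁, p₂, h1, h2, fun q m hq1 hq2 => ?_⟩
    obtain ⟨z1, z2, z3⟩ := hz ε p₁ p₂ q m e1 e2 hq1 hq2
    have hlt : q.1 1 - (p.1 1 - ε) < δ := by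
      by_contra hge
      have h3 := chron_martinet_gain (chron_martinet_of_slit hq1) hδ.le (by rw [e1]; exact hδ1) (by
        rw [e1]
        change δ ≤ q.1 1 - (p.1 1 + -ε)
        linarith)
      rw [e1] at h3
      change (p.1 0 / 2) ^ 2 * δ ≤ q.1 2 - (p.1 2 + p.1 0 ^ 2 * (-ε)) at h3
      have h4 : p.1 0 ^ 2 * ε ≤ p.1 0 ^ 2 * (δ / 16) := mul_le_mul_of_nonneg_left hε1 hx2.le
      have h5 : 0 < p.1 0 ^ 2 * δ := mul_pos hx2 hδ
      linarith
    have h6 := (abs_nonneg _).trans_lt z3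
    exact hbox' q (by linarith) (abs_lt.2 ⟨by linarith, by linarith⟩)
      (abs_lt.2 ⟨by linarith, by linarith⟩)

/-- The sets of `exists_slit_diamond` project to Alexandrov neighbourhoods. The future of a point of
the plane `x = 0` is not open, as it contains points of the plane with the same height, but none
below. -/
theorem manifoldOpens_ssubset_of_slit_quotient
    [ChartedSpace (EuclideanSpace ℝ (Fin 3)) (OrbitSpace slitShiftAction)]
    [IsManifold (𝓡 3) ∞ (OrbitSpace slitShiftAction)]
    {S' : SubSpaceTime 3 (OrbitSpace slitShiftAction)}
    (hq : slitSpaceTime.IsQuotientBy slitShiftAction S' (OrbitSpace.proj slitShiftAction))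
    (h : ∀ p q, S'.Chron (OrbitSpace.proj slitShiftAction p) (OrbitSpace.proj slitShiftAction q) ↔
      ∃ m : ℤ, slitSpaceTime.Chron p (slitShiftAction.toVAdd.vadd m q)) :
    manifoldOpens (OrbitSpace slitShiftAction) ⊂ S'.alexandrovOpens := by
  let _ : AddAction ℤ slitSpace := slitShiftAction
  set π : slitSpace → OrbitSpace slitShiftAction := OrbitSpace.proj slitShiftAction
  have hsurj : Function.Surjective π := hq.isCovering.surjective
  have hcont : Continuous π := hq.isLocalDiffeo.contMDiff.continuous
  have hinv : ∀ (m : ℤ) (q : slitSpace), π (m +ᵥ q) = π q := fun m q =>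
    hq.isCovering.apply_eq_iff_mem_orbit.2 ⟨m, rfl⟩
  have hproj : ∀ {p q}, slitSpaceTime.Chron p q → S'.Chron (π p) (π q) := fun {p q} hpq =>
    (h p q).2 ⟨0, by rwa [show slitShiftAction.toVAdd.vadd 0 q = q from zero_vadd ℤ q]⟩
  refine ⟨fun U hU => ?_, fun hsub => ?_⟩
  · change IsOpen[S'.alexandrov] U
    refine (@isOpen_iff_forall_mem_open _ S'.alexandrov U).2 fun x hx => ?_
    obtain ⟨p, rfl⟩ := hsurj x
    have hU' : IsOpen U := hU
    obtain ⟨p₁, p₂, h1, h2, h3⟩ := exists_slit_diamond (hU'.preimage hcont) (p := p) hx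
    have o1 : IsOpen[S'.alexandrov] (S'.chronFuture (π p₁)) := .basic _ ⟨π p₁, Or.inl rfl⟩
    have o2 : IsOpen[S'.alexandrov] (S'.chronPast (π p₂)) := .basic _ ⟨π p₂, Or.inr rfl⟩
    refine ⟨_, ?_, TopologicalSpace.GenerateOpen.inter _ _ o1 o2, hproj h1, hproj h2⟩
    rintro y ⟨hy1, hy2⟩
    obtain ⟨q, rfl⟩ := hsurj y
    obtain ⟨m, hm⟩ := (h _ _).1 hy1
    change S'.Chron (π q) (π p₂) at hy2
    rw [← hinv m q] at hy2 ⊢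
    obtain ⟨m', hm'⟩ := (h _ _).1 hy2
    exact h3 _ m' hm hm'
  · have hflow : ∀ s ∈ Icc (1 / 2 : ℝ) 1, martinetFlow 0 s ∈ slitSpace := fun s hs =>
      mem_slitSpace_of_lt 0 (by simp [martinetFlow]; linarith [hs.1])
        (by simp [martinetFlow]; linarith [hs.2])
    have hchron := chron_slitFlow 0 (by norm_num) hflow
    set a : slitSpace := ⟨martinetFlow 0 (1 / 2), hflow _ (by norm_num)⟩
    set b : slitSpace := ⟨martinetFlow 0 1, hflow _ (by norm_num)⟩
    have o1 : IsOpen (S'.chronFuture (π a)) :=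
      hsub (show S'.chronFuture (π a) ∈ S'.alexandrovOpens from .basic _ ⟨π a, Or.inl rfl⟩)
    obtain ⟨η, hη, hbox⟩ := exists_box_subset
      (slitSpace.isOpen.isOpenMap_subtype_val _ (o1.preimage hcont))
      (mem_image_of_mem _ (show b ∈ π ⁻¹' S'.chronFuture (π a) from hproj hchron))
    obtain ⟨q, hq1, hq2⟩ := hbox !₂[0, 1, -(η / 2)] (by simp [b, martinetFlow, hη])
      (by simp [b, martinetFlow, hη]) (by
        simp only [b, martinetFlow, Matrix.cons_val, PiLp.zero_apply]
        rw [abs_lt]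
        constructor <;> simp <;> linarith)
    obtain ⟨m, hm⟩ := (h _ _).1 hq1
    have hz := chron_martinet_height_le (chron_martinet_of_slit hm)
    change (0 : ℝ) + 0 ^ 2 * (1 / 2) ≤ q.1 2 at hz
    rw [hq2] at hz
    simp at hz
    linarith

/-- The flow lines of `T` in the plane `x = 0` are closed in the quotient, and two points of a
closed timelike curve have the same Alexandrov neighbourhoods. The future of a point of the plane
is not open, as it contains points of the plane with the same height, but none below. -/
theorem not_subset_of_martinet_quotient
    [ChartedSpace (EuclideanSpace ℝ (Fin 3)) (OrbitSpace unitShiftAction)]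
    [IsManifold (𝓡 3) ∞ (OrbitSpace unitShiftAction)]
    {S' : SubSpaceTime 3 (OrbitSpace unitShiftAction)}
    (hq : martinetSpaceTime.IsQuotientBy unitShiftAction S' (OrbitSpace.proj unitShiftAction))
    (h : ∀ p q, S'.Chron (OrbitSpace.proj unitShiftAction p) (OrbitSpace.proj unitShiftAction q) ↔
      ∃ m : ℤ, martinetSpaceTime.Chron p (shiftY m q)) :
    ¬ manifoldOpens (OrbitSpace unitShiftAction) ⊆ S'.alexandrovOpens ∧
      ¬ S'.alexandrovOpens ⊆ manifoldOpens (OrbitSpace unitShiftAction) := by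
  let _ : AddAction ℤ R3 := unitShiftAction
  set π : R3 → OrbitSpace unitShiftAction := OrbitSpace.proj unitShiftAction
  have hcont : Continuous π := hq.isLocalDiffeo.contMDiff.continuous
  have hproj : ∀ {p q}, martinetSpaceTime.Chron p q → S'.Chron (π p) (π q) := fun {p q} hpq =>
    (h p q).2 ⟨0, by rwa [show shiftY ((0 : ℤ) : ℝ) q = q from zero_vadd ℤ q]⟩
  set a : R3 := martinetFlow 0 0
  set b : R3 := martinetFlow 0 (1 / 2)
  set c : R3 := martinetFlow 0 1
  have hab : S'.Chron (π a) (π b) := hproj (chron_martinetFlow 0 (by norm_num))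
  have hbc : S'.Chron (π b) (π c) := hproj (chron_martinetFlow 0 (by norm_num))
  have hca : π c = π a := hq.isCovering.apply_eq_iff_mem_orbit.2 ⟨1, by
    change shiftY ((1 : ℤ) : ℝ) a = c
    ext k
    fin_cases k <;> simp [shiftY, a, c, martinetFlow]⟩
  constructor
  · intro hsub
    -- the points `π a` and `π b` lie on a closed timelike curve
    have hmem : ∀ U, IsOpen[S'.alexandrov] U → π a ∈ U → π b ∈ U := by
      intro U hU
      induction hU with
      | basic U hU =>
        obtain ⟨x, rfl | rfl⟩ := hU
        · exact fun hx => S'.chron_trans hx hab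
        · intro hx
          have hba : S'.Chron (π b) (π a) := hca ▸ hbc
          exact S'.chron_trans hba hx
      | univ => exact fun _ => mem_univ _
      | inter U V _ _ hU hV => exact fun hx => ⟨hU hx.1, hV hx.2⟩
      | sUnion 𝒰 _ ih => exact fun ⟨V, hV, hx⟩ => ⟨V, hV, ih V hV hx⟩
    have := S'.hausdorff
    have hopen : IsOpen ({π b}ᶜ : Set (OrbitSpace unitShiftAction)) := isOpen_compl_singleton
    refine hmem _ (hsub hopen) (fun he => ?_) rfl
    obtain ⟨m, hm⟩ := hq.isCovering.apply_eq_iff_mem_orbit.1 he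
    have hm' : shiftY m b = a := hm
    have h1 := congrArg (fun v : R3 => v 1) hm'
    simp [shiftY, a, b, martinetFlow] at h1
    have h2 : (1 + 2 * m : ℝ) = 0 := by linarith
    have h3 : 1 + 2 * m = 0 := by exact_mod_cast h2
    omega
  · intro hsub
    have o1 : IsOpen (S'.chronFuture (π a)) :=
      hsub (show S'.chronFuture (π a) ∈ S'.alexandrovOpens from .basic _ ⟨π a, Or.inl rfl⟩)
    obtain ⟨η, hη, hbox⟩ := exists_box_subset (o1.preimage hcont)
      (show c ∈ π ⁻¹' S'.chronFuture (π a) from S'.chron_trans hab hbc)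
    have hmem := hbox !₂[0, 1, -(η / 2)] (by simp [c, martinetFlow, hη])
      (by simp [c, martinetFlow, hη]) (by
        simp only [c, martinetFlow, Matrix.cons_val, PiLp.zero_apply]
        rw [abs_lt]
        constructor <;> simp <;> linarith)
    obtain ⟨m, hm⟩ := (h _ _).1 hmem
    have hz := chron_martinet_height_le hm
    simp [a, martinetFlow, shiftY] at hz
    linarith

end Martinet

end SubLorentz

end

/-- For sub-space-times all relations between the Alexandrov topology and the manifold topology
occur: (1) equal, (2) Alexandrov strictly coarser, (3) Alexandrov strictly finer,
(4) incomparable; each on an explicit example with a proper distribution. -/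
theorem mainTheorem1 :
    -- (1) the Lorentzian Heisenberg group
    (∃ S : SubLorentz.SubSpaceTime 3 SubLorentz.R3,
      S.IsFramedBy SubLorentz.heisenbergT SubLorentz.heisenbergY ∧
      S.alexandrovOpens = SubLorentz.manifoldOpens SubLorentz.R3) ∧
    -- (2) its quotient by the discrete group of isometries with parameter `φ`
    (∀ φ : ℝ, ∃ S : SubLorentz.SubSpaceTime 3 SubLorentz.R3,
      S.IsFramedBy SubLorentz.heisenbergT SubLorentz.heisenbergY ∧
      ∃ (_ : ChartedSpace (EuclideanSpace ℝ (Fin 3))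
            (SubLorentz.OrbitSpace (SubLorentz.heisenbergAction φ)))
        (_ : IsManifold (𝓡 3) ∞ (SubLorentz.OrbitSpace (SubLorentz.heisenbergAction φ)))
        (S' : SubLorentz.SubSpaceTime 3 (SubLorentz.OrbitSpace (SubLorentz.heisenbergAction φ))),
        S.IsQuotientBy (SubLorentz.heisenbergAction φ) S'
          (SubLorentz.OrbitSpace.proj (SubLorentz.heisenbergAction φ)) ∧
        S'.alexandrovOpens ⊂
          SubLorentz.manifoldOpens (SubLorentz.OrbitSpace (SubLorentz.heisenbergAction φ))) ∧
    -- (3) the quotient of the slit space by the translations `(x, y, z) ↦ (x, y + 2 m, z)`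
    (∃ S : SubLorentz.SubSpaceTime 3 SubLorentz.slitSpace,
      S.IsFramedBy SubLorentz.slitT SubLorentz.slitX ∧
      ∃ (_ : ChartedSpace (EuclideanSpace ℝ (Fin 3))
            (SubLorentz.OrbitSpace SubLorentz.slitShiftAction))
        (_ : IsManifold (𝓡 3) ∞ (SubLorentz.OrbitSpace SubLorentz.slitShiftAction))
        (S' : SubLorentz.SubSpaceTime 3 (SubLorentz.OrbitSpace SubLorentz.slitShiftAction)),
        S.IsQuotientBy SubLorentz.slitShiftAction S'
          (SubLorentz.OrbitSpace.proj SubLorentz.slitShiftAction) ∧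
        SubLorentz.manifoldOpens (SubLorentz.OrbitSpace SubLorentz.slitShiftAction) ⊂
          S'.alexandrovOpens) ∧
    -- (4) the quotient of `ℝ³` by the translations `(x, y, z) ↦ (x, y + m, z)`
    (∃ S : SubLorentz.SubSpaceTime 3 SubLorentz.R3,
      S.IsFramedBy SubLorentz.martinetT SubLorentz.martinetX ∧
      ∃ (_ : ChartedSpace (EuclideanSpace ℝ (Fin 3))
            (SubLorentz.OrbitSpace SubLorentz.unitShiftAction))
        (_ : IsManifold (𝓡 3) ∞ (SubLorentz.OrbitSpace SubLorentz.unitShiftAction))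
        (S' : SubLorentz.SubSpaceTime 3 (SubLorentz.OrbitSpace SubLorentz.unitShiftAction)),
        S.IsQuotientBy SubLorentz.unitShiftAction S'
          (SubLorentz.OrbitSpace.proj SubLorentz.unitShiftAction) ∧
        ¬ SubLorentz.manifoldOpens (SubLorentz.OrbitSpace SubLorentz.unitShiftAction) ⊆
          S'.alexandrovOpens ∧
        ¬ S'.alexandrovOpens ⊆
          SubLorentz.manifoldOpens (SubLorentz.OrbitSpace SubLorentz.unitShiftAction)) := by
  refine ⟨⟨SubLorentz.heisenbergSpaceTime, SubLorentz.isFramedBy_heisenberg,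
    SubLorentz.alexandrovOpens_heisenberg⟩, fun φ => ⟨SubLorentz.heisenbergSpaceTime,
      SubLorentz.isFramedBy_heisenberg, ?_⟩, ⟨SubLorentz.slitSpaceTime,
      SubLorentz.isFramedBy_slit, ?_⟩, ⟨SubLorentz.martinetSpaceTime,
      SubLorentz.isFramedBy_martinet, ?_⟩⟩
  · obtain ⟨c, hM, S', hq, h⟩ := SubLorentz.exists_heisenberg_quotient φ
    exact ⟨c, hM, S', hq, SubLorentz.alexandrovOpens_ssubset_of_heisenberg_quotient hq h⟩
  · obtain ⟨c, hM, S', hq, h⟩ := SubLorentz.exists_slit_quotient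
    exact ⟨c, hM, S', hq, SubLorentz.manifoldOpens_ssubset_of_slit_quotient hq h⟩
  · obtain ⟨c, hM, S', hq, h⟩ := SubLorentz.exists_martinet_quotient
    exact ⟨c, hM, S', hq, SubLorentz.not_subset_of_martinet_quotient hq h⟩
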